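/- \textbf{Notation.} Put $x\ominus a=\frac{x-a}{1-a}$. All series lie in $\mathbb{Z}[[x_i,a_i : i\in\mathbb{Z}]]$ with coefficientwise convergence. Let $s_i$ exchange $x_i$ and $x_{i+1}$, and let $\tilde\pi_i f=(x_i-x_{i+1})^{-1}(1-s_i)\big((1-x_{i+1})f\big)$. For $w\in S_n$ the double Grothendieck polynomial $\mathfrak{G}_w(x;a)$ is given by $\mathfrak{G}_{w_0}(x;a)=\prod_{i+j\le n}(x_i\ominus a_j)$ for the longest element $w_0$, and $\mathfrak{G}_w=\tilde\pi_i\mathfrak{G}_{ws_i}$ if $w(i)<w(i+1)$. For a permutation $w$ of $\mathbb{Z}$ moving only integers in $[p,q]$, let $\mathfrak{G}_w^{[p,q]}(x;a)$ be the same polynomial computed with $[p,q]$, $x_p,\dots,x_q$, $a_p,\dots,a_q$ in place of $[1,n]$, $x_1,\dots,x_n$, $a_1,\dots,a_n$. Let $\hat\Lambda(x\|a)$ be the ring of series in $x_0,x_{-1},\dots$ over $\mathbb{Z}[[a_i : i\in\mathbb{Z}]]$ that are symmetric in the $x$-variables (equivalently, of formal power series in the $e_k(x/a)$ over $\mathbb{Z}[[a_i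 : i\in\mathbb{Z}]]$). The double back stable ring is $\hat\Lambda(x\|a)\otimes_{\mathbb{Z}}\mathbb{Z}[(1-x_i)^{\pm1}: i\in\mathbb{Z}]$. The back stable double Grothendieck polynomial $\overleftarrow{\mathfrak{G}}_w(x;a)$ is the element of this ring whose series is $\lim_{p\to-\infty,\,q\to\infty}\mathfrak{G}^{[p,q]}_w(x;a)$. Put $G_w(x\|a)=\eta_a(\overleftarrow{\mathfrak{G}}_w(x;a))$, where $\eta_a$ is the $\hat\Lambda(x\|a)$-algebra homomorphism from the double back stable ring to $\hat\Lambda(x\|a)$ with $x_i\mapsto a_i$. For a partition $\lambda$ with conjugate $\lambda'$ let $w_\lambda(i)=i+\lambda_{1-i}$ for $i\le0$ and $w_\lambda(i)=i-\lambda'_i$ for $i>0$. The Grassmannian double $K$-Stanley function is $G_\lambda(x\|a):=G_{w_\lambda}(x\|a)$. A \emph{$\lambda$-halfplane pipedream} is a tiling $D$ of the squares $(i,j)$, $i\le 0$, $j\in\mathbb{Z}$ (matrix coordinates: row $i$, column $j$), by the tiles: empty, NW elbow (joining the north and west sides), SE elbow (joining the south and east sides), horizontal line, vertical line (no crossings),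 such that pipes match along common edges; for all $N\ll0$ a pipe travels north in column $N$ to $(N,N)$, turns east there and continues in row $N$ towards $(N,\infty)$; pipes enter from the southern boundary exactly in the columns $w_\lambda(\mathbb{Z}_{\le0})$; and in every row $i\le0$ a pipe heads off towards $(i,\infty)$. Its weight is $$\mathrm{wt}(D)=\prod_{\text{empty tiles }(i,j)}\big(-(x_i\ominus a_j)\big)\prod_{\text{NW elbows }(i,j)}\big(1-(x_i\ominus a_j)\big).$$ \textbf{Theorem.} For every partition $\lambda$ the limit defining $\overleftarrow{\mathfrak{G}}_{w_\lambda}(x;a)$ exists and is the series of exactly one element of the double back stable ring, and $$G_\lambda(x\|a)=(-1)^{|\lambda|}\sum_D \mathrm{wt}(D),$$ summed over all $\lambda$-halfplane pipedreams. Moreover, $$G_\lambda(x\|a)=\sum_T\ \prod_{s=(i,j)\in\lambda}\Big((x_{T(s)}\ominus a_{T(s)+j-i})\prod_k\big(1-(x_k\ominus a_{k+j-i})\big)\Big),$$ where $T$ runs over the semistandard tableaux of shape $\lambda$ with entries in $\mathbb{Z}_{\le0}$ (rows weakly and columns strictly increasing), $s=(i,j)$ over the boxes of $\lambda$ in row $i$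 and column $j$, and $k\in\mathbb{Z}_{\le0}$ over the values with $T(s)<k$ such that replacing the entry of $T$ in box $s$ by $k$ gives a semistandard tableau. Both sums converge coefficientwise. -/

import Mathlib

open Filter Topology
open scoped MvPowerSeries.WithPiTopology

namespace KStanley

noncomputable section

/-! ### Power series in the variables `x_i` and `a_i`, with `i` an integer -/

/-- The ring `ℤ[[x_i, a_i : i ∈ ℤ]]` in which all computations take place. It carries the topology
of coefficientwise convergence (`ℤ` being discrete). -/
abbrev Series : Type := MvPowerSeries (ℤ ⊕ ℤ) ℤ

/-- The variable `x_i`. -/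
def x (i : ℤ) : Series := MvPowerSeries.X (Sum.inl i)

/-- The variable `a_i`. -/
def a (i : ℤ) : Series := MvPowerSeries.X (Sum.inr i)

/-- `1 - v` as a unit, for a variable `v`. -/
def oneSub (v : ℤ ⊕ ℤ) : Seriesˣ where
  val := 1 - MvPowerSeries.X v
  inv := MvPowerSeries.invOfUnit (1 - MvPowerSeries.X v) 1
  val_inv := MvPowerSeries.mul_invOfUnit _ _ (by simp)
  inv_val := MvPowerSeries.invOfUnit_mul _ _ (by simp)

/-- `x_i ⊖ a_j = (x_i - a_j) / (1 - a_j)`. -/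
def xMinusA (i j : ℤ) : Series := (x i - a j) * ((oneSub (Sum.inr j))⁻¹ : Seriesˣ)

/-- The action of the simple transposition `s_i` on the `x` variables: it exchanges `x_i` and
`x_{i+1}` and fixes every other variable. -/
def swapX (i : ℤ) : Series ≃ₐ[ℤ] Series :=
  MvPowerSeries.renameEquiv ℤ (Equiv.sumCongr (Equiv.swap i (i + 1)) (Equiv.refl ℤ))

/-- The shift `γ^m` of the variables: `x_i ↦ x_{i+m}`, `a_i ↦ a_{i+m}`. -/
def shiftSeries (m : ℤ) : Series ≃ₐ[ℤ] Series :=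
  MvPowerSeries.renameEquiv ℤ (Equiv.sumCongr (Equiv.addRight m) (Equiv.addRight m))

/-- The shift `γ^m` of permutations of `ℤ`: `γ^m(w)(j) = w(j - m) + m`, so that
`γ^m(s_i) = s_{i+m}`. -/
def shiftPerm (m : ℤ) (w : Equiv.Perm ℤ) : Equiv.Perm ℤ :=
  Equiv.addRight m * w * (Equiv.addRight m)⁻¹

/-! ### Double Grothendieck polynomials -/

/-- The Demazure operator
`f ↦ (x_i - x_{i+1})⁻¹ (1 - s_i) ((1 - x_{i+1}) f)` in the `x` variables. The division is exact,
and as `Series` is an integral domain the quotient is unique. -/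
def demazure (i : ℤ) (f : Series) : Series :=
  Classical.epsilon fun g : Series =>
    (x i - x (i + 1)) * g = (1 - x (i + 1)) * f - swapX i ((1 - x (i + 1)) * f)

/-- The longest element of `S_n`, as a permutation of `ℤ`: `i ↦ n + 1 - i` for `1 ≤ i ≤ n`. -/
def longest (n : ℤ) : Equiv.Perm ℤ :=
  Function.Involutive.toPerm (fun i => if 1 ≤ i ∧ i ≤ n then n + 1 - i else i) (by
    intro i
    dsimp only
    split_ifs <;> omega)

/-- `IsDoubleGrothendieck n w f`: the power series `f` is obtained as `𝔊_w(x;a)`, `w ∈ S_n`, from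
`𝔊_{w₀}(x;a) = ∏_{i+j ≤ n} (x_i ⊖ a_j)` and `𝔊_w = π_i 𝔊_{w s_i}` whenever `w s_i > w`
(that is, `w(i) < w(i+1)`). -/
inductive IsDoubleGrothendieck (n : ℤ) : Equiv.Perm ℤ → Series → Prop
  | top : IsDoubleGrothendieck n (longest n)
      (∏ p ∈ (Finset.Icc 1 n ×ˢ Finset.Icc 1 n).filter (fun p : ℤ × ℤ => p.1 + p.2 ≤ n),
        xMinusA p.1 p.2)
  | step (w : Equiv.Perm ℤ) (i : ℤ) (f : Series) (one_le : 1 ≤ i) (lt : i < n)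
      (ascent : w i < w (i + 1))
      (h : IsDoubleGrothendieck n (w * Equiv.swap i (i + 1)) f) :
      IsDoubleGrothendieck n w (demazure i f)

/-- The double Grothendieck polynomial `𝔊_w(x;a)` for `w ∈ S_n` (the operators `π_i` satisfy the
braid relations, so it is the only series with `IsDoubleGrothendieck n w`). -/
def doubleGrothendieck (n : ℤ) (w : Equiv.Perm ℤ) : Series :=
  Classical.epsilon (IsDoubleGrothendieck n w)

/-- `𝔊_w^{[p,q]}(x;a) = γ^{p-1} (𝔊_{γ^{1-p}(w)}(x;a))`, for an interval `[p,q]` that contains all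
the integers moved by `w`, so that `γ^{1-p}(w) ∈ S_{q-p+1}`. -/
def intervalGrothendieck (p q : ℤ) (w : Equiv.Perm ℤ) : Series :=
  shiftSeries (p - 1) (doubleGrothendieck (q - p + 1) (shiftPerm (1 - p) w))

/-! ### The double back stable ring and back stable double Grothendieck polynomials -/

/-- The ring `Λ̂(x‖a)` of (completed) double symmetric functions: the power series that involve
only the variables `x_0, x_{-1}, x_{-2}, …` and the `a_i`, and are symmetric in the `x` variables,
i.e. symmetric series in `x_{≤ 0}` with coefficients in `ℤ[[a_i : i ∈ ℤ]]`. These are the formal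
power series in the `e_k(x/a)` over `ℤ[[a]]`, since `e_k(x/a)` is `e_k(x_{≤ 0})` plus a
combination of the `e_l(x_{≤ 0})`, `l < k`, whose coefficients are homogeneous of degree `k - l`
in the `a_i`. -/
def symmSeries : Subring Series where
  carrier := {f | (∀ (m : ℤ ⊕ ℤ →₀ ℕ) (i : ℤ), 0 < i → m (Sum.inl i) ≠ 0 →
      MvPowerSeries.coeff m f = 0) ∧ ∀ i < 0, swapX i f = f}
  zero_mem' := ⟨fun _ _ _ _ => by simp, fun _ _ => map_zero _⟩
  one_mem' := by
    classical
    refine ⟨fun m i _ h => ?_, fun _ _ => map_one _⟩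
    rw [MvPowerSeries.coeff_one, if_neg]
    rintro rfl
    exact h rfl
  add_mem' := by
    rintro f g ⟨hf, hf2⟩ ⟨hg, hg2⟩
    refine ⟨fun m i hi h => ?_, fun i hi => ?_⟩
    · rw [map_add, hf m i hi h, hg m i hi h, add_zero]
    · rw [map_add, hf2 i hi, hg2 i hi]
  neg_mem' := by
    rintro f ⟨hf, hf2⟩
    refine ⟨fun m i hi h => ?_, fun i hi => ?_⟩
    · rw [map_neg, hf m i hi h, neg_zero]
    · rw [map_neg, hf2 i hi]
  mul_mem' := by
    classical
    rintro f g ⟨hf, hf2⟩ ⟨hg, hg2⟩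
    refine ⟨fun m i hi h => ?_, fun i hi => ?_⟩
    · rw [MvPowerSeries.coeff_mul]
      refine Finset.sum_eq_zero fun p hp => ?_
      replace hp : p.1 + p.2 = m := by simpa using hp
      have hm : m (Sum.inl i) = p.1 (Sum.inl i) + p.2 (Sum.inl i) := by
        rw [← hp, Finsupp.add_apply]
      by_cases h1 : p.1 (Sum.inl i) = 0
      · rw [hg p.2 i hi (by omega), mul_zero]
      · rw [hf p.1 i hi h1, zero_mul]
    · rw [map_mul, hf2 i hi, hg2 i hi]

/-- The double back stable ring `Λ̂(x‖a) ⊗_{R(a)} R(x;a) = Λ̂(x‖a) ⊗_ℤ R(x)`, where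
`R(x) = ℤ[(1 - x_i)^{±1} : i ∈ ℤ]` and `R(x;a) = R(x) ⊗ R(a)`: it is the ring of Laurent
polynomials over `Λ̂(x‖a)` in the quantities `1 - x_i`. The exponent vector `m` stands for
the Laurent monomial `∏_i (1 - x_i)^{m_i}`. -/
abbrev BackStableRing : Type := AddMonoidAlgebra symmSeries (ℤ →₀ ℤ)

/-- The Laurent monomial `∏_i (u_i)^{m_i}` in given units `u_i`. -/
def laurentMonomial (u : ℤ → Seriesˣ) : Multiplicative (ℤ →₀ ℤ) →* Series where
  toFun m := ((m.toAdd.prod fun i k => u i ^ k : Seriesˣ) : Series)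
  map_one' := by simp
  map_mul' m m' := by
    rw [toAdd_mul, Finsupp.prod_add_index' (by simp) (fun i k l => zpow_add (u i) k l),
      Units.val_mul]

/-- The `Λ̂(x‖a)`-algebra homomorphism on the double back stable ring with `1 - x_i ↦ u_i`. -/
def evalLaurent (u : ℤ → Seriesˣ) : BackStableRing →ₐ[symmSeries] Series :=
  AddMonoidAlgebra.lift symmSeries Series (ℤ →₀ ℤ) (laurentMonomial u)

/-- The power series represented by an element of the double back stable ring. -/
def toSeries : BackStableRing →ₐ[symmSeries] Series :=
  evalLaurent fun i => oneSub (Sum.inl i)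

/-- The homomorphism `η_a` from the double back stable ring to `Λ̂(x‖a)`: it sends `x_i` to `a_i`
for all `i ∈ ℤ` and is the identity on `Λ̂(x‖a)`. -/
def eta : BackStableRing →ₐ[symmSeries] Series :=
  evalLaurent fun i => oneSub (Sum.inr i)

/-- `F` is the limit of `𝔊_w^{[p,q]}(x;a)` for `p → -∞`, `q → ∞`. -/
def IsBackStableLimit (w : Equiv.Perm ℤ) (F : BackStableRing) : Prop :=
  Tendsto (fun pq : ℤ × ℤ => intervalGrothendieck pq.1 pq.2 w) (atBot ×ˢ atTop)
    (𝓝 (toSeries F))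

/-- The back stable double Grothendieck polynomial of `w`. -/
def backStableGrothendieck (w : Equiv.Perm ℤ) : BackStableRing :=
  Classical.epsilon (IsBackStableLimit w)

/-- The double `K`-Stanley function `G_w(x‖a)`. -/
def doubleKStanley (w : Equiv.Perm ℤ) : Series := eta (backStableGrothendieck w)

/-! ### Grassmannian permutations

Partitions are Young diagrams `μ`, with rows and columns numbered from `0`: thus
`λ_i = μ.rowLen (i - 1)` and `λ'_j = μ.colLen (j - 1)`. -/

/-- `w_λ(i) = i + λ_{1-i}` for `i ≤ 0` and `w_λ(i) = i - λ'_i` for `i > 0`. -/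
def grassmannianFun (μ : YoungDiagram) (i : ℤ) : ℤ :=
  if i ≤ 0 then i + μ.rowLen (-i).toNat else i - μ.colLen (i - 1).toNat

theorem grassmannianFun_row (μ : YoungDiagram) (r : ℕ) :
    grassmannianFun μ (-(r : ℤ)) = -(r : ℤ) + μ.rowLen r := by
  simp [grassmannianFun]

theorem grassmannianFun_col (μ : YoungDiagram) (c : ℕ) :
    grassmannianFun μ ((c : ℤ) + 1) = (c : ℤ) + 1 - μ.colLen c := by
  have h : ¬ ((c : ℤ) + 1 ≤ 0) := by omega
  simp [grassmannianFun, h]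

theorem row_ne_col (μ : YoungDiagram) (r c : ℕ) :
    -(r : ℤ) + μ.rowLen r ≠ (c : ℤ) + 1 - μ.colLen c := by
  have h1 := @YoungDiagram.mem_iff_lt_rowLen μ r c
  have h2 := @YoungDiagram.mem_iff_lt_colLen μ r c
  by_cases h : (r, c) ∈ μ
  · have := h1.1 h
    have := h2.1 h
    omega
  · have : ¬ c < μ.rowLen r := fun h' => h (h1.2 h')
    have : ¬ r < μ.colLen c := fun h' => h (h2.2 h')
    omega

theorem nonpos_or_pos (i : ℤ) : (∃ r : ℕ, i = -(r : ℤ)) ∨ ∃ c : ℕ, i = (c : ℤ) + 1 := by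
  by_cases h : i ≤ 0
  · exact Or.inl ⟨(-i).toNat, by omega⟩
  · exact Or.inr ⟨(i - 1).toNat, by omega⟩

theorem grassmannianFun_bijective (μ : YoungDiagram) :
    Function.Bijective (grassmannianFun μ) := by
  constructor
  · intro i j hij
    rcases nonpos_or_pos i with ⟨r, rfl⟩ | ⟨c, rfl⟩ <;>
      rcases nonpos_or_pos j with ⟨r', rfl⟩ | ⟨c', rfl⟩
    · simp only [grassmannianFun_row] at hij
      rcases lt_trichotomy r r' with h | h | h
      · have := μ.rowLen_anti r r' h.le
        omega
      · rw [h]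
      · have := μ.rowLen_anti r' r h.le
        omega
    · rw [grassmannianFun_row, grassmannianFun_col] at hij
      exact absurd hij (row_ne_col μ r c')
    · rw [grassmannianFun_row, grassmannianFun_col] at hij
      exact absurd hij.symm (row_ne_col μ r' c)
    · simp only [grassmannianFun_col] at hij
      rcases lt_trichotomy c c' with h | h | h
      · have := μ.colLen_anti c c' h.le
        omega
      · rw [h]
      · have := μ.colLen_anti c' c h.le
        omega
  · intro k
    have hex : ∃ r : ℕ, (μ.rowLen r : ℤ) - r ≤ k := by
      refine ⟨((μ.rowLen 0 : ℤ) - k).toNat, ?_⟩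
      have := μ.rowLen_anti 0 ((μ.rowLen 0 : ℤ) - k).toNat (Nat.zero_le _)
      omega
    classical
    obtain ⟨r, hr, hmin⟩ : ∃ r : ℕ, (μ.rowLen r : ℤ) - r ≤ k ∧
        ∀ s < r, ¬ (μ.rowLen s : ℤ) - s ≤ k :=
      ⟨Nat.find hex, Nat.find_spec hex, fun s hs => Nat.find_min hex hs⟩
    rcases hr.eq_or_lt with h | h
    · exact ⟨-(r : ℤ), by rw [grassmannianFun_row]; omega⟩
    · obtain ⟨c, hc⟩ : ∃ c : ℕ, (c : ℤ) = k + r - 1 := ⟨(k + r - 1).toNat, by omega⟩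
      refine ⟨(c : ℤ) + 1, ?_⟩
      rw [grassmannianFun_col]
      have h1 : ¬ r < μ.colLen c := fun h' => by
        have := YoungDiagram.mem_iff_lt_rowLen.1 (YoungDiagram.mem_iff_lt_colLen.2 h')
        omega
      have h2 : ∀ s : ℕ, s + 1 = r → s < μ.colLen c := fun s hs => by
        refine YoungDiagram.mem_iff_lt_colLen.1 (YoungDiagram.mem_iff_lt_rowLen.2 ?_)
        have := hmin s (by omega)
        omega
      rcases r with _ | s
      · omega
      · have := h2 s rfl
        omega

/-- The Grassmannian permutation `w_λ`. -/
def grassmannianPerm (μ : YoungDiagram) : Equiv.Perm ℤ :=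
  Equiv.ofBijective (grassmannianFun μ) (grassmannianFun_bijective μ)

/-- The Grassmannian double `K`-Stanley function `G_λ(x‖a) = G_{w_λ}(x‖a)`. -/
def grassmannianDoubleKStanley (μ : YoungDiagram) : Series :=
  doubleKStanley (grassmannianPerm μ)

/-- `I_{w,+} = ℤ_{>0} ∩ w(ℤ_{≤0})`. -/
def Iplus (w : Equiv.Perm ℤ) : Set ℤ := Set.Ioi 0 ∩ w '' Set.Iic 0

/-- `I_{w,-} = ℤ_{≤0} ∩ w(ℤ_{>0})`. -/
def Iminus (w : Equiv.Perm ℤ) : Set ℤ := Set.Iic 0 ∩ w '' Set.Ioi 0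

/-! ### Halfplane pipedreams -/

/-- The six tiles of bumpless pipedreams. The north-west elbow connects the north and west sides,
the south-east elbow connects the south and east sides. -/
inductive Tile
  | empty
  | nwElbow
  | seElbow
  | horizontal
  | crossing
  | vertical

/-- Does a pipe of the tile touch the north side? -/
def Tile.north : Tile → Prop
  | .empty => False
  | .nwElbow => True
  | .seElbow => False
  | .horizontal => False
  | .crossing => True
  | .vertical => True

/-- Does a pipe of the tile touch the south side? -/
def Tile.south : Tile → Prop
  | .empty => False
  | .nwElbow => False
  | .seElbow => True
  | .horizontal => False
  | .crossing => True
  | .vertical => True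

/-- Does a pipe of the tile touch the east side? -/
def Tile.east : Tile → Prop
  | .empty => False
  | .nwElbow => False
  | .seElbow => True
  | .horizontal => True
  | .crossing => True
  | .vertical => False

/-- Does a pipe of the tile touch the west side? -/
def Tile.west : Tile → Prop
  | .empty => False
  | .nwElbow => True
  | .seElbow => False
  | .horizontal => True
  | .crossing => True
  | .vertical => False

/-- A `λ`-halfplane pipedream: a bumpless pipedream in the upper halfplane `ℤ_{≤0} × ℤ` (matrix
coordinates: `tile i j` is in row `i` and column `j`, rows increase downwards). -/
structure HalfplanePipedream (μ : YoungDiagram) where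
  tile : ℤ → ℤ → Tile
  /-- Rows with positive index are not part of the halfplane; `tile` has a dummy value there. -/
  outside : ∀ i j, 0 < i → tile i j = .empty
  /-- Pipes continue across the vertical edges. -/
  match_horizontal : ∀ i j, i ≤ 0 → ((tile i j).east ↔ (tile i (j + 1)).west)
  /-- Pipes continue across the horizontal edges. -/
  match_vertical : ∀ i j, i ≤ 0 → ((tile i j).north ↔ (tile (i - 1) j).south)
  /-- For all `N ≪ 0` there is a pipe that travels north in column `N` to the square `(N, N)`,
  where it turns east and travels towards `(N, ∞)`. -/
  far_away : ∃ N₀ ≤ 0, ∀ N ≤ N₀, tile N N = .seElbow ∧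
    (∀ i, N < i → i ≤ 0 → tile i N = .vertical) ∧ ∀ j, N < j → tile N j = .horizontal
  no_crossing : ∀ i j, i ≤ 0 → tile i j ≠ .crossing
  /-- The pipes entering from the southern boundary do so in the columns `I` with
  `I ∩ ℤ_{>0} = I_{w_λ,+}` and `ℤ_{≤0} \ I = I_{w_λ,-}`. -/
  south_plus : {j | (tile 0 j).south} ∩ Set.Ioi 0 = Iplus (grassmannianPerm μ)
  south_minus : Set.Iic 0 \ {j | (tile 0 j).south} = Iminus (grassmannianPerm μ)
  /-- In every row `i ≤ 0` there is a pipe heading towards `(i, ∞)`. -/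
  exits_east : ∀ i ≤ 0, ∃ N, ∀ j ≥ N, (tile i j).east

namespace HalfplanePipedream

variable {μ : YoungDiagram}

theorem finite_tiles (D : HalfplanePipedream μ) :
    {p : ℤ × ℤ | p.1 ≤ 0 ∧ (D.tile p.1 p.2 = .empty ∨ D.tile p.1 p.2 = .nwElbow)}.Finite := by
  obtain ⟨N₀, hN₀, hfar⟩ := D.far_away
  choose! M hM using D.exits_east
  have hfin : (⋃ i ∈ Set.Icc N₀ 0, ({i} ×ˢ Set.Icc N₀ (M i) : Set (ℤ × ℤ))).Finite :=
    (Set.finite_Icc N₀ 0).biUnion fun i _ => (Set.finite_singleton i).prod (Set.finite_Icc _ _)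
  refine hfin.subset ?_
  rintro ⟨i, j⟩ ⟨hi, h⟩
  dsimp only at hi h
  have hne : D.tile i j ≠ .seElbow ∧ D.tile i j ≠ .vertical ∧ D.tile i j ≠ .horizontal := by
    rcases h with h | h <;> simp [h]
  have hj : N₀ ≤ j := by
    by_contra hlt
    rcases lt_trichotomy i j with h' | h' | h'
    · exact hne.2.2 ((hfar i (by omega)).2.2 j h')
    · subst h'
      exact hne.1 (hfar i (by omega)).1
    · exact hne.2.1 ((hfar j (by omega)).2.1 i h' hi)
  have hi' : N₀ ≤ i := by
    by_contra hlt
    exact hne.2.2 ((hfar i (by omega)).2.2 j (by omega))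
  have hj' : j ≤ M i := by
    by_contra hlt
    have he := hM i hi j (by omega)
    rcases h with h | h <;> simp [h, Tile.east] at he
  simp only [Set.mem_iUnion]
  exact ⟨i, ⟨hi', hi⟩, by simp [hj, hj']⟩

/-- The positions of the empty tiles. -/
def emptyTiles (D : HalfplanePipedream μ) : Finset (ℤ × ℤ) :=
  (show {p : ℤ × ℤ | p.1 ≤ 0 ∧ D.tile p.1 p.2 = .empty}.Finite from
    D.finite_tiles.subset fun _ h => ⟨h.1, Or.inl h.2⟩).toFinset

/-- The positions of the north-west elbows. -/
def nwElbows (D : HalfplanePipedream μ) : Finset (ℤ × ℤ) :=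
  (show {p : ℤ × ℤ | p.1 ≤ 0 ∧ D.tile p.1 p.2 = .nwElbow}.Finite from
    D.finite_tiles.subset fun _ h => ⟨h.1, Or.inr h.2⟩).toFinset

/-- `wt(D) = ∏_{empty tiles (i,j)} (-(x_i ⊖ a_j)) ∏_{NW elbows (i,j)} (1 - (x_i ⊖ a_j))`. -/
def weight (D : HalfplanePipedream μ) : Series :=
  (∏ p ∈ D.emptyTiles, -xMinusA p.1 p.2) * ∏ p ∈ D.nwElbows, (1 - xMinusA p.1 p.2)

end HalfplanePipedream

/-! ### Semistandard tableaux with nonpositive entries -/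

/-- A filling of `μ` is semistandard: rows weakly increase from left to right, columns strictly
increase from top to bottom. -/
def IsSemistandard (μ : YoungDiagram) (T : ℕ × ℕ → ℤ) : Prop :=
  (∀ i j₁ j₂ : ℕ, j₁ < j₂ → (i, j₂) ∈ μ → T (i, j₁) ≤ T (i, j₂)) ∧
    ∀ i₁ i₂ j : ℕ, i₁ < i₂ → (i₂, j) ∈ μ → T (i₁, j) < T (i₂, j)

/-- A semistandard tableau of shape `μ` with entries in `ℤ_{≤0}`. As a function it is set to `0`
outside `μ`. -/
structure NonposTableau (μ : YoungDiagram) where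
  entry : ℕ × ℕ → ℤ
  semistandard : IsSemistandard μ entry
  nonpos : ∀ s ∈ μ, entry s ≤ 0
  zero_outside : ∀ s, s ∉ μ → entry s = 0

/-- The weight `x_k ⊖ a_{k+j-i}` of an entry `k` in the box `s = (i, j)`. -/
def boxWeight (k : ℤ) (s : ℕ × ℕ) : Series := xMinusA k (k + s.2 - s.1)

open Classical in
/-- The values `k ≤ 0` with `T(s) < k` such that replacing the entry of `T` in the box `s` by `k`
results in a semistandard tableau. -/
def NonposTableau.raises {μ : YoungDiagram} (T : NonposTableau μ) (s : ℕ × ℕ) : Finset ℤ :=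
  (Finset.Ioc (T.entry s) 0).filter fun k => IsSemistandard μ (Function.update T.entry s k)

/-- The factored weight of a tableau. -/
def NonposTableau.weight {μ : YoungDiagram} (T : NonposTableau μ) : Series :=
  ∏ s ∈ μ.cells, (boxWeight (T.entry s) s * ∏ k ∈ T.raises s, (1 - boxWeight k s))

end

end KStanley

namespace KStanley

/-! ### Permuting the variables -/

/-! Polynomials, tableaux and pipedreams are all governed by the same objects: chains of partitions
descending from λ to the empty partition in which consecutive shapes interlace, i.e. differ by
horizontal strips. Step t uses the variable x_{-t}. A box in row k and column c (numbered from 0)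
that is removed in it contributes x_{-t} ⊖ a_{-t+c-k}. The last remaining box of a row contributes 1
- (x_{-t} ⊖ a_{-t+c-k}) if it could already have been removed in that step.

Algebra. The permutation w_λ has no descent except possibly at 0, so on the interval [1-m, q],
shifted to start at 1, its polynomial is symmetric in x_1, …, x_m. With ρ = ∏ (1 - x_j)^{j-1}, the
antisymmetrization of ρf does not change when f is replaced by a Demazure image of f
(`alt_rho_demazure`). Hence w may be replaced by its product with the longest element of S_m. That
product is dominant, and its polynomial is a product of factors x_i ⊖ a_j
(`doubleGrothendieck_dominant`). The outcome is a bialternant formula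
(`doubleGrothendieck_mul_vdm`). Splitting off the last variable by column operations and a
telescoping identity expands the determinant over interlacing partitions (`bialternant_branching`).
Iteration gives the sum over the chains that are empty after m steps
(`intervalGrothendieck_grassmannianPerm`).

Limit. A chain that is not yet empty at step m has a factor x_{-t} ⊖ a_{-t} with t ≥ m, so each
coefficient is eventually constant as the interval grows. The limit is symmetric in x_{≤0} and free
of x_{>0}; it therefore lies in Λ̂(x‖a) and η_a does not change it. The representing element of the
back stable ring is unique because the 1 - x_i are algebraically independent over Λ̂(x‖a)
(`toSeries_injective`).

Combinatorics. A tableau corresponds to the chain of the shapes formed by its entries ≤ -t. A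
pipedream corresponds to the chain whose parts record, after a shift, the columns in which pipes
cross the boundaries between rows. Both bijections respect weights, up to the sign (-1)^{|λ|} from
the |λ| empty tiles (`NonposTableau.weight_toChain`, `Chain.weight_toPipedream`). -/

/-- The action of a permutation of `ℤ` on the `x` variables. -/
noncomputable def permX (e : Equiv.Perm ℤ) : Series ≃ₐ[ℤ] Series :=
  MvPowerSeries.renameEquiv ℤ (Equiv.sumCongr e (Equiv.refl ℤ))

theorem permX_swap (i : ℤ) : permX (Equiv.swap i (i + 1)) = swapX i := rfl

theorem permX_x (e : Equiv.Perm ℤ) (i : ℤ) : permX e (x i) = x (e i) := by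
  simp only [permX, MvPowerSeries.renameEquiv, x]
  exact MvPowerSeries.rename_X _ _

theorem permX_a (e : Equiv.Perm ℤ) (i : ℤ) : permX e (a i) = a i := by
  simp only [permX, MvPowerSeries.renameEquiv, a]
  exact MvPowerSeries.rename_X _ _

theorem permX_mul (e f : Equiv.Perm ℤ) (h : Series) : permX (e * f) h = permX e (permX f h) := by
  have : (permX f).trans (permX e) = permX (e * f) := by
    unfold permX
    rw [MvPowerSeries.renameEquiv_trans]
    congr 1
    ext i
    rcases i with i | i <;> rfl
  rw [← this]; rfl

theorem permX_one (h : Series) : permX 1 h = h := by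
  have : permX 1 = AlgEquiv.refl := by
    unfold permX
    rw [← MvPowerSeries.renameEquiv_refl]
    congr 1
    ext i
    rcases i with i | i <;> rfl
  rw [this]; rfl

theorem coeff_renameEquiv {σ : Type*} (e : σ ≃ σ) (h : MvPowerSeries σ ℤ) (d : σ →₀ ℕ) :
    MvPowerSeries.coeff d (MvPowerSeries.renameEquiv ℤ e h) =
      MvPowerSeries.coeff (d.mapDomain e.symm) h := by
  have := MvPowerSeries.coeff_embDomain_rename e.toEmbedding h (d.mapDomain e.symm)
  rw [Finsupp.embDomain_eq_mapDomain, ← Finsupp.mapDomain_comp] at this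
  simpa [MvPowerSeries.renameEquiv] using! this

theorem coeff_permX (e : Equiv.Perm ℤ) (h : Series) (d : ℤ ⊕ ℤ →₀ ℕ) :
    MvPowerSeries.coeff d (permX e h) =
      MvPowerSeries.coeff (d.mapDomain (Equiv.sumCongr e (Equiv.refl ℤ)).symm) h :=
  coeff_renameEquiv _ _ _

theorem one_sub_a_mul_inv (j : ℤ) :
    (1 - a j) * ((oneSub (Sum.inr j))⁻¹ : Seriesˣ) = 1 :=
  (oneSub (Sum.inr j)).mul_inv

theorem xMinusA_mul (i j : ℤ) : xMinusA i j * (1 - a j) = x i - a j := by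
  rw [xMinusA, mul_assoc, mul_comm _ (1 - a j), one_sub_a_mul_inv, mul_one]

theorem one_sub_a_ne_zero (j : ℤ) : 1 - a j ≠ 0 := (oneSub (Sum.inr j)).ne_zero

theorem one_sub_x_ne_zero (j : ℤ) : 1 - x j ≠ 0 := (oneSub (Sum.inl j)).ne_zero

theorem permX_xMinusA (e : Equiv.Perm ℤ) (i j : ℤ) :
    permX e (xMinusA i j) = xMinusA (e i) j := by
  apply mul_right_cancel₀ (one_sub_a_ne_zero j)
  have := congrArg (permX e) (xMinusA_mul i j)
  rw [map_mul, map_sub, map_sub, map_one, permX_x, permX_a] at this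
  rw [this, xMinusA_mul]

theorem swapX_x_left (i : ℤ) : swapX i (x i) = x (i + 1) := by
  rw [← permX_swap, permX_x, Equiv.swap_apply_left]

theorem swapX_x_right (i : ℤ) : swapX i (x (i + 1)) = x i := by
  rw [← permX_swap, permX_x, Equiv.swap_apply_right]

theorem swapX_x_of_ne {i j : ℤ} (h : j ≠ i) (h' : j ≠ i + 1) : swapX i (x j) = x j := by
  rw [← permX_swap, permX_x, Equiv.swap_apply_of_ne_of_ne h h']

theorem swapX_swapX (i : ℤ) (f : Series) : swapX i (swapX i f) = f := by
  rw [← permX_swap, ← permX_mul, Equiv.swap_mul_self, permX_one]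

theorem x_injective : Function.Injective x := fun i j h => by
  have := MvPowerSeries.X_inj.1 h
  simpa using this

theorem x_sub_x_ne_zero {i j : ℤ} (h : i ≠ j) : x i - x j ≠ 0 :=
  sub_ne_zero.2 (x_injective.ne h)

/-! ### Divided differences -/

/-- This makes the division in the Demazure operator exact. The quotient is written down
coefficientwise, as for the polynomials (X^pY^q - X^qY^p)/(X - Y). In `H e p q` the exponents of the
two variables in e are replaced by p and q. -/
theorem X_sub_X_dvd_sub_rename_swap {σ : Type*} [DecidableEq σ] {i j : σ} (hij : i ≠ j)
    (h : MvPowerSeries σ ℤ) :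
    (MvPowerSeries.X i - MvPowerSeries.X j : MvPowerSeries σ ℤ) ∣
      h - MvPowerSeries.renameEquiv ℤ (Equiv.swap i j) h := by
  classical
  set H : (σ →₀ ℕ) → ℕ → ℕ → ℤ := fun e p q =>
    MvPowerSeries.coeff ((e.update i p).update j q) h with hH
  have Hi : ∀ e p q, H (e - Finsupp.single i 1) p q = H e p q := by
    intro e p q
    simp only [hH]
    congr 2
    ext k
    simp only [Finsupp.coe_update, Function.update_apply, Finsupp.coe_tsub, Pi.sub_apply]
    split_ifs with h1 h2
    · rfl
    · rfl
    · rw [Finsupp.single_eq_of_ne h2, Nat.sub_zero]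
  have Hj : ∀ e p q, H (e - Finsupp.single j 1) p q = H e p q := by
    intro e p q
    simp only [hH]
    congr 2
    ext k
    simp only [Finsupp.coe_update, Function.update_apply, Finsupp.coe_tsub, Pi.sub_apply]
    split_ifs with h1 h2
    · rfl
    · rfl
    · rw [Finsupp.single_eq_of_ne h1, Nat.sub_zero]
  have Hself : ∀ e, MvPowerSeries.coeff e h = H e (e i) (e j) := by
    intro e
    simp only [hH]
    congr 2
    ext k
    simp only [Finsupp.coe_update, Function.update_apply]
    split_ifs with h1 h2
    · rw [h1]
    · rw [h2]
    · rfl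
  have Hswap : ∀ e, MvPowerSeries.coeff e (MvPowerSeries.renameEquiv ℤ (Equiv.swap i j) h) =
      H e (e j) (e i) := by
    intro e
    rw [coeff_renameEquiv]
    simp only [hH]
    congr 2
    ext k
    rw [Finsupp.mapDomain_equiv_apply]
    simp only [Finsupp.coe_update, Function.update_apply, Equiv.symm_symm]
    split_ifs with h1 h2
    · rw [h1, Equiv.swap_apply_right]
    · rw [h2, Equiv.swap_apply_left]
    · rw [Equiv.swap_apply_of_ne_of_ne h2 h1]
  -- The coefficient of the quotient at exponents (c, d) is the partial sum of length min(c, d) + 1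
  -- over total degree c + d + 1. Multiplying by X_i - X_j leaves the difference of two partial sums
  -- in the same total degree, which is at most one summand.
  let S : (σ →₀ ℕ) → ℕ → ℕ → ℤ := fun e N r =>
    ∑ b ∈ Finset.range r, (H e (N - b) b - H e b (N - b))
  obtain ⟨g, hg⟩ : ∃ g : MvPowerSeries σ ℤ, ∀ e, MvPowerSeries.coeff e g =
      S e (e i + e j + 1) (min (e i) (e j) + 1) := ⟨fun e => _, fun e => rfl⟩
  refine ⟨g, ?_⟩
  ext e
  rw [sub_mul, map_sub, map_sub, Hself, Hswap, MvPowerSeries.X, MvPowerSeries.X,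
    MvPowerSeries.coeff_monomial_mul, MvPowerSeries.coeff_monomial_mul]
  simp only [Finsupp.single_le_iff, one_mul]
  have e1 : MvPowerSeries.coeff (e - Finsupp.single i 1) g =
      S e (e i - 1 + e j + 1) (min (e i - 1) (e j) + 1) := by
    rw [hg]
    simp only [S, Hi, Finsupp.coe_tsub, Pi.sub_apply, Finsupp.single_eq_same,
      Finsupp.single_eq_of_ne hij.symm, Nat.sub_zero]
  have e2 : MvPowerSeries.coeff (e - Finsupp.single j 1) g =
      S e (e i + (e j - 1) + 1) (min (e i) (e j - 1) + 1) := by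
    rw [hg]
    simp only [S, Hj, Finsupp.coe_tsub, Pi.sub_apply, Finsupp.single_eq_same,
      Finsupp.single_eq_of_ne hij, Nat.sub_zero]
  rw [e1, e2]
  have key : ∀ N r, S e N (r + 1) = S e N r + (H e (N - r) r - H e r (N - r)) :=
    fun N r => Finset.sum_range_succ _ _
  have key0 : ∀ N, S e N 0 = 0 := fun N => Finset.sum_range_zero _
  have hN : ∀ c d : ℕ, (if 1 ≤ c then S e (c - 1 + d + 1) (min (c - 1) d + 1) else 0) =
      S e (c + d) (min c (d + 1)) := by
    intro c d
    rcases c with _ | c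
    · simp [key0]
    · rw [if_pos (by omega)]
      congr 1 <;> omega
  have hN' : ∀ c d : ℕ, (if 1 ≤ d then S e (c + (d - 1) + 1) (min c (d - 1) + 1) else 0) =
      S e (c + d) (min (c + 1) d) := by
    intro c d
    rcases d with _ | d
    · simp [key0]
    · rw [if_pos (by omega)]
      congr 1; omega
  rw [hN, hN']
  generalize e i = c
  generalize e j = d
  rcases lt_trichotomy c d with hcd | rfl | hcd
  · rw [min_eq_left (by omega), min_eq_left (by omega), key, show c + d - c = d by omega]
    ring
  · rw [min_eq_left (by omega), min_eq_right (by omega)]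
    ring
  · rw [min_eq_right (by omega), min_eq_right (by omega), key, show c + d - d = c by omega]
    ring

theorem demazure_spec (i : ℤ) (f : Series) :
    (x i - x (i + 1)) * demazure i f =
      (1 - x (i + 1)) * f - swapX i ((1 - x (i + 1)) * f) := by
  have h := X_sub_X_dvd_sub_rename_swap (i := (Sum.inl i : ℤ ⊕ ℤ)) (j := Sum.inl (i + 1))
    (by simp) ((1 - x (i + 1)) * f)
  have hs : (Equiv.swap (Sum.inl i : ℤ ⊕ ℤ) (Sum.inl (i + 1))) =
      Equiv.sumCongr (Equiv.swap i (i + 1)) (Equiv.refl ℤ) := by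
    rw [← Equiv.Perm.sumCongr_swap_refl]
  rw [hs] at h
  obtain ⟨g, hg⟩ := h
  exact Classical.epsilon_spec (p := fun g : Series =>
    (x i - x (i + 1)) * g = (1 - x (i + 1)) * f - swapX i ((1 - x (i + 1)) * f)) ⟨g, hg.symm⟩

theorem demazure_mul (i : ℤ) (f : Series) :
    (x i - x (i + 1)) * demazure i f =
      (1 - x (i + 1)) * f - (1 - x i) * swapX i f := by
  rw [demazure_spec, map_mul, map_sub, map_one, swapX_x_right]

theorem x_sub_ne_zero (i : ℤ) : x i - x (i + 1) ≠ 0 := x_sub_x_ne_zero (by omega)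

theorem swapX_demazure (i : ℤ) (f : Series) : swapX i (demazure i f) = demazure i f := by
  have h := congrArg (swapX i) (demazure_mul i f)
  simp only [map_mul, map_sub, map_one, swapX_x_left, swapX_x_right, swapX_swapX] at h
  apply mul_left_cancel₀ (x_sub_ne_zero i)
  linear_combination -h - demazure_mul i f

theorem demazure_mul_of_swapX (i : ℤ) (f g : Series) (hg : swapX i g = g) :
    demazure i (f * g) = demazure i f * g := by
  apply mul_left_cancel₀ (x_sub_ne_zero i)
  rw [← mul_assoc, demazure_mul, demazure_mul, map_mul, hg]
  ring

theorem demazure_xMinusA (i j : ℤ) : demazure i (xMinusA i j) = 1 := by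
  apply mul_left_cancel₀ (mul_ne_zero (x_sub_ne_zero i) (one_sub_a_ne_zero j))
  have h := demazure_mul i (xMinusA i j)
  rw [← permX_swap, permX_xMinusA, Equiv.swap_apply_left] at h
  linear_combination (1 - a j) * h + (1 - x (i + 1)) * xMinusA_mul i j -
    (1 - x i) * xMinusA_mul (i + 1) j

theorem swapX_comm {i j : ℤ} (h : i + 1 < j) (f : Series) :
    swapX i (swapX j f) = swapX j (swapX i f) := by
  rw [← permX_swap, ← permX_swap, ← permX_mul, ← permX_mul]
  congr 1
  congr 1
  apply Equiv.Perm.Disjoint.commute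
  intro k
  simp only [Equiv.swap_apply_def]
  split_ifs <;> omega

theorem swapX_demazure_comm {i j : ℤ} (h : i + 1 < j ∨ j + 1 < i) (f : Series) :
    swapX i (demazure j f) = demazure j (swapX i f) := by
  apply mul_left_cancel₀ (x_sub_ne_zero j)
  have h1 := congrArg (swapX i) (demazure_mul j f)
  have hc : swapX i (swapX j f) = swapX j (swapX i f) := by
    rcases h with h | h
    · exact swapX_comm h f
    · exact (swapX_comm h f).symm
  simp only [map_mul, map_sub, map_one,
    swapX_x_of_ne (show j ≠ i by omega) (show j ≠ i + 1 by omega),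
    swapX_x_of_ne (show j + 1 ≠ i by omega) (show j + 1 ≠ i + 1 by omega), hc] at h1
  rw [h1, demazure_mul]

theorem demazure_comm {i j : ℤ} (h : i + 1 < j ∨ j + 1 < i) (f : Series) :
    demazure i (demazure j f) = demazure j (demazure i f) := by
  apply mul_left_cancel₀ (x_sub_ne_zero i)
  apply mul_left_cancel₀ (x_sub_ne_zero j)
  have hc := swapX_demazure_comm h f
  have h1 := demazure_mul i (demazure j f)
  have h2 := demazure_mul j (demazure i f)
  have h3 := demazure_mul j f
  have h4 := demazure_mul i f
  have h5 := demazure_mul j (swapX i f)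
  have hc' := swapX_demazure_comm h.symm f
  have h6 := demazure_mul i (swapX j f)
  have hs : swapX i (swapX j f) = swapX j (swapX i f) := by
    rcases h with h | h
    · exact swapX_comm h f
    · exact (swapX_comm h f).symm
  rw [hc] at h1
  rw [hc'] at h2
  rw [hs] at h6
  linear_combination (x j - x (j + 1)) * h1 - (x i - x (i + 1)) * h2 + (1 - x (i + 1)) * h3 -
    (1 - x i) * h5 - (1 - x (j + 1)) * h4 + (1 - x j) * h6

theorem swapX_braid (i : ℤ) (f : Series) :
    swapX i (swapX (i + 1) (swapX i f)) = swapX (i + 1) (swapX i (swapX (i + 1) f)) := by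
  simp only [← permX_swap, ← permX_mul]
  congr 1
  congr 1
  rw [← mul_assoc, ← mul_assoc]
  ext k
  simp only [Equiv.Perm.mul_apply, Equiv.swap_apply_def]
  split_ifs <;> omega

/-- After multiplication by the three differences of variables, both sides become combinations of
the images of f under the six permutations of x_i, x_{i+1}, x_{i+2}. The coefficients then agree,
the two words for the longest permutation being identified by `swapX_braid`. -/
theorem demazure_braid (i : ℤ) (f : Series) :
    demazure i (demazure (i + 1) (demazure i f)) =
      demazure (i + 1) (demazure i (demazure (i + 1) f)) := by
  have e1 : i + 1 + 1 = i + 2 := by ring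
  have xz : x i - x (i + 2) ≠ 0 := x_sub_x_ne_zero (by omega)
  have xy : x i - x (i + 1) ≠ 0 := x_sub_ne_zero i
  have yz : x (i + 1) - x (i + 2) ≠ 0 := x_sub_x_ne_zero (by omega)
  have D1 := demazure_mul i
  have D2 := demazure_mul (i + 1)
  simp only [e1] at D2
  have s1x := swapX_x_left i
  have s1y := swapX_x_right i
  have s1z : swapX i (x (i + 2)) = x (i + 2) := swapX_x_of_ne (by omega) (by omega)
  have s2x : swapX (i + 1) (x i) = x i := swapX_x_of_ne (by omega) (by omega)
  have s2y : swapX (i + 1) (x (i + 1)) = x (i + 2) := by rw [swapX_x_left, e1]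
  have s2z : swapX (i + 1) (x (i + 2)) = x (i + 1) := by rw [← e1, swapX_x_right]
  have br := swapX_braid i f
  have su := swapX_demazure i f
  have tu := swapX_demazure (i + 1) f
  generalize swapX i = s at *
  generalize swapX (i + 1) = t at *
  generalize demazure i = d at *
  generalize demazure (i + 1) = δ at *
  have A1 := D1 f
  have A2 := D2 (d f)
  have A3 := D1 (δ (d f))
  have A1t := congrArg t A1
  have A1st := congrArg s A1t
  have A2s := congrArg s A2
  have B1 := D2 f
  have B2 := D1 (δ f)
  have B3 := D2 (d (δ f))
  have B1t := congrArg s B1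
  have B1st := congrArg t B1t
  have B2s := congrArg t B2
  simp only [map_mul, map_sub, map_one, s1x, s1y, s1z, s2x, s2y, s2z, su, tu] at *
  rw [br] at A1st
  generalize x i = X at *
  generalize x (i + 1) = Y at *
  generalize x (i + 2) = Z at *
  apply mul_left_cancel₀ (mul_ne_zero (mul_ne_zero xy yz) xz)
  linear_combination (X - Z) * (Y - Z) * A3 + (1 - Y) * (X - Z) * A2 - (1 - X) * (Y - Z) * A2s +
    (1 - Z) ^ 2 * A1 - (1 - Y) ^ 2 * A1t + (1 - X) ^ 2 * A1st -
    ((X - Y) * (X - Z) * B3 + (1 - Z) * (X - Z) * B2 - (1 - Y) * (X - Y) * B2s +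
      (1 - Y) * (1 - Z) * B1 - (1 - Z) * (1 - X) * B1t + (1 - Y) * (1 - X) * B1st)

/-! ### Existence and uniqueness of double Grothendieck polynomials -/

/-- `w` moves only integers in `[1, n]`. -/
def SuppIn (n : ℤ) (w : Equiv.Perm ℤ) : Prop := ∀ k, k < 1 ∨ n < k → w k = k

/-- A statistic that drops along the covering relations `w < w s_i`. -/
noncomputable def potential (n : ℤ) (w : Equiv.Perm ℤ) : ℤ := ∑ k ∈ Finset.Icc 1 n, k * w k

theorem SuppIn.mem {n : ℤ} {w : Equiv.Perm ℤ} (hw : SuppIn n w) {k : ℤ} (h1 : 1 ≤ k)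
    (h2 : k ≤ n) : 1 ≤ w k ∧ w k ≤ n := by
  by_contra h
  have := w.injective (hw (w k) (by omega))
  omega

theorem SuppIn.mul_swap {n : ℤ} {w : Equiv.Perm ℤ} (hw : SuppIn n w) {i : ℤ} (h1 : 1 ≤ i)
    (h2 : i < n) : SuppIn n (w * Equiv.swap i (i + 1)) := by
  intro k hk
  rw [Equiv.Perm.mul_apply, Equiv.swap_apply_of_ne_of_ne (by omega) (by omega), hw k hk]

theorem SuppIn.potential_nonneg {n : ℤ} {w : Equiv.Perm ℤ} (hw : SuppIn n w) :
    0 ≤ potential n w := by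
  refine Finset.sum_nonneg fun k hk => ?_
  rw [Finset.mem_Icc] at hk
  have := hw.mem hk.1 hk.2
  exact mul_nonneg (by omega) (by omega)

theorem potential_mul_swap {n i : ℤ} (w : Equiv.Perm ℤ) (h1 : 1 ≤ i) (h2 : i < n) :
    potential n (w * Equiv.swap i (i + 1)) = potential n w - (w (i + 1) - w i) := by
  have hsub : ({i, i + 1} : Finset ℤ) ⊆ Finset.Icc 1 n := by
    intro k hk
    simp only [Finset.mem_insert, Finset.mem_singleton] at hk
    rw [Finset.mem_Icc]
    omega
  unfold potential
  rw [← Finset.sum_sdiff hsub, ← Finset.sum_sdiff hsub,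
    Finset.sum_pair (by omega : i ≠ i + 1), Finset.sum_pair (by omega : i ≠ i + 1)]
  have : ∀ k ∈ Finset.Icc 1 n \ {i, i + 1},
      k * (w * Equiv.swap i (i + 1)) k = k * w k := by
    intro k hk
    simp only [Finset.mem_sdiff, Finset.mem_insert, Finset.mem_singleton, not_or] at hk
    rw [Equiv.Perm.mul_apply, Equiv.swap_apply_of_ne_of_ne hk.2.1 hk.2.2]
  rw [Finset.sum_congr rfl this, Equiv.Perm.mul_apply, Equiv.Perm.mul_apply,
    Equiv.swap_apply_left, Equiv.swap_apply_right]
  ring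

theorem strictAnti_of_no_ascent {p q : ℤ} {w : Equiv.Perm ℤ}
    (h : ∀ i, p ≤ i → i < q → ¬ w i < w (i + 1)) {i j : ℤ} (hi : p ≤ i) (hij : i < j)
    (hj : j ≤ q) : w j < w i := by
  induction j, (show i + 1 ≤ j by omega) using Int.leInduction with
  | base =>
    have := h i hi (by omega)
    have : w (i + 1) ≠ w i := w.injective.ne (by omega)
    omega
  | succ j hj' ih =>
    have := ih (by omega) (by omega)
    have := h j (by omega) (by omega)
    have : w (j + 1) ≠ w j := w.injective.ne (by omega)
    omega

theorem SuppIn.eq_longest {n : ℤ} {w : Equiv.Perm ℤ} (hw : SuppIn n w)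
    (h : ∀ i, 1 ≤ i → i < n → ¬ w i < w (i + 1)) : w = longest n := by
  have hlong : ∀ k, longest n k = if 1 ≤ k ∧ k ≤ n then n + 1 - k else k := fun k => rfl
  have up : ∀ k, 1 ≤ k → k ≤ n → w k ≤ n + 1 - k := by
    intro k hk
    induction k, hk using Int.leInduction with
    | base =>
      intro hn
      have := hw.mem le_rfl hn
      omega
    | succ k hk ih =>
      intro hn
      have := ih (by omega)
      have := strictAnti_of_no_ascent h hk (show k < k + 1 by omega) hn
      omega
  have down : ∀ k, k ≤ n → 1 ≤ k → n + 1 - k ≤ w k := by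
    intro k hk
    induction k, hk using Int.leInductionDown with
    | base =>
      intro hn
      have := hw.mem hn le_rfl
      omega
    | pred k hk ih =>
      intro hn
      have := ih (by omega)
      have := strictAnti_of_no_ascent h hn (show k - 1 < k by omega) hk
      omega
  ext k
  rw [hlong]
  split_ifs with hk
  · have := up k hk.1 hk.2
    have := down k hk.2 hk.1
    omega
  · exact hw k (by omega)

/-- Induction down the weak order from the longest element. It is well founded because passing from
w to w s_i at an ascent lowers the nonnegative quantity Σ k·w(k). -/
theorem suppIn_induction {n : ℤ} {C : ∀ w, SuppIn n w → Prop}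
    (step : ∀ w (hw : SuppIn n w), (∀ i (h1 : 1 ≤ i) (h2 : i < n), w i < w (i + 1) →
      C (w * Equiv.swap i (i + 1)) (hw.mul_swap h1 h2)) → C w hw)
    (w : Equiv.Perm ℤ) (hw : SuppIn n w) : C w hw := by
  induction hN : (potential n w).toNat using Nat.strong_induction_on generalizing w with
  | _ N ih =>
    refine step w hw fun i h1 h2 h3 => ?_
    have hw' := hw.mul_swap h1 h2
    have h4 := hw'.potential_nonneg
    have h5 := potential_mul_swap w h1 h2
    exact ih _ (by omega) _ hw' rfl

theorem exists_isDoubleGrothendieck {n : ℤ} (w : Equiv.Perm ℤ) (hw : SuppIn n w) :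
    ∃ f, IsDoubleGrothendieck n w f := by
  induction w, hw using suppIn_induction with
  | step w hw ih =>
    by_cases h : ∀ i, 1 ≤ i → i < n → ¬ w i < w (i + 1)
    · rw [hw.eq_longest h]
      exact ⟨_, .top⟩
    · push Not at h
      obtain ⟨i, h1, h2, h3⟩ := h
      obtain ⟨f, hf⟩ := ih i h1 h2 h3
      exact ⟨_, .step w i f h1 h2 h3 hf⟩

theorem IsDoubleGrothendieck.cases_step {n : ℤ} {w : Equiv.Perm ℤ} {f : Series}
    (h : IsDoubleGrothendieck n w f) :
    (w = longest n ∧ f = ∏ p ∈ (Finset.Icc 1 n ×ˢ Finset.Icc 1 n).filter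
        (fun p : ℤ × ℤ => p.1 + p.2 ≤ n), xMinusA p.1 p.2) ∨
      ∃ i g, 1 ≤ i ∧ i < n ∧ w i < w (i + 1) ∧
        IsDoubleGrothendieck n (w * Equiv.swap i (i + 1)) g ∧ f = demazure i g := by
  cases h with
  | top => exact Or.inl ⟨rfl, rfl⟩
  | step _ i g h1 h2 h3 h4 => exact Or.inr ⟨i, g, h1, h2, h3, h4, rfl⟩

theorem longest_no_ascent {n i : ℤ} (h1 : 1 ≤ i) (h2 : i < n) :
    ¬ longest n i < longest n (i + 1) := by
  have hlong : ∀ k, longest n k = if 1 ≤ k ∧ k ≤ n then n + 1 - k else k := fun k => rfl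
  rw [hlong, hlong, if_pos (by omega), if_pos (by omega)]
  omega

theorem swap_mul_comm {i j : ℤ} (h : i + 1 < j) (w : Equiv.Perm ℤ) :
    w * Equiv.swap i (i + 1) * Equiv.swap j (j + 1) =
      w * Equiv.swap j (j + 1) * Equiv.swap i (i + 1) := by
  ext k
  simp only [Equiv.Perm.mul_apply]
  congr 1
  simp only [Equiv.swap_apply_def]
  split_ifs <;> omega

theorem swap_mul_braid (i : ℤ) (w : Equiv.Perm ℤ) :
    w * Equiv.swap i (i + 1) * Equiv.swap (i + 1) (i + 1 + 1) * Equiv.swap i (i + 1) =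
      w * Equiv.swap (i + 1) (i + 1 + 1) * Equiv.swap i (i + 1) *
        Equiv.swap (i + 1) (i + 1 + 1) := by
  ext k
  simp only [Equiv.Perm.mul_apply]
  congr 1
  simp only [Equiv.swap_apply_def]
  split_ifs <;> omega

theorem mul_swap_apply_left (w : Equiv.Perm ℤ) (i : ℤ) :
    (w * Equiv.swap i (i + 1)) i = w (i + 1) := by
  rw [Equiv.Perm.mul_apply, Equiv.swap_apply_left]

theorem mul_swap_apply_right (w : Equiv.Perm ℤ) (i : ℤ) :
    (w * Equiv.swap i (i + 1)) (i + 1) = w i := by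
  rw [Equiv.Perm.mul_apply, Equiv.swap_apply_right]

theorem mul_swap_apply_of_ne (w : Equiv.Perm ℤ) {i k : ℤ} (h : k ≠ i) (h' : k ≠ i + 1) :
    (w * Equiv.swap i (i + 1)) k = w k := by
  rw [Equiv.Perm.mul_apply, Equiv.swap_apply_of_ne_of_ne h h']

/-- A confluence argument: two different ascents of w lead upwards to a common element, w s_i s_j or
w s_i s_{i+1} s_i. Commutation or the braid relation of the Demazure operators then gives equal
results. -/
theorem isDoubleGrothendieck_unique {n : ℤ} (w : Equiv.Perm ℤ) (hw : SuppIn n w) :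
    ∀ f g, IsDoubleGrothendieck n w f → IsDoubleGrothendieck n w g → f = g := by
  induction w, hw using suppIn_induction with
  | step w hw ih =>
    have main : ∀ i j, i < j → 1 ≤ i → i < n → 1 ≤ j → j < n →
        w i < w (i + 1) → w j < w (j + 1) → ∀ f g,
        IsDoubleGrothendieck n (w * Equiv.swap i (i + 1)) f →
        IsDoubleGrothendieck n (w * Equiv.swap j (j + 1)) g → demazure i f = demazure j g := by
      intro i j hij hi1 hi2 hj1 hj2 hi hj f g hf hg
      rcases (show i + 1 < j ∨ j = i + 1 by omega) with h | rfl
      · obtain ⟨k, hk⟩ := exists_isDoubleGrothendieck _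
          ((hw.mul_swap hi1 hi2).mul_swap hj1 hj2)
        have hk' := hk
        rw [swap_mul_comm h] at hk'
        have e1 := ih i hi1 hi2 hi _ _ hf (.step _ j k hj1 hj2 (by
          rwa [mul_swap_apply_of_ne _ (by omega) (by omega),
            mul_swap_apply_of_ne _ (by omega) (by omega)]) hk)
        have e2 := ih j hj1 hj2 hj _ _ hg (.step _ i k hi1 hi2 (by
          rwa [mul_swap_apply_of_ne _ (by omega) (by omega),
            mul_swap_apply_of_ne _ (by omega) (by omega)]) hk')
        rw [e1, e2, demazure_comm (Or.inl h)]
      · obtain ⟨k, hk⟩ := exists_isDoubleGrothendieck _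
          (((hw.mul_swap hi1 hi2).mul_swap hj1 hj2).mul_swap hi1 hi2)
        have hk' := hk
        rw [swap_mul_braid] at hk'
        have v1 := mul_swap_apply_left w i
        have v2 := mul_swap_apply_right w i
        have v3 := mul_swap_apply_of_ne w (show i + 1 + 1 ≠ i by omega)
          (show i + 1 + 1 ≠ i + 1 by omega)
        have u1 := mul_swap_apply_left w (i + 1)
        have u2 := mul_swap_apply_right w (i + 1)
        have u3 := mul_swap_apply_of_ne w (show i ≠ i + 1 by omega)
          (show i ≠ i + 1 + 1 by omega)
        have e1 := ih i hi1 hi2 hi _ _ hf (.step _ (i + 1) _ hj1 hj2 (by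
          rw [v2, v3]; exact hi.trans hj) (.step _ i k hi1 hi2 (by
          rw [mul_swap_apply_of_ne _ (by omega) (by omega), mul_swap_apply_left _ (i + 1), v1, v3]
          exact hj) hk))
        have e2 := ih (i + 1) hj1 hj2 hj _ _ hg (.step _ i _ hi1 hi2 (by
          rw [u1, u3]; exact hi.trans hj) (.step _ (i + 1) k hj1 hj2 (by
          rw [mul_swap_apply_right (w * Equiv.swap (i + 1) (i + 1 + 1)) i, u3,
            mul_swap_apply_of_ne _ (by omega) (by omega), u2]
          exact hi) hk'))
        rw [e1, e2, demazure_braid]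
    intro f g hf hg
    rcases hf.cases_step with ⟨hwl, rfl⟩ | ⟨i, f, hi1, hi2, hi, hf', rfl⟩
    · rcases hg.cases_step with ⟨-, rfl⟩ | ⟨j, g, hj1, hj2, hj, hg', rfl⟩
      · rfl
      · rw [hwl] at hj
        exact absurd hj (longest_no_ascent hj1 hj2)
    · rcases hg.cases_step with ⟨hwl, rfl⟩ | ⟨j, g, hj1, hj2, hj, hg', rfl⟩
      · rw [hwl] at hi
        exact absurd hi (longest_no_ascent hi1 hi2)
      · rcases lt_trichotomy i j with h | rfl | h
        · exact main i j h hi1 hi2 hj1 hj2 hi hj f g hf' hg'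
        · rw [ih i hi1 hi2 hi f g hf' hg']
        · exact (main j i h hj1 hj2 hi1 hi2 hj hi g f hg' hf').symm

theorem doubleGrothendieck_spec {n : ℤ} {w : Equiv.Perm ℤ} (hw : SuppIn n w) :
    IsDoubleGrothendieck n w (doubleGrothendieck n w) :=
  Classical.epsilon_spec (exists_isDoubleGrothendieck w hw)

theorem doubleGrothendieck_eq {n : ℤ} {w : Equiv.Perm ℤ} (hw : SuppIn n w) {f : Series}
    (hf : IsDoubleGrothendieck n w f) : doubleGrothendieck n w = f :=
  isDoubleGrothendieck_unique w hw _ _ (doubleGrothendieck_spec hw) hf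

theorem doubleGrothendieck_step {n : ℤ} {w : Equiv.Perm ℤ} (hw : SuppIn n w) {i : ℤ}
    (h1 : 1 ≤ i) (h2 : i < n) (h3 : w i < w (i + 1)) :
    doubleGrothendieck n w = demazure i (doubleGrothendieck n (w * Equiv.swap i (i + 1))) :=
  doubleGrothendieck_eq hw (.step w i _ h1 h2 h3 (doubleGrothendieck_spec (hw.mul_swap h1 h2)))

theorem swapX_doubleGrothendieck {n : ℤ} {w : Equiv.Perm ℤ} (hw : SuppIn n w) {i : ℤ}
    (h1 : 1 ≤ i) (h2 : i < n) (h3 : w i < w (i + 1)) :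
    swapX i (doubleGrothendieck n w) = doubleGrothendieck n w := by
  rw [doubleGrothendieck_step hw h1 h2 h3, swapX_demazure]

/-! ### Dominant permutations -/

/-- The Lehmer code of `w`. -/
noncomputable def code (n : ℤ) (w : Equiv.Perm ℤ) (i : ℤ) : ℕ :=
  ((Finset.Icc 1 n).filter fun j => i < j ∧ w j < w i).card

theorem code_le_of_ascent (n : ℤ) {w : Equiv.Perm ℤ} {i : ℤ} (h : w i < w (i + 1)) :
    code n w i ≤ code n w (i + 1) := by
  refine Finset.card_le_card fun j hj => ?_
  simp only [Finset.mem_filter] at hj ⊢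
  have : j ≠ i + 1 := by rintro rfl; omega
  exact ⟨hj.1, by omega, by omega⟩

theorem code_lt_of_descent {n : ℤ} {w : Equiv.Perm ℤ} {i : ℤ} (h1 : 1 ≤ i) (h2 : i < n)
    (h : w (i + 1) < w i) : code n w (i + 1) < code n w i := by
  refine Finset.card_lt_card ((Finset.ssubset_iff_of_subset fun j hj => ?_).2 ⟨i + 1, ?_, ?_⟩)
  · simp only [Finset.mem_filter] at hj ⊢
    exact ⟨hj.1, by omega, by omega⟩
  · simp only [Finset.mem_filter, Finset.mem_Icc]
    omega
  · simp

theorem code_mul_swap_right (n : ℤ) {w : Equiv.Perm ℤ} {i : ℤ} (h : w i < w (i + 1)) :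
    code n (w * Equiv.swap i (i + 1)) (i + 1) = code n w i := by
  refine congrArg Finset.card (Finset.filter_congr fun j _ => ?_)
  rw [mul_swap_apply_right]
  constructor
  · rintro ⟨h1, h2⟩
    rw [mul_swap_apply_of_ne w (by omega) (by omega)] at h2
    exact ⟨by omega, h2⟩
  · rintro ⟨h1, h2⟩
    have : j ≠ i + 1 := by rintro rfl; omega
    rw [mul_swap_apply_of_ne w (by omega) (by omega)]
    exact ⟨by omega, h2⟩

theorem code_mul_swap_left {n : ℤ} {w : Equiv.Perm ℤ} {i : ℤ} (h1 : 1 ≤ i) (h2 : i < n)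
    (h : w i < w (i + 1)) :
    code n (w * Equiv.swap i (i + 1)) i = code n w (i + 1) + 1 := by
  have : ((Finset.Icc 1 n).filter fun j => i < j ∧
      (w * Equiv.swap i (i + 1)) j < (w * Equiv.swap i (i + 1)) i) =
      insert (i + 1) ((Finset.Icc 1 n).filter fun j => i + 1 < j ∧ w j < w (i + 1)) := by
    ext j
    rw [mul_swap_apply_left]
    simp only [Finset.mem_filter, Finset.mem_insert, Finset.mem_Icc]
    by_cases hj : j = i + 1
    · subst hj
      rw [mul_swap_apply_right]
      simp
      omega
    · by_cases hj' : j = i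
      · subst hj'
        simp
      · rw [mul_swap_apply_of_ne w hj' hj]
        omega
  rw [code, this, Finset.card_insert_of_notMem (by simp)]
  rfl

theorem code_mul_swap_of_ne {n : ℤ} {w : Equiv.Perm ℤ} {i : ℤ} (h1 : 1 ≤ i) (h2 : i < n) {k : ℤ}
    (hk : k ≠ i) (hk' : k ≠ i + 1) : code n (w * Equiv.swap i (i + 1)) k = code n w k := by
  refine Finset.card_bij' (fun j _ => Equiv.swap i (i + 1) j) (fun j _ => Equiv.swap i (i + 1) j)
    ?_ ?_ (fun j _ => Equiv.swap_apply_self _ _ _) (fun j _ => Equiv.swap_apply_self _ _ _)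
  · intro j hj
    simp only [Finset.mem_filter, Finset.mem_Icc, mul_swap_apply_of_ne w hk hk',
      Equiv.Perm.mul_apply] at hj ⊢
    refine ⟨?_, ?_, hj.2.2⟩ <;> rw [Equiv.swap_apply_def] <;> split_ifs <;> omega
  · intro j hj
    simp only [Finset.mem_filter, Finset.mem_Icc, mul_swap_apply_of_ne w hk hk',
      Equiv.Perm.mul_apply, Equiv.swap_apply_self] at hj ⊢
    refine ⟨?_, ?_, hj.2.2⟩ <;> rw [Equiv.swap_apply_def] <;> split_ifs <;> omega

/-- The product of the `x_i ⊖ a_j` over the left-justified diagram with row lengths `c`. -/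
noncomputable def diagramProd (n : ℤ) (c : ℤ → ℕ) : Series :=
  ∏ i ∈ Finset.Icc 1 n, ∏ j ∈ Finset.range (c i), xMinusA i (j + 1)

theorem longest_code {n i : ℤ} (h1 : 1 ≤ i) (h2 : i ≤ n) :
    code n (longest n) i = (n - i).toNat := by
  have hlong : ∀ k, longest n k = if 1 ≤ k ∧ k ≤ n then n + 1 - k else k := fun k => rfl
  have : ((Finset.Icc 1 n).filter fun j => i < j ∧ longest n j < longest n i) =
      Finset.Ioc i n := by
    ext j
    simp only [Finset.mem_filter, Finset.mem_Icc, Finset.mem_Ioc, hlong]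
    constructor
    · omega
    · intro h
      rw [if_pos (by omega), if_pos (by omega)]
      omega
  rw [code, this, Int.card_Ioc]

theorem prod_longest (n : ℤ) :
    (∏ p ∈ (Finset.Icc 1 n ×ˢ Finset.Icc 1 n).filter (fun p : ℤ × ℤ => p.1 + p.2 ≤ n),
        xMinusA p.1 p.2) = diagramProd n (code n (longest n)) := by
  rw [Finset.prod_filter, Finset.prod_product, diagramProd]
  refine Finset.prod_congr rfl fun i hi => ?_
  rw [Finset.mem_Icc] at hi
  rw [← Finset.prod_filter, longest_code hi.1 hi.2]
  refine (Finset.prod_nbij (fun j : ℕ => (j : ℤ) + 1) ?_ ?_ ?_ ?_).symm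
  · intro j hj
    simp only [Finset.mem_range, Finset.mem_filter, Finset.mem_Icc] at hj ⊢
    omega
  · intro j _ k _ h
    simpa using h
  · intro j hj
    simp only [Finset.coe_filter, Finset.mem_Icc, Set.mem_ofPred_eq] at hj
    exact ⟨(j - 1).toNat, by simp only [Finset.coe_range, Set.mem_Iio]; omega, by simp; omega⟩
  · intro j _
    rfl

/-- Going up at the first ascent i adds one box to row i of the diagram. The rest of the product is
symmetric in x_i and x_{i+1}, and the Demazure operator sends the factor of the added box to 1. -/
theorem doubleGrothendieck_dominant {n : ℤ} (w : Equiv.Perm ℤ) (hw : SuppIn n w) :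
    (∀ i, 1 ≤ i → i < n → code n w (i + 1) ≤ code n w i) →
    doubleGrothendieck n w = diagramProd n (code n w) := by
  induction w, hw using suppIn_induction with
  | step w hw ih =>
    intro hc
    by_cases h : ∀ i, 1 ≤ i → i < n → ¬ w i < w (i + 1)
    · obtain rfl := hw.eq_longest h
      rw [doubleGrothendieck_eq hw .top, prod_longest]
    · push Not at h
      obtain ⟨i, ⟨h1, h2, h3⟩, hmin⟩ : ∃ i, (1 ≤ i ∧ i < n ∧ w i < w (i + 1)) ∧
          ∀ j, 1 ≤ j → j < i → ¬ w j < w (j + 1) := by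
        obtain ⟨i, hi, hmin⟩ := Int.exists_least_of_bdd
          (P := fun i => 1 ≤ i ∧ i < n ∧ w i < w (i + 1)) ⟨1, fun z hz => hz.1⟩ h
        refine ⟨i, hi, fun j hj1 hj2 hj3 => ?_⟩
        have := hmin j ⟨hj1, by omega, hj3⟩
        omega
      -- Rows i and i + 1 have equal length, so their factors are exchanged by the swap of
      -- variables.
      have heq : code n w (i + 1) = code n w i := le_antisymm (hc i h1 h2) (code_le_of_ascent n h3)
      have cl := code_mul_swap_left h1 h2 h3
      have cr := code_mul_swap_right n h3
      rw [doubleGrothendieck_step hw h1 h2 h3, ih i h1 h2 h3]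
      · have hsub : ({i, i + 1} : Finset ℤ) ⊆ Finset.Icc 1 n := by
          intro k hk
          simp only [Finset.mem_insert, Finset.mem_singleton] at hk
          rw [Finset.mem_Icc]
          omega
        unfold diagramProd
        rw [← Finset.prod_sdiff hsub, ← Finset.prod_sdiff hsub,
          Finset.prod_pair (by omega : i ≠ i + 1), Finset.prod_pair (by omega : i ≠ i + 1), cl, cr,
          heq, Finset.prod_range_succ]
        have : ∀ k ∈ Finset.Icc 1 n \ {i, i + 1}, (∏ j ∈ Finset.range
            (code n (w * Equiv.swap i (i + 1)) k), xMinusA k (j + 1)) =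
            ∏ j ∈ Finset.range (code n w k), xMinusA k (j + 1) := by
          intro k hk
          simp only [Finset.mem_sdiff, Finset.mem_insert, Finset.mem_singleton, not_or] at hk
          rw [code_mul_swap_of_ne h1 h2 hk.2.1 hk.2.2]
        rw [Finset.prod_congr rfl this]
        set P := ∏ k ∈ Finset.Icc 1 n \ {i, i + 1}, ∏ j ∈ Finset.range (code n w k),
          xMinusA k (j + 1) with hP
        set A := ∏ j ∈ Finset.range (code n w i), xMinusA i (j + 1) with hA
        set B := ∏ j ∈ Finset.range (code n w i), xMinusA (i + 1) (j + 1) with hB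
        have sP : swapX i P = P := by
          rw [hP, map_prod]
          refine Finset.prod_congr rfl fun k hk => ?_
          simp only [Finset.mem_sdiff, Finset.mem_insert, Finset.mem_singleton, not_or] at hk
          rw [map_prod]
          refine Finset.prod_congr rfl fun j _ => ?_
          rw [← permX_swap, permX_xMinusA, Equiv.swap_apply_of_ne_of_ne hk.2.1 hk.2.2]
        have sA : swapX i A = B := by
          rw [hA, hB, map_prod]
          refine Finset.prod_congr rfl fun j _ => ?_
          rw [← permX_swap, permX_xMinusA, Equiv.swap_apply_left]
        have sB : swapX i B = A := by
          rw [← sA, swapX_swapX]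
        rw [show P * (A * xMinusA i (code n w i + 1) * B) =
          xMinusA i (code n w i + 1) * (P * (A * B)) by ring, demazure_mul_of_swapX,
          demazure_xMinusA, one_mul]
        rw [map_mul, map_mul, sP, sA, sB, mul_comm B A]
      · intro k hk1 hk2
        by_cases e1 : k = i
        · rw [e1, cl, cr]; omega
        · by_cases e2 : k = i + 1
          · subst e2
            rw [cr, code_mul_swap_of_ne h1 h2 (by omega) (by omega), ← heq]
            exact hc _ hk1 hk2
          · by_cases e3 : k + 1 = i
            · subst e3
              rw [cl, code_mul_swap_of_ne h1 h2 (by omega) (by omega), heq]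
              -- Row i grew by one box. The code stays weakly decreasing since, by minimality of i,
              -- the preceding position is a descent and its row is strictly longer.
              have := hmin k hk1 (by omega)
              have hne : w (k + 1) ≠ w k := w.injective.ne (by omega)
              exact code_lt_of_descent hk1 hk2 (by omega)
            · rw [code_mul_swap_of_ne h1 h2 e1 e2,
                code_mul_swap_of_ne h1 h2 e3 (by omega)]
              exact hc k hk1 hk2

/-! ### Antisymmetrization -/

/-- The embedding of `Fin m` onto the interval `[1, m]`. -/
def finEmb (m : ℕ) : Fin m ↪ ℤ := ⟨fun i => (i : ℤ) + 1, fun i j h => by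
  ext; simpa using h⟩

theorem finEmb_apply (m : ℕ) (i : Fin m) : finEmb m i = (i : ℤ) + 1 := rfl

/-- A permutation of `[1, m]` acting on the `x` variables. -/
noncomputable def permFin {m : ℕ} (σ : Equiv.Perm (Fin m)) : Series ≃ₐ[ℤ] Series :=
  permX (Equiv.Perm.viaEmbeddingHom (finEmb m) σ)

theorem permFin_mul {m : ℕ} (σ τ : Equiv.Perm (Fin m)) (h : Series) :
    permFin (σ * τ) h = permFin σ (permFin τ h) := by
  rw [permFin, map_mul, permX_mul]; rfl

theorem permFin_one {m : ℕ} (h : Series) : permFin (1 : Equiv.Perm (Fin m)) h = h := by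
  rw [permFin, map_one, permX_one]

theorem permFin_x {m : ℕ} (σ : Equiv.Perm (Fin m)) (i : Fin m) :
    permFin σ (x ((i : ℤ) + 1)) = x ((σ i : ℤ) + 1) := by
  rw [permFin, permX_x, Equiv.Perm.viaEmbeddingHom_apply, ← finEmb_apply,
    Equiv.Perm.viaEmbedding_apply, finEmb_apply]

theorem permFin_xMinusA {m : ℕ} (σ : Equiv.Perm (Fin m)) (i : Fin m) (j : ℤ) :
    permFin σ (xMinusA ((i : ℤ) + 1) j) = xMinusA ((σ i : ℤ) + 1) j := by
  rw [permFin, permX_xMinusA, Equiv.Perm.viaEmbeddingHom_apply, ← finEmb_apply,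
    Equiv.Perm.viaEmbedding_apply, finEmb_apply]

theorem permFin_swap {m k : ℕ} (hk : k + 1 < m) (h : Series) :
    permFin (Equiv.swap (⟨k, by omega⟩ : Fin m) ⟨k + 1, hk⟩) h = swapX ((k : ℤ) + 1) h := by
  rw [← permX_swap, permFin]
  congr 2
  ext j
  rw [Equiv.Perm.viaEmbeddingHom_apply]
  by_cases hj : j ∈ Set.range (finEmb m)
  · obtain ⟨i, rfl⟩ := hj
    rw [Equiv.Perm.viaEmbedding_apply]
    simp only [Equiv.swap_apply_def, finEmb_apply, Fin.ext_iff]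
    split_ifs <;> push_cast <;> omega
  · rw [Equiv.Perm.viaEmbedding_apply_of_notMem _ _ _ hj, Equiv.swap_apply_of_ne_of_ne]
    · rintro rfl; exact hj ⟨⟨k, by omega⟩, rfl⟩
    · rintro rfl; exact hj ⟨⟨k + 1, hk⟩, by simp [finEmb_apply]⟩

/-- The adjacent transpositions generate the symmetric group. -/
theorem permFin_eq_of_swapX {m : ℕ} {g : Series}
    (hg : ∀ i : ℤ, 1 ≤ i → i < m → swapX i g = g) (σ : Equiv.Perm (Fin m)) :
    permFin σ g = g := by
  rcases m with _ | m
  · rw [Subsingleton.elim σ 1, permFin_one]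
  · have hσ : σ ∈ Submonoid.closure
        (Set.range fun i : Fin m => Equiv.swap i.castSucc i.succ) := by
      rw [Equiv.Perm.mclosure_swap_castSucc_succ]; trivial
    induction hσ using Submonoid.closure_induction with
    | mem σ hσ =>
      obtain ⟨i, rfl⟩ := hσ
      have := permFin_swap (m := m + 1) (k := i) (by omega) g
      rw [hg _ (by omega) (by push_cast; omega)] at this
      exact this
    | one => exact permFin_one g
    | mul σ τ _ _ h1 h2 => rw [permFin_mul, h2, h1]

/-- The antisymmetrization over the permutations of `x_1, …, x_m`. -/
noncomputable def alt (m : ℕ) (h : Series) : Series :=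
  ∑ σ : Equiv.Perm (Fin m), Equiv.Perm.sign σ • permFin σ h

theorem alt_sub (m : ℕ) (g h : Series) : alt m (g - h) = alt m g - alt m h := by
  simp only [alt, map_sub, smul_sub, Finset.sum_sub_distrib]

theorem alt_mul {m : ℕ} {g : Series} (hg : ∀ i : ℤ, 1 ≤ i → i < m → swapX i g = g)
    (h : Series) : alt m (g * h) = g * alt m h := by
  simp only [alt, map_mul, permFin_eq_of_swapX hg, Finset.mul_sum, mul_smul_comm]

theorem alt_swapX {m k : ℕ} (hk : k + 1 < m) (h : Series) :
    alt m (swapX ((k : ℤ) + 1) h) = - alt m h := by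
  unfold alt
  rw [← Equiv.sum_comp (Equiv.mulRight (Equiv.swap (⟨k, by omega⟩ : Fin m) ⟨k + 1, hk⟩)),
    ← Finset.sum_neg_distrib]
  refine Finset.sum_congr rfl fun σ _ => ?_
  rw [← permFin_swap hk, ← permFin_mul, Equiv.coe_mulRight, mul_assoc, Equiv.swap_mul_self,
    mul_one, map_mul, Equiv.Perm.sign_swap (by simp), mul_neg_one, Units.neg_smul]

/-- The product `∏_j (1 - x_j)^{j-1}` over `1 ≤ j ≤ m`. -/
noncomputable def rho (m : ℕ) : Series := ∏ j : Fin m, (1 - x ((j : ℤ) + 1)) ^ (j : ℕ)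

theorem exists_rho_eq {m k : ℕ} (hk : k + 1 < m) :
    ∃ R, swapX ((k : ℤ) + 1) R = R ∧ rho m = R * (1 - x ((k : ℤ) + 1 + 1)) := by
  have hne : (⟨k, by omega⟩ : Fin m) ≠ ⟨k + 1, hk⟩ := by simp
  refine ⟨(∏ j ∈ (Finset.univ : Finset (Fin m)) \ {⟨k, by omega⟩, ⟨k + 1, hk⟩},
    (1 - x ((j : ℤ) + 1)) ^ (j : ℕ)) *
      ((1 - x ((k : ℤ) + 1)) * (1 - x ((k : ℤ) + 1 + 1))) ^ k, ?_, ?_⟩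
  · rw [map_mul, map_prod, map_pow, map_mul, map_sub, map_sub, map_one, swapX_x_left,
      swapX_x_right, mul_comm (1 - x ((k : ℤ) + 1 + 1))]
    congr 1
    refine Finset.prod_congr rfl fun j hj => ?_
    simp only [Finset.mem_sdiff, Finset.mem_insert, Finset.mem_singleton, not_or,
      Fin.ext_iff] at hj
    rw [map_pow, map_sub, map_one, swapX_x_of_ne (by omega) (by omega)]
  · rw [rho, ← Finset.prod_sdiff (Finset.subset_univ {(⟨k, by omega⟩ : Fin m), ⟨k + 1, hk⟩}),
      Finset.prod_pair hne]
    push_cast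
    rw [mul_pow]
    ring_nf

/-- Antisymmetrizing h gives half the result of antisymmetrizing h - s_k h. Write ρ = R(1 - x_{k+1})
with R fixed by s_k. Since the Demazure image is also fixed by s_k, subtraction leaves R(x_k -
x_{k+1}) times that image. By the definition of the operator this equals ρf - s_k(ρf). -/
theorem alt_rho_demazure {m k : ℕ} (hk : k + 1 < m) (f : Series) :
    alt m (rho m * demazure ((k : ℤ) + 1) f) = alt m (rho m * f) := by
  obtain ⟨R, hR, hrho⟩ := exists_rho_eq hk
  have key : ∀ h, 2 * alt m h = alt m (h - swapX ((k : ℤ) + 1) h) := fun h => by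
    rw [alt_sub, alt_swapX hk]; ring
  have two : (2 : Series) ≠ 0 := fun h => by
    have := congrArg MvPowerSeries.constantCoeff h
    rw [map_ofNat, map_zero] at this
    omega
  apply mul_left_cancel₀ two
  rw [key, key, hrho]
  congr 1
  simp only [map_mul, map_sub, map_one, hR, swapX_x_right, swapX_demazure]
  linear_combination R * demazure_mul ((k : ℤ) + 1) f

/-! ### The bialternant formula -/

instance : IsDomain Series := NoZeroDivisors.to_isDomain _

/-- The Vandermonde determinant `∏_{i<j} (x_i - x_j)` in `x_1, …, x_m`. -/
noncomputable def vdm (m : ℕ) : Series :=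
  (Matrix.vandermonde fun i : Fin m => 1 - x ((i : ℤ) + 1)).det

theorem vdm_ne_zero (m : ℕ) : vdm m ≠ 0 := by
  rw [vdm, Matrix.det_vandermonde_ne_zero_iff]
  intro i j h
  have := x_injective (sub_right_injective h)
  ext
  simpa using this

theorem alt_prod {m : ℕ} (F : Fin m → Fin m → Series)
    (h : ∀ σ : Equiv.Perm (Fin m), ∀ i j, permFin σ (F i j) = F (σ i) j) :
    alt m (∏ j, F j j) = (Matrix.of F).det := by
  rw [Matrix.det_apply, alt]
  refine Finset.sum_congr rfl fun σ _ => ?_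
  rw [map_prod]
  simp only [h, Matrix.of_apply]

theorem alt_rho (m : ℕ) : alt m (rho m) = vdm m := by
  rw [rho, alt_prod (fun i j : Fin m => (1 - x ((i : ℤ) + 1)) ^ (j : ℕ))]
  · rfl
  · intro σ i j
    rw [map_pow, map_sub, map_one, permFin_x]

/-- Climb along ascents inside [1, m] until none is left; by `alt_rho_demazure` no step changes the
antisymmetrization. -/
theorem alt_rho_mul_longest {n : ℤ} {m : ℕ} (hm : m ≤ n) {w : Equiv.Perm ℤ} (hw : SuppIn n w)
    (hinc : ∀ i j : ℤ, 1 ≤ i → i < j → j ≤ m → w i < w j) :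
    SuppIn n (w * longest m) ∧
    alt m (rho m * doubleGrothendieck n w) =
      alt m (rho m * doubleGrothendieck n (w * longest m)) := by
  have main : ∀ v, SuppIn n v → ∃ u, SuppIn m u ∧ SuppIn n (v * u) ∧
      (∀ i : ℤ, 1 ≤ i → i < m → ¬ (v * u) i < (v * u) (i + 1)) ∧
      alt m (rho m * doubleGrothendieck n v) =
        alt m (rho m * doubleGrothendieck n (v * u)) := by
    intro v hv
    induction v, hv using suppIn_induction with
    | step v hv ih =>
      by_cases h : ∀ i : ℤ, 1 ≤ i → i < m → ¬ v i < v (i + 1)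
      · refine ⟨1, fun k _ => rfl, ?_⟩
        rw [mul_one]
        exact ⟨hv, h, rfl⟩
      · push Not at h
        obtain ⟨i, h1, h2, h3⟩ := h
        obtain ⟨u, hu1, hu2, hu3, hu4⟩ := ih i h1 (by omega) h3
        obtain ⟨k, rfl⟩ : ∃ k : ℕ, i = (k : ℤ) + 1 := ⟨(i - 1).toNat, by omega⟩
        refine ⟨Equiv.swap ((k : ℤ) + 1) ((k : ℤ) + 1 + 1) * u, ?_, ?_, ?_, ?_⟩
        · intro j hj
          rw [Equiv.Perm.mul_apply, hu1 j hj, Equiv.swap_apply_of_ne_of_ne] <;> omega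
        · rw [← mul_assoc]; exact hu2
        · rw [← mul_assoc]; exact hu3
        · rw [← mul_assoc, ← hu4, doubleGrothendieck_step hv h1 (by omega) h3,
            alt_rho_demazure (by omega)]
  obtain ⟨u, hu1, hu2, hu3, hu4⟩ := main w hw
  -- As w is increasing on [1, m], an ascent of u there would be an ascent of w u.
  have : u = longest m := by
    refine hu1.eq_longest fun i h1 h2 h3 => hu3 i h1 h2 ?_
    have := hu1.mem h1 (by omega)
    have := hu1.mem (show 1 ≤ i + 1 by omega) (by omega)
    exact hinc _ _ (by omega) h3 (by omega)
  rw [← this]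
  exact ⟨hu2, hu4⟩

theorem longest_apply {m k : ℤ} (h1 : 1 ≤ k) (h2 : k ≤ m) : longest m k = m + 1 - k :=
  if_pos ⟨h1, h2⟩

theorem longest_apply_of_lt {m k : ℤ} (h : m < k) : longest m k = k :=
  if_neg (by omega)

/-- The product is decreasing on [1, m], so every smaller positive value is taken to the right of i;
the code counts all of them. -/
theorem code_mul_longest {n : ℤ} {m : ℕ} (hm : m ≤ n) {w : Equiv.Perm ℤ}
    (hw : SuppIn n (w * longest m)) (hinc : ∀ i j : ℤ, 1 ≤ i → i < j → j ≤ m → w i < w j)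
    {i : ℤ} (h1 : 1 ≤ i) (h2 : i ≤ m) :
    code n (w * longest m) i = (w (m + 1 - i) - 1).toNat := by
  set v := w * longest m with hv
  have hvi : v i = w (m + 1 - i) := by rw [hv, Equiv.Perm.mul_apply, longest_apply h1 h2]
  rw [← hvi, ← Int.card_Ico 1 (v i), code]
  have hvi' := hw.mem h1 (show i ≤ n by omega)
  refine Finset.card_nbij v ?_ v.injective.injOn ?_
  · intro j hj
    rw [Finset.mem_coe, Finset.mem_filter, Finset.mem_Icc] at hj
    have := hw.mem hj.1.1 hj.1.2
    rw [Finset.mem_coe, Finset.mem_Ico]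
    omega
  · intro k hk
    simp only [Finset.coe_Ico, Set.mem_Ico] at hk
    refine ⟨v.symm k, ?_, v.apply_symm_apply k⟩
    set j := v.symm k with hj
    have hjk : v j = k := v.apply_symm_apply k
    have hj1 : 1 ≤ j ∧ j ≤ n := by
      by_contra hcon
      have := hw j (by omega)
      omega
    simp only [Finset.coe_filter, Finset.mem_Icc, Set.mem_ofPred_eq]
    refine ⟨hj1, ?_, by omega⟩
    by_contra hlt
    have hne : j ≠ i := by rintro h; rw [h] at hjk; omega
    have hvj : v j = w (m + 1 - j) := by
      rw [hv, Equiv.Perm.mul_apply, longest_apply hj1.1 (by omega)]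
    have := hinc (m + 1 - i) (m + 1 - j) (by omega) (by omega) (by omega)
    omega

theorem code_mul_longest_of_lt {n : ℤ} {m : ℕ} {w : Equiv.Perm ℤ}
    (hinc : ∀ i j : ℤ, m < i → i < j → w i < w j) {i : ℤ} (h : m < i) :
    code n (w * longest m) i = 0 := by
  rw [code, Finset.card_eq_zero, Finset.filter_eq_empty_iff]
  rintro j - ⟨h1, h2⟩
  rw [Equiv.Perm.mul_apply, Equiv.Perm.mul_apply, longest_apply_of_lt h,
    longest_apply_of_lt (by omega)] at h2
  have := hinc i j h h1
  omega

/-- The product `(x_i ⊖ a_1) ⋯ (x_i ⊖ a_l)`. -/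
noncomputable def factorialPow (i : ℤ) (l : ℕ) : Series :=
  ∏ c ∈ Finset.range l, xMinusA i (c + 1)

/-- The numerator of the bialternant formula for exponents `l_1, …, l_m`. -/
noncomputable def bialternant (m : ℕ) (l : ℕ → ℕ) : Series :=
  (Matrix.of fun i j : Fin m =>
    (1 - x ((i : ℤ) + 1)) ^ (j : ℕ) * factorialPow ((i : ℤ) + 1) (l j)).det

/-- The polynomial is symmetric in x_1, …, x_m, so it can be pulled out of the antisymmetrization of
ρ, which is a Vandermonde determinant. The antisymmetrization also equals that for the dominant
permutation, where it is a determinant because ρ and the diagram product both factor over the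
variables. -/
theorem doubleGrothendieck_mul_vdm {n : ℤ} {m : ℕ} (hm : m ≤ n) {w : Equiv.Perm ℤ}
    (hw : SuppIn n w) (hinc : ∀ i j : ℤ, 1 ≤ i → i < j → j ≤ m → w i < w j)
    (hinc' : ∀ i j : ℤ, m < i → i < j → w i < w j) :
    doubleGrothendieck n w * vdm m = bialternant m fun j => (w (m - j) - 1).toNat := by
  obtain ⟨hv, halt⟩ := alt_rho_mul_longest hm hw hinc
  have hc : ∀ {i : ℤ}, 1 ≤ i → i ≤ m → code n (w * longest m) i = (w (m + 1 - i) - 1).toNat :=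
    code_mul_longest hm hv hinc
  have hc' : ∀ {i : ℤ}, m < i → code n (w * longest m) i = 0 := code_mul_longest_of_lt hinc'
  have hsymm : ∀ i : ℤ, 1 ≤ i → i < m →
      swapX i (doubleGrothendieck n w) = doubleGrothendieck n w := fun i h1 h2 =>
    swapX_doubleGrothendieck hw h1 (by omega) (hinc i (i + 1) h1 (by omega) (by omega))
  rw [← alt_rho, ← alt_mul hsymm, mul_comm, halt, doubleGrothendieck_dominant _ hv]
  · have hprod : diagramProd n (code n (w * longest m)) =
        ∏ j : Fin m, factorialPow ((j : ℤ) + 1) (w (m - (j : ℕ)) - 1).toNat := by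
      rw [diagramProd, ← Finset.prod_subset (s₁ := Finset.univ.map (finEmb m)), Finset.prod_map]
      · refine Finset.prod_congr rfl fun j _ => ?_
        rw [finEmb_apply, hc (by omega) (by omega), factorialPow]
        congr 5
        ring
      · intro i hi
        simp only [Finset.mem_map, Finset.mem_univ, true_and, finEmb_apply] at hi
        obtain ⟨j, rfl⟩ := hi
        rw [Finset.mem_Icc]
        omega
      · intro i hi hi'
        rw [Finset.mem_Icc] at hi
        have : m < i := by
          by_contra hcon
          apply hi'
          simp only [Finset.mem_map, Finset.mem_univ, true_and, finEmb_apply]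
          exact ⟨⟨(i - 1).toNat, by omega⟩, by simp; omega⟩
        rw [hc' this, Finset.prod_range_zero]
    rw [hprod, rho, ← Finset.prod_mul_distrib, alt_prod (fun i j : Fin m =>
      (1 - x ((i : ℤ) + 1)) ^ (j : ℕ) *
        factorialPow ((i : ℤ) + 1) (w (m - (j : ℕ)) - 1).toNat), bialternant]
    intro σ i j
    simp only [factorialPow, map_mul, map_pow, map_sub, map_one, map_prod, permFin_x,
      permFin_xMinusA]
  · intro i h1 h2
    by_cases h : i + 1 ≤ m
    · rw [hc h1 (by omega), hc (by omega) h]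
      have := hinc (m + 1 - (i + 1)) (m + 1 - i) (by omega) (by omega) (by omega)
      omega
    · rw [hc' (by omega)]
      exact Nat.zero_le _

/-! ### Branching -/

/-- The X-factors are exchanged for Z-factors one at a time by means of `H`; u marks the position of
the exchange. At the lowest position there is no factor 1 - Z, because the term with 1 - y on the
left absorbs it. -/
theorem telescoping {R : Type*} [CommRing R] {y z : R} {X Z : ℕ → R}
    (H : ∀ c, (1 - z) * X c = (1 - z) * Z c + (y - z) * (1 - Z c)) (s p q : ℕ) (hpq : p ≤ q) :
    (1 - z) * ∏ c ∈ Finset.Ico (p + s) (q + s + 1), X c -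
        (1 - y) * ∏ c ∈ Finset.Ico (p + s) (q + s + 1), Z c =
      (y - z) * ∑ u ∈ Finset.Icc p q, (∏ c ∈ Finset.Ico (u + s + 1) (q + s + 1), Z c) *
        (if p < u then 1 - Z (u + s) else 1) * ∏ c ∈ Finset.Ico (p + s) (u + s), X c := by
  induction q, hpq using Nat.le_induction with
  | base =>
    simp only [Finset.Icc_self, Finset.sum_singleton, Nat.Ico_succ_singleton,
      Finset.prod_singleton, Finset.Ico_self, Finset.prod_empty, lt_irrefl, if_false]
    linear_combination H (p + s)
  | succ q hpq ih =>
    rw [Finset.sum_Icc_succ_top (by omega), show q + 1 + s + 1 = q + s + 1 + 1 by ring,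
      Finset.prod_Ico_succ_top (show p + s ≤ q + s + 1 by omega) X,
      Finset.prod_Ico_succ_top (show p + s ≤ q + s + 1 by omega) Z]
    have : ∀ u ∈ Finset.Icc p q, (∏ c ∈ Finset.Ico (u + s + 1) (q + s + 1 + 1), Z c) *
        (if p < u then 1 - Z (u + s) else 1) * ∏ c ∈ Finset.Ico (p + s) (u + s), X c =
        Z (q + s + 1) * ((∏ c ∈ Finset.Ico (u + s + 1) (q + s + 1), Z c) *
        (if p < u then 1 - Z (u + s) else 1) * ∏ c ∈ Finset.Ico (p + s) (u + s), X c) := by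
      intro u hu
      rw [Finset.mem_Icc] at hu
      rw [Finset.prod_Ico_succ_top (by omega)]
      ring
    rw [Finset.sum_congr rfl this, ← Finset.mul_sum, mul_add, mul_left_comm (y - z) (Z _), ← ih,
      show q + 1 + s = q + s + 1 by ring, Finset.Ico_self, Finset.prod_empty,
      if_pos (show p < q + 1 by omega)]
    linear_combination (∏ c ∈ Finset.Ico (p + s) (q + s + 1), X c) * H (q + s + 1)

/-- The weight of a row: `l` and `u` list the lengths of the partitions on both sides. -/
noncomputable def rowWeight (r : ℤ) (K : ℕ) (l u : ℕ → ℕ) : Series :=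
  ∏ k ∈ Finset.range K, (∏ c ∈ Finset.Ico (u k) (l k), xMinusA r (r + c - k)) *
    (if l (k + 1) < u k then 1 - xMinusA r (r + (u k - 1) - k) else 1)

/-- Extension by zero. -/
def extendZero {m : ℕ} (u : Fin m → ℕ) (k : ℕ) : ℕ := if h : k < m then u ⟨k, h⟩ else 0

theorem extendZero_coe {m : ℕ} (u : Fin m → ℕ) (k : Fin m) : extendZero u k = u k :=
  dif_pos k.2

theorem extendZero_of_le {m : ℕ} (u : Fin m → ℕ) {k : ℕ} (h : m ≤ k) : extendZero u k = 0 :=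
  dif_neg (by omega)

/-- The lists `u` of `m` numbers that interlace with `l`. -/
def interlacing (m : ℕ) (l : ℕ → ℕ) : Finset (Fin m → ℕ) :=
  Fintype.piFinset fun j : Fin m => Finset.Icc (l (j + 1)) (l j)

/-- Both differences have the denominator 1 - a_j: X - Z has numerator x_i - x_z, and 1 - Z has
numerator 1 - x_z. -/
theorem xMinusA_relation (i z j : ℤ) :
    (1 - x z) * xMinusA i j = (1 - x z) * xMinusA z j + (x i - x z) * (1 - xMinusA z j) := by
  apply mul_right_cancel₀ (one_sub_a_ne_zero j)
  linear_combination (1 - x z) * xMinusA_mul i j - (1 - x i) * xMinusA_mul z j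

theorem factorialPow_eq_mul (i : ℤ) {p q : ℕ} (h : p ≤ q) :
    factorialPow i q = factorialPow i p * ∏ c ∈ Finset.Ico p q, xMinusA i (c + 1) :=
  (Finset.prod_range_mul_prod_Ico _ h).symm

theorem factorialPow_telescoping (i z : ℤ) (j s p q : ℕ) (hpq : p ≤ q) :
    (1 - x z) * ((1 - x i) ^ j * factorialPow i (q + s + 1)) -
      (∏ c ∈ Finset.Ico (p + s) (q + s + 1), xMinusA z (c + 1)) *
        ((1 - x i) ^ (j + 1) * factorialPow i (p + s)) =
    (x i - x z) * ∑ u ∈ Finset.Icc p q,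
      ((∏ c ∈ Finset.Ico (u + s + 1) (q + s + 1), xMinusA z (c + 1)) *
        (if p < u then 1 - xMinusA z ((u + s : ℕ) + 1) else 1)) *
      ((1 - x i) ^ j * factorialPow i (u + s)) := by
  have H := telescoping (y := x i) (z := x z) (X := fun c : ℕ => xMinusA i (c + 1))
    (Z := fun c : ℕ => xMinusA z (c + 1)) (fun c => xMinusA_relation _ _ _) s p q hpq
  have : ∀ u ∈ Finset.Icc p q,
      ((∏ c ∈ Finset.Ico (u + s + 1) (q + s + 1), xMinusA z (c + 1)) *
        (if p < u then 1 - xMinusA z ((u + s : ℕ) + 1) else 1)) *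
      ((1 - x i) ^ j * factorialPow i (u + s)) =
      ((1 - x i) ^ j * factorialPow i (p + s)) *
      ((∏ c ∈ Finset.Ico (u + s + 1) (q + s + 1), xMinusA z (c + 1)) *
        (if p < u then 1 - xMinusA z ((u + s : ℕ) + 1) else 1) *
        ∏ c ∈ Finset.Ico (p + s) (u + s), xMinusA i (c + 1)) := by
    intro u hu
    rw [Finset.mem_Icc] at hu
    rw [factorialPow_eq_mul i (show p + s ≤ u + s by omega)]
    ring
  rw [Finset.sum_congr rfl this, ← Finset.mul_sum,
    factorialPow_eq_mul i (show p + s ≤ q + s + 1 by omega), mul_left_comm (x i - x z), ← H]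
  ring

/-! ### Determinant identities and the branching rule -/

/-- The column operations amount to multiplication by a lower triangular matrix with diagonal d, …,
d, 1. -/
theorem det_mul_eq_of_col_sub {R : Type*} [CommRing R] {m : ℕ}
    (M N : Matrix (Fin (m + 1)) (Fin (m + 1)) R) (d : R) (C : Fin m → R)
    (h : ∀ i (j : Fin m), N i j.castSucc = d * M i j.castSucc - C j * M i j.succ)
    (hlast : ∀ i, N i (Fin.last m) = M i (Fin.last m)) :
    N.det = d ^ m * M.det := by
  let U : Matrix (Fin (m + 1)) (Fin (m + 1)) R := fun k j =>
    Fin.lastCases (motive := fun _ => R) (if k = Fin.last m then 1 else 0)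
      (fun j' => if k = j'.castSucc then d else if k = j'.succ then -C j' else 0) j
  have hU1 : ∀ k (j : Fin m), U k j.castSucc =
      if k = j.castSucc then d else if k = j.succ then -C j else 0 := fun k j => by
    simp only [U, Fin.lastCases_castSucc]
  have hU2 : ∀ k, U k (Fin.last m) = if k = Fin.last m then 1 else 0 := fun k => by
    simp only [U, Fin.lastCases_last]
  have hN : N = M * U := by
    ext i j
    rw [Matrix.mul_apply]
    induction j using Fin.lastCases with
    | last => simp [hU2, hlast]
    | cast j =>
      have hne : j.castSucc ≠ j.succ := Fin.castSucc_lt_succ.ne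
      rw [h, Finset.sum_eq_add j.castSucc j.succ hne]
      · rw [hU1, hU1, if_pos rfl, if_neg hne.symm, if_pos rfl]
        ring
      · rintro k - ⟨h1, h2⟩
        rw [hU1, if_neg h1, if_neg h2, mul_zero]
      · simp
      · simp
  have hdet : U.det = d ^ m := by
    rw [Matrix.det_of_isLowerTriangular, Fin.prod_univ_castSucc, hU2, if_pos rfl, mul_one]
    · simp [hU1]
    · intro k j hkj
      have hkj : k < j := hkj
      induction j using Fin.lastCases with
      | last => rw [hU2, if_neg hkj.ne]
      | cast j =>
        rw [hU1, if_neg hkj.ne, if_neg]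
        rintro rfl
        exact absurd hkj (not_lt.2 Fin.castSucc_lt_succ.le)
  rw [hN, Matrix.det_mul, hdet, mul_comm]

theorem det_of_last_row {R : Type*} [CommRing R] {m : ℕ}
    (N : Matrix (Fin (m + 1)) (Fin (m + 1)) R) (h : ∀ j : Fin m, N (Fin.last m) j.castSucc = 0) :
    N.det = N (Fin.last m) (Fin.last m) *
      (Matrix.of fun i j : Fin m => N i.castSucc j.castSucc).det := by
  rw [Matrix.det_succ_row N (Fin.last m), Fin.sum_univ_castSucc]
  simp only [h, mul_zero, zero_mul, Finset.sum_const_zero, zero_add, Fin.val_last,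
    Fin.succAbove_last]
  rw [Even.neg_one_pow ⟨m, rfl⟩, one_mul]
  rfl

theorem det_sum_col {R : Type*} [CommRing R] {m : ℕ} (A : Fin m → Finset ℕ)
    (ω : Fin m → ℕ → R) (B : Fin m → Fin m → ℕ → R) :
    (Matrix.of fun i j : Fin m => ∑ u ∈ A j, ω j u * B i j u).det =
      ∑ u ∈ Fintype.piFinset A, (∏ j, ω j (u j)) *
        (Matrix.of fun i j : Fin m => B i j (u j)).det := by
  rw [← Matrix.det_transpose]
  have h1 : (Matrix.of fun i j : Fin m => ∑ u ∈ A j, ω j u * B i j u).transpose =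
      fun j => ∑ u ∈ A j, ω j u • fun i => B i j u := by
    ext j i
    simp [Matrix.transpose_apply, Finset.sum_apply]
  have h2 := (Matrix.detRowAlternating (n := Fin m) (R := R)).toMultilinearMap.map_sum_finset
    (fun j u => ω j u • fun i => B i j u) A
  simp only [AlternatingMap.coe_multilinearMap] at h2
  rw [h1]
  refine h2.trans (Finset.sum_congr rfl fun u _ => ?_)
  rw [← AlternatingMap.coe_multilinearMap, MultilinearMap.map_smul_univ, smul_eq_mul,
    ← Matrix.det_transpose (Matrix.of _)]
  rfl

theorem prod_boxes_shift {m j : ℕ} (hj : j < m) (p q : ℕ) :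
    ∏ c ∈ Finset.Ico (p + (m - 1 - j) + 1) (q + (m - 1 - j) + 1), xMinusA (m + 1) (c + 1) =
      ∏ c ∈ Finset.Ico p q, xMinusA (m + 1) (m + 1 + c - j) := by
  rw [add_assoc, add_assoc, ← Finset.prod_Ico_add' (fun c : ℕ => xMinusA (m + 1) (c + 1))]
  refine Finset.prod_congr rfl fun c _ => ?_
  congr 1
  push_cast
  omega

/-- Combining each column with the next one makes every entry outside the last column divisible by
x_i - x_{m+1}. The last row is then zero except in the corner. The remaining minor is expanded by
multilinearity in the columns, and the choices of summands are exactly the interlacing lists. -/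
theorem bialternant_branching (m : ℕ) {l : ℕ → ℕ} (hl : ∀ k, l (k + 1) ≤ l k) :
    bialternant (m + 1) (fun j => l j + (m - j)) =
      (∏ i : Fin m, (x ((i : ℤ) + 1) - x (m + 1))) *
        ∑ u ∈ interlacing m l, rowWeight (m + 1) (m + 1) l (extendZero u) *
          bialternant m (fun j => extendZero u j + (m - 1 - j)) := by
  set z : ℤ := (m : ℤ) + 1 with hz
  obtain ⟨M, hM⟩ : ∃ M : Matrix (Fin (m + 1)) (Fin (m + 1)) Series, M = Matrix.of fun (i j : Fin (m + 1)) =>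
    (1 - x ((i : ℤ) + 1)) ^ (j : ℕ) * factorialPow ((i : ℤ) + 1) (l j + (m - j)) := ⟨_, rfl⟩
  have hMdet : bialternant (m + 1) (fun j => l j + (m - j)) = M.det := by rw [hM, bialternant]
  -- `C j` is the product of Z-factors over the range by which the exponent of column j exceeds that
  -- of column j + 1, as required by `factorialPow_telescoping`.
  obtain ⟨C, hC⟩ : ∃ C : Fin m → Series, ∀ j, C j =
    ∏ c ∈ Finset.Ico (l (j + 1) + (m - 1 - j)) (l j + (m - 1 - j) + 1), xMinusA z (c + 1) :=
    ⟨_, fun _ => rfl⟩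
  obtain ⟨N, hN1, hN2⟩ : ∃ N : Matrix (Fin (m + 1)) (Fin (m + 1)) Series,
      (∀ i (j : Fin m), N i j.castSucc = (1 - x z) * M i j.castSucc - C j * M i j.succ) ∧
      ∀ i, N i (Fin.last m) = M i (Fin.last m) :=
    ⟨fun i j => Fin.lastCases (motive := fun _ => Series) (M i (Fin.last m))
      (fun j' => (1 - x z) * M i j'.castSucc - C j' * M i j'.succ) j,
      fun i j => by simp only [Fin.lastCases_castSucc], fun i => by simp only [Fin.lastCases_last]⟩
  obtain ⟨ω, hω⟩ : ∃ ω : Fin m → ℕ → Series, ∀ j u, ω j u =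
    (∏ c ∈ Finset.Ico (u + (m - 1 - j) + 1) (l j + (m - 1 - j) + 1), xMinusA z (c + 1)) *
        (if l (j + 1) < u then 1 - xMinusA z ((u + (m - 1 - j) : ℕ) + 1) else 1) :=
    ⟨_, fun _ _ => rfl⟩
  have hNt : ∀ i (j : Fin m), N i j.castSucc = (x ((i : ℤ) + 1) - x z) *
      ∑ u ∈ Finset.Icc (l (j + 1)) (l j), ω j u *
        ((1 - x ((i : ℤ) + 1)) ^ (j : ℕ) * factorialPow ((i : ℤ) + 1) (u + (m - 1 - j))) := by
    intro i j
    simp only [hω]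
    rw [← factorialPow_telescoping _ _ _ _ _ _ (hl j), hN1]
    simp only [hM, hC, Matrix.of_apply, Fin.val_castSucc, Fin.val_succ]
    rw [show l j + (m - j) = l j + (m - 1 - j) + 1 by omega,
      show m - ((j : ℕ) + 1) = m - 1 - j by omega]
  have hd := det_mul_eq_of_col_sub M N (1 - x z) C hN1 hN2
  rw [det_of_last_row N fun j => by rw [hNt, Fin.val_last, sub_self, zero_mul], hN2] at hd
  have hlast : M (Fin.last m) (Fin.last m) = (1 - x z) ^ m * factorialPow z (l m) := by
    simp only [hM, Matrix.of_apply, Fin.val_last, Nat.sub_self, add_zero, hz]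
  have hsub : (Matrix.of fun i j : Fin m => N i.castSucc j.castSucc).det =
      (∏ i : Fin m, (x ((i : ℤ) + 1) - x z)) *
        ∑ u ∈ interlacing m l, (∏ j, ω j (u j)) *
          bialternant m (fun j => extendZero u j + (m - 1 - j)) := by
    simp only [hNt, Fin.val_castSucc]
    rw [interlacing]
    have := det_sum_col (fun j : Fin m => Finset.Icc (l (j + 1)) (l j)) ω
      (fun i j u => (1 - x ((i : ℤ) + 1)) ^ (j : ℕ) *
        factorialPow ((i : ℤ) + 1) (u + (m - 1 - j)))
    simp only [bialternant, extendZero_coe]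
    rw [← this, ← Matrix.det_mul_column]
    rfl
  -- The scaling of m columns by 1 - x_z is undone by the power of 1 - x_z in the corner entry.
  have hne : (1 - x z) ^ m ≠ 0 := pow_ne_zero _ (one_sub_x_ne_zero z)
  apply mul_left_cancel₀ hne
  rw [hMdet, ← hd, hlast, hsub, mul_assoc, mul_left_comm (factorialPow z (l m)), Finset.mul_sum]
  congr 2
  refine Finset.sum_congr rfl fun u hu => ?_
  rw [← mul_assoc]
  congr 1
  -- The part with index m of the smaller partition is 0, so its whole row is removed; these boxes
  -- account for the factorial power in the corner entry.
  rw [rowWeight, Finset.prod_range_succ, extendZero_of_le u le_rfl, if_neg (Nat.not_lt_zero _),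
    mul_one, mul_comm, Finset.prod_range]
  congr 1
  · refine Finset.prod_congr rfl fun j _ => ?_
    rw [extendZero_coe]
    rw [hω, prod_boxes_shift j.2]
    refine congrArg₂ _ rfl (if_congr Iff.rfl ?_ rfl)
    rw [show (((u j + (m - 1 - j) : ℕ) : ℤ) + 1) = m + 1 + ((u j : ℤ) - 1) - j by omega]
  · rw [factorialPow, Finset.range_eq_Ico]
    refine Finset.prod_congr rfl fun c _ => ?_
    congr 1
    omega

theorem vdm_succ (m : ℕ) :
    vdm (m + 1) = vdm m * ∏ i : Fin m, (x ((i : ℤ) + 1) - x (m + 1)) := by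
  have key : ∀ n : ℕ, vdm n = ∏ i : Fin n, ∏ j : Fin n,
      if i < j then x ((i : ℤ) + 1) - x ((j : ℤ) + 1) else 1 := by
    intro n
    rw [vdm, Matrix.det_vandermonde]
    refine Finset.prod_congr rfl fun i _ => ?_
    rw [← Finset.prod_filter]
    refine Finset.prod_congr (by ext j; simp) fun j _ => by ring
  rw [key, key, Fin.prod_univ_castSucc]
  simp only [Fin.prod_univ_castSucc, Fin.val_castSucc, Fin.val_last, Fin.castSucc_lt_castSucc_iff,
    Fin.castSucc_lt_last, if_true, lt_irrefl, if_false, mul_one]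
  rw [Finset.prod_mul_distrib, Finset.prod_eq_one fun j _ => if_neg (not_lt.2 (Fin.le_last _)),
    mul_one]

/-! ### Iterating the branching rule -/

/-- The sum of the weights of all chains of interlacing partitions from the empty one to `l`. -/
noncomputable def chainSum : ℕ → (ℕ → ℕ) → Series
  | 0, _ => 1
  | m + 1, l => ∑ u ∈ interlacing m l,
      rowWeight (m + 1) (m + 1) l (extendZero u) * chainSum m (extendZero u)

theorem extendZero_antitone {m : ℕ} {l : ℕ → ℕ} {u : Fin m → ℕ} (hu : u ∈ interlacing m l)
    (k : ℕ) : extendZero u (k + 1) ≤ extendZero u k := by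
  simp only [interlacing, Fintype.mem_piFinset, Finset.mem_Icc] at hu
  by_cases h : k + 1 < m
  · have h1 := hu ⟨k, by omega⟩
    have h2 := hu ⟨k + 1, h⟩
    rw [← extendZero_coe u] at h1 h2
    exact h2.2.trans h1.1
  · rw [extendZero_of_le u (by omega)]
    exact Nat.zero_le _

/-- The factors x_i - x_{m+1} split off by the branching rule are those by which the Vandermonde
determinant grows with one more variable. -/
theorem bialternant_eq (m : ℕ) {l : ℕ → ℕ} (hl : ∀ k, l (k + 1) ≤ l k) :
    bialternant m (fun j => l j + (m - 1 - j)) = vdm m * chainSum m l := by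
  induction m generalizing l with
  | zero => simp [bialternant, vdm, chainSum]
  | succ m ih =>
    have := bialternant_branching m hl
    rw [Nat.add_sub_cancel, this, vdm_succ, chainSum, mul_comm (vdm m), mul_assoc]
    congr 1
    rw [Finset.mul_sum]
    refine Finset.sum_congr rfl fun u hu => ?_
    rw [ih (extendZero_antitone hu)]
    ring

theorem doubleGrothendieck_eq_chainSum {n : ℤ} {m : ℕ} (hm : m ≤ n) {w : Equiv.Perm ℤ}
    (hw : SuppIn n w) (hinc : ∀ i j : ℤ, 1 ≤ i → i < j → j ≤ m → w i < w j)
    (hinc' : ∀ i j : ℤ, m < i → i < j → w i < w j) {l : ℕ → ℕ} (hl : ∀ k, l (k + 1) ≤ l k)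
    (hwl : ∀ k : ℕ, k < m → w (m - k) = m - k + l k) :
    doubleGrothendieck n w = chainSum m l := by
  apply mul_right_cancel₀ (vdm_ne_zero m)
  rw [doubleGrothendieck_mul_vdm hm hw hinc hinc', mul_comm (chainSum m l), ← bialternant_eq m hl]
  unfold bialternant
  congr 2
  funext i j
  dsimp only
  rw [hwl j j.2]
  congr 2
  omega

/-! ### Chains of interlacing partitions -/

/-- Consecutive rows interlace. -/
def Interlaces (P : ℕ → ℕ → ℕ) : Prop :=
  ∀ t k, P t (k + 1) ≤ P (t + 1) k ∧ P (t + 1) k ≤ P t k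

theorem Interlaces.succ_le {P : ℕ → ℕ → ℕ} (h : Interlaces P) (t k : ℕ) :
    P t (k + 1) ≤ P t k := (h t k).1.trans (h t k).2

theorem Interlaces.anti_right {P : ℕ → ℕ → ℕ} (h : Interlaces P) (t : ℕ) {k k' : ℕ}
    (hk : k ≤ k') : P t k' ≤ P t k := antitone_nat_of_succ_le (h.succ_le t) hk

theorem Interlaces.anti_left {P : ℕ → ℕ → ℕ} (h : Interlaces P) {t t' : ℕ} (ht : t ≤ t')
    (k : ℕ) : P t' k ≤ P t k :=
  antitone_nat_of_succ_le (f := fun t => P t k) (fun t => (h t k).2) ht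

theorem Interlaces.le_of_lt {P : ℕ → ℕ → ℕ} (h : Interlaces P) (t : ℕ) {k k' : ℕ}
    (hk : k < k') : P t k' ≤ P (t + 1) k :=
  (h.anti_right t hk).trans (h t k).1

/-- Put the row `l` before the rows `Q`. -/
def consRow (l : ℕ → ℕ) (Q : ℕ → ℕ → ℕ) : ℕ → ℕ → ℕ
  | 0 => l
  | t + 1 => Q t

theorem consRow_injective (l : ℕ → ℕ) : Function.Injective (consRow l) := fun _ _ h =>
  funext fun t => congrFun h (t + 1)

theorem extendZero_injective (m : ℕ) :
    Function.Injective (extendZero : (Fin m → ℕ) → ℕ → ℕ) := fun u v h => by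
  ext j
  rw [← extendZero_coe u, h, extendZero_coe]

open Classical in
/-- The chains that start with `l` and vanish from step `m` on. -/
noncomputable def chains : ℕ → (ℕ → ℕ) → Finset (ℕ → ℕ → ℕ)
  | 0, _ => {fun _ _ => 0}
  | m + 1, l => (interlacing m l).biUnion fun u => (chains m (extendZero u)).image (consRow l)

theorem mem_chains {m : ℕ} {l : ℕ → ℕ} (hl : ∀ k, m ≤ k → l k = 0) (P : ℕ → ℕ → ℕ) :
    P ∈ chains m l ↔ P 0 = l ∧ Interlaces P ∧ P m = 0 := by
  classical
  induction m generalizing l P with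
  | zero =>
    rw [chains, Finset.mem_singleton]
    constructor
    · rintro rfl
      exact ⟨funext fun k => (hl k (Nat.zero_le _)).symm, fun t k => ⟨le_rfl, le_rfl⟩, rfl⟩
    · rintro ⟨-, h, h0⟩
      ext t k
      have := h.anti_left (Nat.zero_le t) k
      rw [h0] at this
      exact Nat.le_zero.1 this
  | succ m ih =>
    simp only [chains, Finset.mem_biUnion, Finset.mem_image]
    constructor
    · rintro ⟨u, hu, Q, hQ, rfl⟩
      rw [ih (fun k hk => extendZero_of_le u hk)] at hQ
      refine ⟨rfl, ?_, hQ.2.2⟩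
      rintro (_ | t) k
      · simp only [consRow, hQ.1]
        simp only [interlacing, Fintype.mem_piFinset, Finset.mem_Icc] at hu
        by_cases hk : k < m
        · have := hu ⟨k, hk⟩
          rwa [← extendZero_coe u] at this
        · rw [extendZero_of_le u (by omega), hl (k + 1) (by omega)]
          exact ⟨le_rfl, Nat.zero_le _⟩
      · exact hQ.2.1 t k
    · rintro ⟨h0, h, hm⟩
      have h1 : ∀ k, m ≤ k → P 1 k = 0 := by
        intro k hk
        -- A horizontal strip shortens a column by at most one box, so a shape that is emptied in m
        -- steps has at most m rows; this is interlacing followed along an antidiagonal.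
        have : ∀ j, P (1 + j) (m - j) = 0 → j ≤ m → P 1 m = 0 := by
          intro j
          induction j with
          | zero => exact fun h _ => h
          | succ j ihj =>
            intro hj hjm
            refine ihj ?_ (by omega)
            have := (h (1 + j) (m - (j + 1))).1
            rw [show m - (j + 1) + 1 = m - j by omega, add_assoc, hj] at this
            omega
        have h2 := this m (by rw [add_comm, hm]; rfl) le_rfl
        have := h.anti_right 1 hk
        omega
      have hext : extendZero (fun j : Fin m => P 1 j) = P 1 := by
        ext k
        by_cases hk : k < m
        · exact extendZero_coe (fun j : Fin m => P 1 j) ⟨k, hk⟩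
        · rw [extendZero_of_le _ (by omega), h1 k (by omega)]
      refine ⟨fun j => P 1 j, ?_, fun t => P (t + 1), ?_, ?_⟩
      · simp only [interlacing, Fintype.mem_piFinset, Finset.mem_Icc]
        intro j
        rw [← h0]
        exact h 0 j
      · rw [hext, ih h1]
        exact ⟨rfl, fun t k => h (t + 1) k, hm⟩
      · funext t
        rcases t with _ | t
        · exact h0.symm
        · rfl

theorem sum_chains_succ (m : ℕ) (l : ℕ → ℕ) (f : (ℕ → ℕ → ℕ) → Series) :
    ∑ P ∈ chains (m + 1) l, f P =
      ∑ u ∈ interlacing m l, ∑ Q ∈ chains m (extendZero u), f (consRow l Q) := by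
  classical
  rw [chains, Finset.sum_biUnion]
  · refine Finset.sum_congr rfl fun u _ => ?_
    rw [Finset.sum_image ((consRow_injective l).injOn)]
  · intro u _ v _ huv
    rw [Function.onFun, Finset.disjoint_left]
    intro P hP hP'
    rw [Finset.mem_image] at hP hP'
    obtain ⟨Q, hQ, rfl⟩ := hP
    obtain ⟨Q', hQ', h⟩ := hP'
    obtain rfl := consRow_injective l h
    rw [mem_chains fun k hk => extendZero_of_le _ hk] at hQ hQ'
    exact huv (extendZero_injective m (hQ.1.symm.trans hQ'.1))

/-- Empty rows contribute the factor 1. This lets all steps use one common number of rows although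
the branching rule loses a row each time. -/
theorem rowWeight_eq_of_le {r : ℤ} {K K' : ℕ} (h : K ≤ K') {l u : ℕ → ℕ}
    (hl : ∀ k, K ≤ k → l k = 0) (hu : ∀ k, K ≤ k → u k = 0) :
    rowWeight r K' l u = rowWeight r K l u := by
  refine (Finset.prod_subset (Finset.range_subset_range.2 h) fun k _ hk => ?_).symm
  rw [Finset.mem_range, not_lt] at hk
  rw [hl k hk, hu k hk, Finset.Ico_self, Finset.prod_empty, if_neg (Nat.not_lt_zero _), mul_one]

theorem rowWeight_of_eq_zero {r : ℤ} {K : ℕ} {l u : ℕ → ℕ} (hl : l = 0) (hu : u = 0) :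
    rowWeight r K l u = 1 := by
  rw [rowWeight_eq_of_le (Nat.zero_le K) (by simp [hl]) (by simp [hu])]
  rfl

theorem chainSum_eq {m K : ℕ} (hK : m ≤ K) {l : ℕ → ℕ} (hl : ∀ k, m ≤ k → l k = 0) :
    chainSum m l = ∑ P ∈ chains m l,
      ∏ t ∈ Finset.range m, rowWeight (m - t) K (P t) (P (t + 1)) := by
  induction m generalizing l with
  | zero => simp [chainSum, chains]
  | succ m ih =>
    rw [sum_chains_succ, chainSum]
    refine Finset.sum_congr rfl fun u hu => ?_
    rw [ih (by omega) (fun k hk => extendZero_of_le u hk), mul_comm, Finset.sum_mul]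
    refine Finset.sum_congr rfl fun Q hQ => ?_
    rw [mem_chains fun k hk => extendZero_of_le _ hk] at hQ
    rw [Finset.prod_range_succ']
    refine congrArg₂ _ (Finset.prod_congr rfl fun t _ => ?_) ?_
    · rw [show ((m + 1 : ℕ) : ℤ) - ((t + 1 : ℕ) : ℤ) = m - t by push_cast; ring]
      rfl
    · rw [show ((m + 1 : ℕ) : ℤ) - ((0 : ℕ) : ℤ) = m + 1 by push_cast; ring,
        ← rowWeight_eq_of_le hK hl fun k hk => extendZero_of_le u (by omega), ← hQ.1]
      rfl

/-! ### Shifted row weights, and chains starting at a Young diagram -/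

theorem shiftSeries_xMinusA (s i j : ℤ) :
    shiftSeries s (xMinusA i j) = xMinusA (i + s) (j + s) := by
  have hx : ∀ k, shiftSeries s (x k) = x (k + s) := fun k => by
    simp only [shiftSeries, MvPowerSeries.renameEquiv, x]
    exact MvPowerSeries.rename_X _ _
  have ha : ∀ k, shiftSeries s (a k) = a (k + s) := fun k => by
    simp only [shiftSeries, MvPowerSeries.renameEquiv, a]
    exact MvPowerSeries.rename_X _ _
  apply mul_right_cancel₀ (one_sub_a_ne_zero (j + s))
  have := congrArg (shiftSeries s) (xMinusA_mul i j)
  rw [map_mul, map_sub, map_sub, map_one, hx, ha] at this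
  rw [this, xMinusA_mul]

theorem shiftSeries_rowWeight (s r : ℤ) (K : ℕ) (l u : ℕ → ℕ) :
    shiftSeries s (rowWeight r K l u) = rowWeight (r + s) K l u := by
  have e : ∀ c k : ℤ, r + c - k + s = r + s + c - k := fun c k => by ring
  simp only [rowWeight, map_prod, map_mul, apply_ite (shiftSeries s), map_sub, map_one,
    shiftSeries_xMinusA, e]

/-- The chains of interlacing partitions from `μ` to the empty partition. -/
structure Chain (μ : YoungDiagram) where
  row : ℕ → ℕ → ℕ
  row_zero : row 0 = μ.rowLen
  interlaces : Interlaces row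
  exists_zero : ∃ m, row m = 0

namespace Chain

variable {μ : YoungDiagram}

theorem ext' {P Q : Chain μ} (h : P.row = Q.row) : P = Q := by
  cases P; cases Q; congr

/-- A step from which on the chain is empty. -/
noncomputable def len (P : Chain μ) : ℕ := P.exists_zero.choose

theorem row_eq_zero (P : Chain μ) {m m' : ℕ} (h : P.row m = 0) (h' : m ≤ m') :
    P.row m' = 0 := by
  ext k
  have := P.interlaces.anti_left h' k
  rw [h] at this
  exact Nat.le_zero.1 this

theorem row_len (P : Chain μ) : P.row P.len = 0 := P.exists_zero.choose_spec

theorem row_eq_zero_of_colLen_le (P : Chain μ) (t : ℕ) {k : ℕ} (h : μ.colLen 0 ≤ k) :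
    P.row t k = 0 := by
  have := P.interlaces.anti_left (Nat.zero_le t) k
  rw [P.row_zero] at this
  have h0 : μ.rowLen k = 0 := by
    by_contra hne
    have := YoungDiagram.mem_iff_lt_colLen.1
      (YoungDiagram.mem_iff_lt_rowLen.2 (Nat.pos_of_ne_zero hne))
    omega
  omega

theorem mem_of_lt (P : Chain μ) {t k c : ℕ} (h : c < P.row t k) : (k, c) ∈ μ := by
  have := P.interlaces.anti_left (Nat.zero_le t) k
  rw [P.row_zero] at this
  exact YoungDiagram.mem_iff_lt_rowLen.2 (by omega)

/-- The weight of a chain, with row `-t` of the variables for step `t`. -/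
noncomputable def weight (P : Chain μ) : Series :=
  ∏ t ∈ Finset.range P.len, rowWeight (-t) (μ.colLen 0) (P.row t) (P.row (t + 1))

theorem weight_eq (P : Chain μ) {m : ℕ} (h : P.row m = 0) :
    P.weight = ∏ t ∈ Finset.range m, rowWeight (-t) (μ.colLen 0) (P.row t) (P.row (t + 1)) := by
  have key : ∀ m m', P.row m = 0 → m ≤ m' →
      ∏ t ∈ Finset.range m, rowWeight (-t) (μ.colLen 0) (P.row t) (P.row (t + 1)) =
      ∏ t ∈ Finset.range m', rowWeight (-t) (μ.colLen 0) (P.row t) (P.row (t + 1)) := by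
    intro m m' h h'
    refine Finset.prod_subset (Finset.range_subset_range.2 h') fun t _ ht => ?_
    rw [Finset.mem_range, not_lt] at ht
    exact rowWeight_of_eq_zero (P.row_eq_zero h ht) (P.row_eq_zero h (by omega))
  rw [weight, key _ (max P.len m) P.row_len (le_max_left _ _),
    key m (max P.len m) h (le_max_right _ _)]

/-- The boxes of `μ`, with the step in which they are removed. -/
noncomputable def boxSet (P : Chain μ) : Finset (ℕ × ℕ × ℕ) :=
  (Finset.range P.len ×ˢ μ.cells).filter fun b =>
    P.row (b.1 + 1) b.2.1 ≤ b.2.2 ∧ b.2.2 < P.row b.1 b.2.1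

/-- The steps `t` and rows `k` in which the last box could have been removed one step earlier. -/
noncomputable def raiseSet (P : Chain μ) : Finset (ℕ × ℕ) :=
  (Finset.range P.len ×ˢ Finset.range (μ.colLen 0)).filter fun b =>
    P.row b.1 (b.2 + 1) < P.row (b.1 + 1) b.2

theorem mem_boxSet (P : Chain μ) (t k c : ℕ) :
    (t, k, c) ∈ P.boxSet ↔ P.row (t + 1) k ≤ c ∧ c < P.row t k := by
  rw [boxSet, Finset.mem_filter, Finset.mem_product, Finset.mem_range, YoungDiagram.mem_cells]
  refine ⟨fun h => h.2, fun h => ⟨⟨?_, P.mem_of_lt h.2⟩, h⟩⟩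
  by_contra hcon
  have := P.row_eq_zero P.row_len (show P.len ≤ t by omega)
  rw [this] at h
  exact absurd h.2 (Nat.not_lt_zero _)

theorem mem_raiseSet (P : Chain μ) (t k : ℕ) :
    (t, k) ∈ P.raiseSet ↔ P.row t (k + 1) < P.row (t + 1) k := by
  rw [raiseSet, Finset.mem_filter, Finset.mem_product, Finset.mem_range, Finset.mem_range]
  refine ⟨fun h => h.2, fun h => ⟨⟨?_, ?_⟩, h⟩⟩
  · by_contra hcon
    have := P.row_eq_zero P.row_len (show P.len ≤ t + 1 by omega)
    rw [this] at h
    exact absurd h (Nat.not_lt_zero _)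
  · by_contra hcon
    have := P.row_eq_zero_of_colLen_le (t + 1) (show μ.colLen 0 ≤ k by omega)
    rw [this] at h
    exact absurd h (Nat.not_lt_zero _)

theorem weight_eq_prod (P : Chain μ) :
    P.weight = (∏ b ∈ P.boxSet, xMinusA (-b.1) (-b.1 + b.2.2 - b.2.1)) *
      ∏ b ∈ P.raiseSet,
        (1 - xMinusA (-b.1) (-b.1 + ((P.row (b.1 + 1) b.2 : ℤ) - 1) - b.2)) := by
  simp only [weight, rowWeight, Finset.prod_mul_distrib]
  congr 1
  · rw [← Finset.prod_product', Finset.prod_sigma']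
    refine Finset.prod_nbij' (fun b => (b.1.1, b.1.2, b.2)) (fun b => ⟨(b.1, b.2.1), b.2.2⟩)
      ?_ ?_ ?_ ?_ ?_
    · rintro ⟨⟨t, k⟩, c⟩ h
      simp only [Finset.mem_sigma, Finset.mem_Ico] at h
      exact (P.mem_boxSet t k c).2 h.2
    · rintro ⟨t, k, c⟩ h
      have h' := (P.mem_boxSet t k c).1 h
      rw [boxSet, Finset.mem_filter, Finset.mem_product] at h
      simp only [Finset.mem_sigma, Finset.mem_product, Finset.mem_Ico]
      refine ⟨⟨h.1.1, ?_⟩, h'⟩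
      rw [Finset.mem_range]
      by_contra hcon
      have := P.row_eq_zero_of_colLen_le t (show μ.colLen 0 ≤ k by omega)
      omega
    · rintro ⟨⟨t, k⟩, c⟩ _; rfl
    · rintro ⟨t, k, c⟩ _; rfl
    · rintro ⟨⟨t, k⟩, c⟩ _; rfl
  · rw [raiseSet, Finset.prod_filter, Finset.prod_product]

end Chain

/-! ### Tableaux and chains -/

namespace NonposTableau

variable {μ : YoungDiagram}

theorem ext' {T U : NonposTableau μ} (h : T.entry = U.entry) : T = U := by
  cases T; cases U; congr

theorem exists_not (T : NonposTableau μ) (t k : ℕ) :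
    ∃ c, ¬ ((k, c) ∈ μ ∧ T.entry (k, c) ≤ -(t : ℤ)) :=
  ⟨μ.rowLen k, fun h => absurd (YoungDiagram.mem_iff_lt_rowLen.1 h.1) (lt_irrefl _)⟩

open Classical in
/-- The number of entries of row `k` that are at most `-t`. -/
noncomputable def count (T : NonposTableau μ) (t k : ℕ) : ℕ := Nat.find (T.exists_not t k)

theorem lt_count (T : NonposTableau μ) (t k c : ℕ) :
    c < T.count t k ↔ (k, c) ∈ μ ∧ T.entry (k, c) ≤ -(t : ℤ) := by
  classical
  rw [count, Nat.lt_find_iff]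
  refine ⟨fun h => not_not.1 (h c le_rfl), fun h c' hc' => not_not.2 ?_⟩
  rcases hc'.eq_or_lt with rfl | hlt
  · exact h
  · exact ⟨μ.up_left_mem le_rfl hc' h.1, (T.semistandard.1 k c' c hlt h.1).trans h.2⟩

theorem count_le_iff (T : NonposTableau μ) (t k c : ℕ) :
    T.count t k ≤ c ↔ ((k, c) ∈ μ → -(t : ℤ) < T.entry (k, c)) := by
  rw [← not_lt, lt_count]
  push Not
  rfl

/-- The chain of the shapes formed by the entries at most `-t`. -/
noncomputable def toChain (T : NonposTableau μ) : Chain μ where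
  row := T.count
  row_zero := by
    ext k
    refine eq_of_forall_lt_iff fun c => ?_
    rw [lt_count, ← YoungDiagram.mem_iff_lt_rowLen]
    exact ⟨fun h => h.1, fun h => ⟨h, by simpa using T.nonpos _ h⟩⟩
  interlaces t k := by
    constructor
    · refine le_of_forall_lt fun c hc => ?_
      rw [lt_count] at hc ⊢
      have := T.semistandard.2 k (k + 1) c (by omega) hc.1
      exact ⟨μ.up_left_mem (by omega) le_rfl hc.1, by push_cast; omega⟩
    · refine le_of_forall_lt fun c hc => ?_
      rw [lt_count] at hc ⊢
      push_cast at hc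
      exact ⟨hc.1, by omega⟩
  exists_zero := by
    -- The sum bounds the absolute value of every entry.
    refine ⟨(∑ s ∈ μ.cells, (-T.entry s).toNat) + 1, ?_⟩
    ext k
    rw [Pi.zero_apply, ← Nat.le_zero, count_le_iff]
    intro h
    have := Finset.single_le_sum (f := fun s => (-T.entry s).toNat) (fun s _ => Nat.zero_le _)
      ((YoungDiagram.mem_cells _).2 h)
    have h' := T.nonpos _ h
    omega

theorem toChain_injective : Function.Injective (toChain (μ := μ)) := by
  intro T U h
  apply ext'
  ext ⟨k, c⟩
  by_cases hs : (k, c) ∈ μ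
  · have key : ∀ t : ℕ, T.entry (k, c) ≤ -(t : ℤ) ↔ U.entry (k, c) ≤ -(t : ℤ) := by
      intro t
      have h1 := T.lt_count t k c
      have h2 := U.lt_count t k c
      have h3 : T.count = U.count := congrArg Chain.row h
      rw [h3] at h1
      simp only [hs, true_and] at h1 h2
      exact h1.symm.trans h2
    have hT := T.nonpos _ hs
    have hU := U.nonpos _ hs
    have k1 := key (-T.entry (k, c)).toNat
    have k2 := key (-U.entry (k, c)).toNat
    omega
  · rw [T.zero_outside _ hs, U.zero_outside _ hs]

theorem toChain_surjective : Function.Surjective (toChain (μ := μ)) := by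
  classical
  intro P
  have hex : ∀ k c, ∃ t, P.row t k ≤ c := fun k c => ⟨P.len, by rw [P.row_len]; exact Nat.zero_le _⟩
  have hlt : ∀ k c t, t < Nat.find (hex k c) ↔ c < P.row t k := by
    intro k c t
    rw [Nat.lt_find_iff]
    exact ⟨fun h => not_le.1 (h t le_rfl), fun h t' ht' =>
      not_le.2 (h.trans_le (P.interlaces.anti_left ht' k))⟩
  have hpos : ∀ k c, (k, c) ∈ μ → 0 < Nat.find (hex k c) := by
    intro k c h
    rw [hlt, P.row_zero]
    exact YoungDiagram.mem_iff_lt_rowLen.1 h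
  let T : NonposTableau μ :=
    -- If t is the first index at which the box is missing, it was removed in step t - 1, so its
    -- entry is -(t - 1).
    { entry := fun s => if s ∈ μ then 1 - (Nat.find (hex s.1 s.2) : ℤ) else 0
      semistandard := by
        constructor
        · intro i j₁ j₂ hj h
          dsimp only
          rw [if_pos h, if_pos (μ.up_left_mem le_rfl hj.le h)]
          have : Nat.find (hex i j₂) ≤ Nat.find (hex i j₁) := by
            refine le_of_forall_lt fun t ht => ?_
            rw [hlt] at ht ⊢
            exact hj.trans ht
          omega
        · intro i₁ i₂ j hi h
          dsimp only
          rw [if_pos h, if_pos (μ.up_left_mem hi.le le_rfl h)]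
          have h2 := hpos _ _ h
          have : Nat.find (hex i₂ j) < Nat.find (hex i₁ j) := by
            have h3 := (hlt i₂ j (Nat.find (hex i₂ j) - 1)).1 (by omega)
            have h4 := P.interlaces.le_of_lt (Nat.find (hex i₂ j) - 1) hi
            rw [Nat.sub_add_cancel h2] at h4
            rw [hlt]
            omega
          omega
      nonpos := by
        intro s h
        rw [if_pos h]
        have := hpos _ _ h
        omega
      zero_outside := fun s h => if_neg h }
  refine ⟨T, Chain.ext' ?_⟩
  ext t k
  refine eq_of_forall_lt_iff fun c => ?_
  change c < T.count t k ↔ _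
  rw [lt_count]
  constructor
  · rintro ⟨h1, h2⟩
    rw [← hlt]
    simp only [T, if_pos h1] at h2
    omega
  · intro h
    have hs := P.mem_of_lt h
    refine ⟨hs, ?_⟩
    rw [← hlt] at h
    simp only [T, if_pos hs]
    omega

theorem le_zero_of_mem_raises (T : NonposTableau μ) {s : ℕ × ℕ} {v : ℤ} (h : v ∈ T.raises s) :
    v ≤ 0 := by
  classical
  rw [raises, Finset.mem_filter, Finset.mem_Ioc] at h
  exact h.1.2

/-- Raising the entry to -t requires three things: the box has an entry ≤ -(t + 1), its right
neighbour has an entry ≥ -t, and its lower neighbour has an entry > -t. The first two make it the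
last box of its row in the shape of entries ≤ -(t + 1). Neighbours suffice by transitivity. -/
theorem mem_raises (T : NonposTableau μ) {r c : ℕ} (hs : (r, c) ∈ μ) (t : ℕ) :
    -(t : ℤ) ∈ T.raises (r, c) ↔ T.count (t + 1) r = c + 1 ∧ T.count t (r + 1) ≤ c := by
  classical
  rw [raises, Finset.mem_filter, Finset.mem_Ioc]
  constructor
  · rintro ⟨⟨h1, -⟩, h2⟩
    refine ⟨le_antisymm ?_ ?_, ?_⟩
    · rw [count_le_iff]
      intro h
      have := h2.1 r c (c + 1) (by omega) h
      rw [Function.update_self, Function.update_of_ne (by simp)] at this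
      push_cast
      omega
    · rw [Nat.succ_le_iff, lt_count]
      push_cast
      exact ⟨hs, by omega⟩
    · rw [count_le_iff]
      intro h
      have := h2.2 r (r + 1) c (by omega) h
      rwa [Function.update_self, Function.update_of_ne (by simp)] at this
  · rintro ⟨h1, h2⟩
    have h3 := (T.lt_count (t + 1) r c).1 (by omega)
    have h4 := (T.count_le_iff (t + 1) r (c + 1)).1 h1.le
    rw [count_le_iff] at h2
    push_cast at h3 h4
    refine ⟨⟨by omega, by omega⟩, ?_, ?_⟩
    · intro i j₁ j₂ hj h
      have h0 := T.semistandard.1 i j₁ j₂ hj h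
      simp only [Function.update_apply, Prod.mk.injEq]
      split_ifs with e1 e2 e2
      · omega
      · obtain ⟨rfl, rfl⟩ := e1
        rcases (show j₂ = j₁ + 1 ∨ j₁ + 1 < j₂ by omega) with rfl | hlt
        · have := h4 h
          omega
        · have := h4 (μ.up_left_mem le_rfl hlt.le h)
          have := T.semistandard.1 i _ _ hlt h
          omega
      · obtain ⟨rfl, rfl⟩ := e2
        omega
      · exact h0
    · intro i₁ i₂ j hi h
      have h0 := T.semistandard.2 i₁ i₂ j hi h
      simp only [Function.update_apply, Prod.mk.injEq]
      split_ifs with e1 e2 e2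
      · omega
      · obtain ⟨rfl, rfl⟩ := e1
        rcases (show i₂ = i₁ + 1 ∨ i₁ + 1 < i₂ by omega) with rfl | hlt
        · exact h2 h
        · have := h2 (μ.up_left_mem hlt.le le_rfl h)
          have := T.semistandard.2 _ _ j hlt h
          omega
      · obtain ⟨rfl, rfl⟩ := e2
        omega
      · exact h0

theorem prod_boxSet_toChain (T : NonposTableau μ) {M : Type*} [CommMonoid M]
    (g : ℕ × ℕ × ℕ → M) :
    ∏ b ∈ T.toChain.boxSet, g b = ∏ s ∈ μ.cells, g ((-T.entry s).toNat, s) := by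
  have hrow : T.toChain.row = T.count := rfl
  have key : ∀ {t k c}, (t, k, c) ∈ T.toChain.boxSet → (-T.entry (k, c)).toNat = t := by
    intro t k c h
    rw [Chain.mem_boxSet, hrow, lt_count, count_le_iff] at h
    have := h.1 h.2.1
    push_cast at this
    omega
  refine Finset.prod_nbij' (fun b => b.2) (fun s => ((-T.entry s).toNat, s)) ?_ ?_ ?_ ?_ ?_
  · rintro ⟨t, k, c⟩ h
    rw [Chain.mem_boxSet] at h
    exact (YoungDiagram.mem_cells _).2 (T.toChain.mem_of_lt h.2)
  · rintro ⟨k, c⟩ h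
    rw [YoungDiagram.mem_cells] at h
    have := T.nonpos _ h
    rw [Chain.mem_boxSet, hrow, lt_count, count_le_iff]
    exact ⟨fun _ => by push_cast; omega, h, by omega⟩
  · rintro ⟨t, k, c⟩ h
    dsimp only
    rw [key h]
  · rintro ⟨k, c⟩ _; rfl
  · rintro ⟨t, k, c⟩ h
    dsimp only
    rw [key h]

theorem card_boxSet_toChain (T : NonposTableau μ) : T.toChain.boxSet.card = μ.card := by
  -- Counting is a product in multiplicative notation, so the reindexing of products also compares
  -- cardinalities.
  have := T.prod_boxSet_toChain (M := Multiplicative ℕ) fun _ => Multiplicative.ofAdd 1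
  rw [Finset.prod_const, Finset.prod_const, ← ofAdd_nsmul, ← ofAdd_nsmul] at this
  simpa using Multiplicative.ofAdd.injective this

theorem weight_toChain (T : NonposTableau μ) : T.toChain.weight = T.weight := by
  rw [Chain.weight_eq_prod, weight, Finset.prod_mul_distrib]
  have hrow : T.toChain.row = T.count := rfl
  congr 1
  · rw [prod_boxSet_toChain]
    refine Finset.prod_congr rfl fun s hs => ?_
    have := T.nonpos s ((YoungDiagram.mem_cells _).1 hs)
    rw [boxWeight, show -(((-T.entry s).toNat : ℕ) : ℤ) = T.entry s by omega]
  · rw [Finset.prod_sigma']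
    -- For each value -t and each row, only the last box of the row in the shape of entries ≤ -(t +
    -- 1) can be raised to -t.
    refine Finset.prod_bij' (fun b _ => ⟨(b.2, T.count (b.1 + 1) b.2 - 1), -(b.1 : ℤ)⟩)
      (fun s _ => ((-s.2).toNat, s.1.1)) ?_ ?_ ?_ ?_ ?_
    · rintro ⟨t, k⟩ h
      rw [Chain.mem_raiseSet, hrow] at h
      have hs := T.toChain.mem_of_lt (t := t + 1) (k := k) (c := T.count (t + 1) k - 1)
        (by rw [hrow]; omega)
      rw [Finset.mem_sigma, YoungDiagram.mem_cells]
      refine ⟨hs, ?_⟩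
      dsimp only at hs ⊢
      rw [mem_raises _ hs]
      omega
    · rintro ⟨⟨k, c⟩, v⟩ h
      rw [Finset.mem_sigma, YoungDiagram.mem_cells] at h
      obtain ⟨hs, h⟩ := h
      have hv : v ≤ 0 := T.le_zero_of_mem_raises h
      obtain ⟨t, rfl⟩ : ∃ t : ℕ, v = -(t : ℤ) := ⟨(-v).toNat, by omega⟩
      dsimp only at h hs ⊢
      rw [mem_raises _ hs] at h
      rw [neg_neg, Int.toNat_natCast, Chain.mem_raiseSet, hrow]
      omega
    · rintro ⟨t, k⟩ _
      simp
    · rintro ⟨⟨k, c⟩, v⟩ h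
      rw [Finset.mem_sigma, YoungDiagram.mem_cells] at h
      obtain ⟨hs, h⟩ := h
      have hv : v ≤ 0 := T.le_zero_of_mem_raises h
      obtain ⟨t, rfl⟩ : ∃ t : ℕ, v = -(t : ℤ) := ⟨(-v).toNat, by omega⟩
      dsimp only at h hs ⊢
      rw [mem_raises _ hs] at h
      rw [neg_neg, Int.toNat_natCast, h.1, Nat.add_sub_cancel]
    · rintro ⟨t, k⟩ h
      rw [Chain.mem_raiseSet, hrow] at h
      rw [hrow, boxWeight]
      congr 2
      dsimp only
      omega

end NonposTableau

/-! ### One row of a pipedream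

The decreasing sequences `c` and `d` list the columns of the pipes that cross the southern and the
northern boundary of the row. -/

/-- The west side of the tile in column `j` is crossed by a pipe. -/
def HasWest (c d : ℕ → ℤ) (j : ℤ) : Prop := ∃ k, c k < j ∧ ∀ k', k = k' + 1 → j ≤ d k'

/-- A pipe that enters in column `c (k + 1)` leaves in column `d k`, to the left of `c k`. -/
def Noncrossing (c d : ℕ → ℤ) : Prop := ∀ k, c (k + 1) ≤ d k ∧ d k < c k

open Classical in
/-- The tiles of a row. -/
noncomputable def rowTile (c d : ℕ → ℤ) (j : ℤ) : Tile :=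
  if ∃ k, c k = j then if ∃ k, d k = j then .vertical else .seElbow
  else if HasWest c d j then if ∃ k, d k = j then .nwElbow else .horizontal
  else .empty

section Row

variable {c d : ℕ → ℤ}

theorem Noncrossing.strictAnti (h : Noncrossing c d) : StrictAnti c :=
  strictAnti_nat_of_succ_lt fun k => (h k).1.trans_lt (h k).2

theorem Noncrossing.strictAnti' (h : Noncrossing c d) : StrictAnti d :=
  strictAnti_nat_of_succ_lt fun k => (h (k + 1)).2.trans_le (h k).1

theorem exists_between (hc : StrictAnti c) (j : ℤ) :
    c 0 ≤ j ∨ ∃ k, c (k + 1) ≤ j ∧ j < c k := by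
  have hle : ∀ k : ℕ, c k ≤ c 0 - k := by
    intro k
    induction k with
    | zero => simp
    | succ k ih =>
      have := hc (Nat.lt_add_one k)
      push_cast
      omega
  have hex : ∃ k, c k ≤ j := ⟨(c 0 - j).toNat, by have := hle (c 0 - j).toNat; omega⟩
  classical
  obtain ⟨n, hn, hmin⟩ : ∃ n, c n ≤ j ∧ ∀ k < n, ¬ c k ≤ j :=
    ⟨Nat.find hex, Nat.find_spec hex, fun k => Nat.find_min hex⟩
  rcases n with _ | n
  · exact Or.inl hn
  · exact Or.inr ⟨n, hn, not_le.1 (hmin n (by omega))⟩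

theorem exists_eq_iff_of_le (hc : StrictAnti c) {j : ℤ} (hj : c 0 ≤ j) :
    (∃ k, c k = j) ↔ j = c 0 := by
  refine ⟨?_, fun h => ⟨0, h.symm⟩⟩
  rintro ⟨k, rfl⟩
  exact le_antisymm (hc.antitone (Nat.zero_le k)) hj

theorem exists_eq_iff_of_between (hc : StrictAnti c) {j : ℤ} {k : ℕ} (h1 : c (k + 1) ≤ j)
    (h2 : j < c k) : (∃ k, c k = j) ↔ j = c (k + 1) := by
  refine ⟨?_, fun h => ⟨k + 1, h.symm⟩⟩
  rintro ⟨k', rfl⟩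
  have h3 := hc.lt_iff_gt.1 h2
  have h4 := hc.le_iff_ge.1 h1
  rw [show k' = k + 1 by omega]

theorem Noncrossing.not_exists_eq_of_le (h : Noncrossing c d) {j : ℤ} (hj : c 0 ≤ j) :
    ¬ ∃ k, d k = j := by
  rintro ⟨k, rfl⟩
  have := (h k).2
  have := h.strictAnti.antitone (Nat.zero_le k)
  omega

theorem Noncrossing.exists_eq_iff_of_between (h : Noncrossing c d) {j : ℤ} {k : ℕ}
    (h1 : c (k + 1) ≤ j) (h2 : j < c k) : (∃ k, d k = j) ↔ j = d k := by
  refine ⟨?_, fun h => ⟨k, h.symm⟩⟩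
  rintro ⟨k', rfl⟩
  have h3 := h.strictAnti.lt_iff_gt.1 ((h k').1.trans_lt h2)
  have h4 := h.strictAnti.lt_iff_gt.1 (h1.trans_lt (h k').2)
  rw [show k' = k by omega]

theorem Noncrossing.hasWest_iff_of_le (h : Noncrossing c d) {j : ℤ} (hj : c 0 ≤ j) :
    HasWest c d j ↔ c 0 < j := by
  refine ⟨?_, fun h => ⟨0, h, by omega⟩⟩
  rintro ⟨k, h1, h2⟩
  rcases k with _ | k
  · exact h1
  · have := h2 k rfl
    have := (h k).2
    have := h.strictAnti.antitone (Nat.zero_le k)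
    omega

theorem Noncrossing.hasWest_iff_of_between (h : Noncrossing c d) {j : ℤ} {k : ℕ}
    (h1 : c (k + 1) ≤ j) (h2 : j ≤ c k) : HasWest c d j ↔ c (k + 1) < j ∧ j ≤ d k := by
  constructor
  · rintro ⟨k', h3, h4⟩
    have h5 := h.strictAnti.lt_iff_gt.1 (h3.trans_le h2)
    rcases k' with _ | k'
    · omega
    · have h6 := h4 k' rfl
      have h7 := h.strictAnti.lt_iff_gt.1 ((h1.trans h6).trans_lt (h k').2)
      obtain rfl : k' = k := by omega
      exact ⟨h3, h6⟩
  · rintro ⟨h3, h4⟩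
    exact ⟨k + 1, h3, fun k' hk' => by rwa [show k' = k by omega]⟩

theorem rowTile_south (c d : ℕ → ℤ) (j : ℤ) : (rowTile c d j).south ↔ ∃ k, c k = j := by
  unfold rowTile
  split_ifs <;> simp_all [Tile.south]

theorem rowTile_ne_crossing (c d : ℕ → ℤ) (j : ℤ) : rowTile c d j ≠ .crossing := by
  unfold rowTile
  split_ifs <;> simp

theorem Noncrossing.rowTile_west (h : Noncrossing c d) (j : ℤ) :
    (rowTile c d j).west ↔ HasWest c d j := by
  have key : (∃ k, c k = j) → ¬ HasWest c d j := by
    rcases exists_between h.strictAnti j with h1 | ⟨k, h1, h2⟩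
    · rw [exists_eq_iff_of_le h.strictAnti h1, h.hasWest_iff_of_le h1]
      omega
    · rw [KStanley.exists_eq_iff_of_between h.strictAnti h1 h2, h.hasWest_iff_of_between h1 h2.le]
      omega
  unfold rowTile
  split_ifs <;> simp_all [Tile.west]

theorem Noncrossing.rowTile_north (h : Noncrossing c d) (j : ℤ) :
    (rowTile c d j).north ↔ ∃ k, d k = j := by
  have key : ¬ (∃ k, c k = j) → ¬ HasWest c d j → ¬ ∃ k, d k = j := by
    rcases exists_between h.strictAnti j with h1 | ⟨k, h1, h2⟩
    · exact fun _ _ => h.not_exists_eq_of_le h1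
    · rw [KStanley.exists_eq_iff_of_between h.strictAnti h1 h2,
        h.hasWest_iff_of_between h1 h2.le, h.exists_eq_iff_of_between h1 h2]
      omega
  unfold rowTile
  split_ifs <;> simp_all [Tile.north]

theorem Noncrossing.rowTile_east (h : Noncrossing c d) (j : ℤ) :
    (rowTile c d j).east ↔ HasWest c d (j + 1) := by
  unfold rowTile
  rcases exists_between h.strictAnti j with h1 | ⟨k, h1, h2⟩
  · rw [exists_eq_iff_of_le h.strictAnti h1, h.hasWest_iff_of_le h1,
      h.hasWest_iff_of_le (by omega), if_neg (h.not_exists_eq_of_le h1),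
      if_neg (h.not_exists_eq_of_le h1)]
    split_ifs <;> simp only [Tile.east, true_iff, false_iff] <;> omega
  · have := h k
    rw [KStanley.exists_eq_iff_of_between h.strictAnti h1 h2, h.hasWest_iff_of_between h1 h2.le,
      h.hasWest_iff_of_between (k := k) (by omega) (by omega), h.exists_eq_iff_of_between h1 h2]
    split_ifs <;> simp only [Tile.east, true_iff, false_iff] <;> omega

theorem Noncrossing.rowTile_eq_empty (h : Noncrossing c d) (j : ℤ) :
    rowTile c d j = .empty ↔ ∃ k, d k < j ∧ j < c k := by
  have key : rowTile c d j = .empty ↔ ¬ (∃ k, c k = j) ∧ ¬ HasWest c d j := by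
    unfold rowTile
    split_ifs <;> simp_all
  rw [key]
  rcases exists_between h.strictAnti j with h1 | ⟨k, h1, h2⟩
  · rw [exists_eq_iff_of_le h.strictAnti h1, h.hasWest_iff_of_le h1]
    constructor
    · omega
    · rintro ⟨k, -, h3⟩
      have := h.strictAnti.antitone (Nat.zero_le k)
      omega
  · rw [KStanley.exists_eq_iff_of_between h.strictAnti h1 h2, h.hasWest_iff_of_between h1 h2.le]
    constructor
    · have := h k
      exact fun h3 => ⟨k, by omega, h2⟩
    · rintro ⟨k', h3, h4⟩
      have h5 := h.strictAnti.lt_iff_gt.1 (h1.trans_lt h4)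
      have h6 := h.strictAnti.lt_iff_gt.1 (((h k').1.trans_lt h3).trans h2)
      obtain rfl : k' = k := by omega
      have := h k'
      omega

theorem Noncrossing.rowTile_eq_nwElbow (h : Noncrossing c d) (j : ℤ) :
    rowTile c d j = .nwElbow ↔ ∃ k, d k = j ∧ c (k + 1) < j := by
  have key : rowTile c d j = .nwElbow ↔
      ¬ (∃ k, c k = j) ∧ HasWest c d j ∧ ∃ k, d k = j := by
    unfold rowTile
    split_ifs <;> simp_all
  rw [key]
  constructor
  · rintro ⟨h1, -, k, rfl⟩
    refine ⟨k, rfl, lt_of_le_of_ne (h k).1 fun h2 => h1 ⟨k + 1, h2⟩⟩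
  · rintro ⟨k, rfl, h1⟩
    rw [KStanley.exists_eq_iff_of_between h.strictAnti h1.le (h k).2,
      h.hasWest_iff_of_between h1.le (h k).2.le]
    exact ⟨h1.ne', ⟨h1, le_rfl⟩, k, rfl⟩

/-- Here S, N and W say that a pipe crosses the south, north or west side of a tile in one row. The
local rules force each entering pipe to turn east and, before the next entry column to its right,
north. The rightmost pipe is the exception and never turns north. -/
theorem exists_noncrossing {S N W : ℤ → Prop} (h1 : ∀ j, S j → ¬ W j)
    (h2 : ∀ j, S j ∨ W j → (N j ↔ ¬ W (j + 1)))
    (h3 : ∀ j, ¬ S j → ¬ W j → ¬ N j ∧ ¬ W (j + 1)) (hE : ∃ b, ∀ j ≥ b, W j)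
    (hc : StrictAnti c) (hS : ∀ j, S j ↔ ∃ k, c k = j) :
    ∃ d, Noncrossing c d ∧ (∀ j, N j ↔ ∃ k, d k = j) ∧ ∀ j, W j ↔ HasWest c d j := by
  have hSk : ∀ k, S (c k) := fun k => (hS _).2 ⟨k, rfl⟩
  have hSn : ∀ j k, c (k + 1) < j → j < c k → ¬ S j := fun j k h4 h5 h6 => by
    rw [hS, exists_eq_iff_of_between hc h4.le h5] at h6
    omega
  have hS0 : ∀ j, c 0 < j → ¬ S j := fun j h4 h6 => by
    rw [hS, exists_eq_iff_of_le hc h4.le] at h6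
    omega
  have step : ∀ k, ∃ d, c (k + 1) ≤ d ∧ d < c k ∧
      (∀ j, c (k + 1) < j → j ≤ d → W j) ∧ ¬ W (d + 1) := by
    intro k
    -- The pipe entering in column `c (k + 1)` leaves in the first column from there on whose east
    -- side is not crossed.
    obtain ⟨d, ⟨hd1, hd2⟩, hmin⟩ := Int.exists_least_of_bdd
      (P := fun j => c (k + 1) ≤ j ∧ ¬ W (j + 1)) ⟨c (k + 1), fun z hz => hz.1⟩
      ⟨c k - 1, by have := hc (Nat.lt_add_one k); omega, by
        rw [sub_add_cancel]; exact h1 _ (hSk k)⟩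
    refine ⟨d, hd1, ?_, fun j hj hj' => ?_, hd2⟩
    · have := hmin (c k - 1) ⟨by have := hc (Nat.lt_add_one k); omega, by
        rw [sub_add_cancel]; exact h1 _ (hSk k)⟩
      omega
    · by_contra hW
      have := hmin (j - 1) ⟨by omega, by rwa [sub_add_cancel]⟩
      omega
  choose d hd1 hd2 hd3 hd4 using step
  have hnc : Noncrossing c d := fun k => ⟨hd1 k, hd2 k⟩
  have hright : ∀ k j, d k < j → j < c k → ¬ W j := by
    intro k j hj
    induction j, (show d k + 1 ≤ j by omega) using Int.leInduction with
    | base => exact fun _ => hd4 k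
    | succ j hj' ih =>
      intro hj2
      have := hd1 k
      exact (h3 j (hSn j k (by omega) (by omega)) (ih (by omega) (by omega))).2
  -- To the right of the last entry an uncrossed side would stay uncrossed for ever, contradicting
  -- the pipe that heads off to the east.
  have hfar : ∀ j, c 0 < j → W j := by
    intro j hj
    by_contra hW
    have hall : ∀ i, j ≤ i → ¬ W i := by
      intro i hi
      induction i, hi using Int.leInduction with
      | base => exact hW
      | succ i hi ih => exact (h3 i (hS0 i (by omega)) ih).2
    obtain ⟨b, hb⟩ := hE
    exact hall (max b j) (le_max_right _ _) (hb _ (le_max_left _ _))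
  have hWest : ∀ j, W j ↔ HasWest c d j := by
    intro j
    rcases exists_between hc j with h4 | ⟨k, h4, h5⟩
    · rw [hnc.hasWest_iff_of_le h4]
      refine ⟨fun hW => lt_of_le_of_ne h4 ?_, hfar j⟩
      rintro rfl
      exact h1 _ (hSk 0) hW
    · rw [hnc.hasWest_iff_of_between h4 h5.le]
      refine ⟨fun hW => ⟨lt_of_le_of_ne h4 ?_, ?_⟩, fun h => hd3 k j h.1 h.2⟩
      · rintro rfl
        exact h1 _ (hSk _) hW
      · by_contra hcon
        exact hright k j (by omega) h5 hW
  refine ⟨d, hnc, fun j => ?_, hWest⟩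
  rcases exists_between hc j with h4 | ⟨k, h4, h5⟩
  · refine iff_of_false ?_ (hnc.not_exists_eq_of_le h4)
    have h6 : S j ∨ W j := by
      rcases h4.eq_or_lt with rfl | h
      · exact Or.inl (hSk 0)
      · exact Or.inr (hfar j h)
    rw [h2 j h6, not_not]
    exact hfar _ (by omega)
  · rw [hnc.exists_eq_iff_of_between h4 h5]
    rcases lt_trichotomy j (d k) with h | rfl | h
    · have h6 : S j ∨ W j := by
        rcases h4.eq_or_lt with rfl | h'
        · exact Or.inl (hSk _)
        · exact Or.inr (hd3 k j h' h.le)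
      rw [h2 j h6]
      exact iff_of_false (not_not.2 (hd3 k _ (by omega) (by omega))) h.ne
    · have h6 : S (d k) ∨ W (d k) := by
        rcases h4.eq_or_lt with h' | h'
        · rw [← h']; exact Or.inl (hSk _)
        · exact Or.inr (hd3 k _ h' le_rfl)
      exact iff_of_true ((h2 _ h6).2 (hd4 k)) rfl
    · have := hd1 k
      exact iff_of_false (h3 j (hSn j k (by omega) h5) (hright k j h h5)).1 h.ne'

end Row

/-- A decreasing enumeration is determined by its set of values, so the crossed edges of a pipedream
determine the column sequences. -/
theorem strictAnti_ext {c d : ℕ → ℤ} (hc : StrictAnti c) (hd : StrictAnti d)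
    (h : ∀ j, (∃ k, c k = j) ↔ ∃ k, d k = j) : c = d := by
  have := (StrictMono.range_inj hc.dual_right hd.dual_right).1 (by
    ext j
    exact h (OrderDual.ofDual j))
  exact funext fun k => congrFun this k

theorem Tile.ext_sides {s t : Tile} (h1 : s.north ↔ t.north) (h2 : s.south ↔ t.south)
    (h3 : s.east ↔ t.east) (h4 : s.west ↔ t.west) : s = t := by
  cases s <;> cases t <;> simp_all [Tile.north, Tile.south, Tile.east, Tile.west]

/-! ### Pipedreams and chains -/

theorem exists_row_sub_iff (μ : YoungDiagram) (j : ℤ) :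
    (∃ k : ℕ, (μ.rowLen k : ℤ) - k = j) ↔ j ∈ grassmannianPerm μ '' Set.Iic 0 := by
  constructor
  · rintro ⟨k, rfl⟩
    refine ⟨-(k : ℤ), by simp, ?_⟩
    change grassmannianFun μ _ = _
    rw [grassmannianFun_row]
    ring
  · rintro ⟨i, hi, rfl⟩
    obtain ⟨k, rfl⟩ : ∃ k : ℕ, i = -(k : ℤ) := ⟨(-i).toNat, by
      have : i ≤ 0 := hi
      omega⟩
    refine ⟨k, ?_⟩
    change _ = grassmannianFun μ _
    rw [grassmannianFun_row]
    ring

namespace Chain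

variable {μ : YoungDiagram}

/-- The column of the pipe number `k` at the southern boundary of row `-t`. -/
def col (P : Chain μ) (t k : ℕ) : ℤ := P.row t k - t - k

theorem noncrossing (P : Chain μ) (t : ℕ) : Noncrossing (P.col t) (P.col (t + 1)) := by
  intro k
  have := P.interlaces t k
  simp only [col]
  push_cast
  omega

/-- Interlacing, iterated along an antidiagonal. It shows that if the chain is empty at step t', the
pipe that turns in row -t' runs straight up column -t' (`col_eq_neg`). -/
theorem row_add_le (P : Chain μ) (t k d : ℕ) : P.row t (k + d) ≤ P.row (t + d) k := by
  induction d generalizing t with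
  | zero => exact le_rfl
  | succ d ih =>
    have h1 := (P.interlaces t (k + d)).1
    have h2 := ih (t + 1)
    rw [show t + 1 + d = t + (d + 1) by ring] at h2
    exact h1.trans h2

theorem col_eq_neg (P : Chain μ) {t t' : ℕ} (h : t ≤ t') (h' : P.row t' = 0) :
    P.col t (t' - t) = -(t' : ℤ) := by
  have := P.row_add_le t 0 (t' - t)
  rw [zero_add, Nat.add_sub_cancel' h, h'] at this
  rw [col, Nat.le_zero.1 this]
  push_cast [h]
  ring

/-- The pipedream of a chain. -/
noncomputable def toPipedream (P : Chain μ) : HalfplanePipedream μ where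
  tile i j := if 0 < i then .empty else
    rowTile (P.col (-i).toNat) (P.col ((-i).toNat + 1)) j
  outside i j h := if_pos h
  match_horizontal i j h := by
    rw [if_neg (by omega), if_neg (by omega), (P.noncrossing _).rowTile_east,
      (P.noncrossing _).rowTile_west]
  match_vertical i j h := by
    rw [if_neg (by omega), if_neg (by omega), (P.noncrossing _).rowTile_north, rowTile_south,
      show (-(i - 1)).toNat = (-i).toNat + 1 by omega]
  far_away := by
    -- From this row upwards the chain is empty and the pipes have their standard form.
    refine ⟨-(P.len : ℤ), by omega, fun N hN => ?_⟩
    obtain ⟨t, rfl⟩ : ∃ t : ℕ, N = -(t : ℤ) := ⟨(-N).toNat, by omega⟩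
    have ht := P.row_eq_zero P.row_len (show P.len ≤ t by omega)
    have h0 : P.col t 0 = -(t : ℤ) := by simpa using P.col_eq_neg le_rfl ht
    have hnc := P.noncrossing t
    rw [neg_neg, Int.toNat_natCast]
    refine ⟨?_, fun i hi hi' => ?_, fun j hj => ?_⟩
    · rw [if_neg (by omega), rowTile, if_pos ⟨0, h0⟩, if_neg (hnc.not_exists_eq_of_le h0.le)]
    · rw [if_neg (by omega), rowTile, if_pos ⟨_, P.col_eq_neg (by omega) ht⟩,
        if_pos ⟨_, P.col_eq_neg (by omega) ht⟩]
    · rw [if_neg (by omega), rowTile, if_neg, if_pos, if_neg]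
      · exact hnc.not_exists_eq_of_le (by omega)
      · rw [hnc.hasWest_iff_of_le (by omega)]
        omega
      · rw [exists_eq_iff_of_le hnc.strictAnti (by omega)]
        omega
  no_crossing i j h := by
    rw [if_neg (by omega)]
    exact rowTile_ne_crossing _ _ _
  south_plus := by
    ext j
    have h := exists_row_sub_iff μ j
    rw [Iplus]
    simp only [Set.mem_inter_iff, Set.mem_ofPred_eq, lt_irrefl, if_false, rowTile_south, ← h,
      neg_zero, Int.toNat_zero, col, P.row_zero, Nat.cast_zero, sub_zero]
    exact and_comm
  south_minus := by
    ext j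
    have h := exists_row_sub_iff μ j
    rw [Iminus, ← Set.compl_Iic, Set.image_compl_eq (grassmannianPerm μ).bijective]
    simp only [Set.mem_inter_iff, Set.mem_sdiff, Set.mem_compl_iff, Set.mem_ofPred_eq, lt_irrefl,
      if_false, rowTile_south, ← h, neg_zero, Int.toNat_zero, col, P.row_zero, Nat.cast_zero,
      sub_zero]
  exits_east i h := by
    refine ⟨P.col (-i).toNat 0, fun j hj => ?_⟩
    rw [if_neg (by omega), (P.noncrossing _).rowTile_east,
      (P.noncrossing _).hasWest_iff_of_le (by omega)]
    omega

theorem toPipedream_tile (P : Chain μ) (t : ℕ) (j : ℤ) :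
    P.toPipedream.tile (-(t : ℤ)) j = rowTile (P.col t) (P.col (t + 1)) j := by
  simp only [toPipedream]
  rw [if_neg (by omega), neg_neg, Int.toNat_natCast]

theorem toPipedream_injective : Function.Injective (toPipedream (μ := μ)) := by
  intro P Q h
  apply Chain.ext'
  ext t k
  have hc : P.col t = Q.col t := by
    refine strictAnti_ext (P.noncrossing t).strictAnti (Q.noncrossing t).strictAnti fun j => ?_
    rw [← rowTile_south _ (P.col (t + 1)), ← rowTile_south _ (Q.col (t + 1)),
      ← toPipedream_tile, ← toPipedream_tile, h]
  have := congrFun hc k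
  simp only [col] at this
  omega

/-- The rows are read from the south: the boundary condition gives the columns at the bottom, and
`exists_noncrossing` passes them on to the next row. Noncrossing of the columns is the same as
interlacing of the shapes. -/
theorem toPipedream_surjective : Function.Surjective (toPipedream (μ := μ)) := by
  intro D
  have step : ∀ (t : ℕ) (c : ℕ → ℤ), StrictAnti c →
      (∀ j, (D.tile (-(t : ℤ)) j).south ↔ ∃ k, c k = j) → ∃ d, Noncrossing c d ∧
      (∀ j, (D.tile (-((t + 1 : ℕ) : ℤ)) j).south ↔ ∃ k, d k = j) ∧
      ∀ j, (D.tile (-(t : ℤ)) j).west ↔ HasWest c d j := by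
    intro t c hc hS
    have hH : ∀ j, (D.tile (-(t : ℤ)) j).east ↔ (D.tile (-(t : ℤ)) (j + 1)).west := fun j =>
      D.match_horizontal _ j (by omega)
    have hV : ∀ j, (D.tile (-(t : ℤ)) j).north ↔ (D.tile (-((t + 1 : ℕ) : ℤ)) j).south := fun j => by
      rw [D.match_vertical _ j (by omega)]
      congr! 2
      push_cast
      ring
    have hX : ∀ j, D.tile (-(t : ℤ)) j ≠ .crossing := fun j => D.no_crossing _ j (by omega)
    refine exists_noncrossing (fun j => ?_) (fun j => ?_) (fun j => ?_) ?_ hc hS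
    · have := hX j
      cases h : D.tile (-(t : ℤ)) j <;> simp_all [Tile.south, Tile.west]
    · rw [← hH, ← hV]
      have := hX j
      cases h : D.tile (-(t : ℤ)) j <;>
        simp_all [Tile.south, Tile.west, Tile.north, Tile.east]
    · rw [← hH, ← hV]
      cases h : D.tile (-(t : ℤ)) j <;>
        simp_all [Tile.south, Tile.west, Tile.north, Tile.east]
    · obtain ⟨b, hb⟩ := D.exits_east (-(t : ℤ)) (by omega)
      refine ⟨b + 1, fun j hj => ?_⟩
      have := (hH (j - 1)).1 (hb _ (by omega))
      rwa [sub_add_cancel] at this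
  have hanti0 : StrictAnti fun k : ℕ => (μ.rowLen k : ℤ) - k :=
    strictAnti_nat_of_succ_lt fun k => by
      have := μ.rowLen_anti k (k + 1) (by omega)
      push_cast
      omega
  have hS0 : ∀ j, (D.tile (-((0 : ℕ) : ℤ)) j).south ↔ ∃ k : ℕ, (μ.rowLen k : ℤ) - k = j := by
    intro j
    rw [exists_row_sub_iff, Nat.cast_zero, neg_zero]
    have hp := Set.ext_iff.1 D.south_plus j
    have hm := Set.ext_iff.1 D.south_minus j
    rw [Iplus] at hp
    rw [Iminus, ← Set.compl_Iic, Set.image_compl_eq (grassmannianPerm μ).bijective] at hm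
    simp only [Set.mem_inter_iff, Set.mem_sdiff, Set.mem_compl_iff, Set.mem_ofPred_eq, Set.mem_Ioi,
      Set.mem_Iic] at hp hm
    by_cases hj : 0 < j
    · simpa [hj] using hp
    · have hj' : j ≤ 0 := not_lt.1 hj
      simp only [hj', true_and] at hm
      exact not_iff_not.1 hm
  have hex : ∀ t : ℕ, ∃ c : ℕ → ℤ, StrictAnti c ∧
      ∀ j, (D.tile (-(t : ℤ)) j).south ↔ ∃ k, c k = j := by
    intro t
    induction t with
    | zero => exact ⟨_, hanti0, hS0⟩
    | succ t ih =>
      obtain ⟨c, hc1, hc2⟩ := ih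
      obtain ⟨d, hd1, hd2, -⟩ := step t c hc1 hc2
      exact ⟨d, hd1.strictAnti', hd2⟩
  choose c hc1 hc2 using hex
  have hc0 : ∀ k : ℕ, c 0 k = (μ.rowLen k : ℤ) - k := fun k =>
    congrFun (strictAnti_ext (hc1 0) hanti0 fun j => (hc2 0 j).symm.trans (hS0 j)) k
  have hnc : ∀ t, Noncrossing (c t) (c (t + 1)) ∧
      ∀ j, (D.tile (-(t : ℤ)) j).west ↔ HasWest (c t) (c (t + 1)) j := by
    intro t
    obtain ⟨d, hd1, hd2, hd3⟩ := step t (c t) (hc1 t) (hc2 t)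
    have : d = c (t + 1) :=
      strictAnti_ext hd1.strictAnti' (hc1 _) fun j => (hd2 j).symm.trans (hc2 (t + 1) j)
    rw [← this]
    exact ⟨hd1, hd3⟩
  -- This makes the would-be parts c t k + t + k nonnegative, so passing to natural numbers loses
  -- nothing.
  have hlow : ∀ t k : ℕ, -(t : ℤ) - k ≤ c t k := by
    intro t
    induction t with
    | zero => intro k; rw [hc0]; push_cast; omega
    | succ t ih =>
      intro k
      have h1 := ih (k + 1)
      have h2 := ((hnc t).1 k).1
      push_cast at h1 ⊢
      omega
  let P : Chain μ :=
    { row := fun t k => (c t k + t + k).toNat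
      row_zero := by
        ext k
        rw [hc0]
        push_cast
        omega
      interlaces := by
        intro t k
        have := (hnc t).1 k
        push_cast
        omega
      exists_zero := by
        obtain ⟨N, hN0, hN⟩ := D.far_away
        obtain ⟨t, rfl⟩ : ∃ t : ℕ, N = -(t : ℤ) := ⟨(-N).toNat, by omega⟩
        obtain ⟨h1, -, h2⟩ := hN _ le_rfl
        -- To the right of column -t the tiles of row -t are horizontal, so no pipe enters there
        -- from the south.
        have h3 : c t 0 ≤ -(t : ℤ) := by
          by_contra hcon
          have h4 := (hc2 t (c t 0)).2 ⟨0, rfl⟩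
          rw [h2 _ (by omega)] at h4
          exact h4
        refine ⟨t, funext fun k => ?_⟩
        have h5 : c t k ≤ c t 0 - k := by
          induction k with
          | zero => simp
          | succ k ih =>
            have := hc1 t (Nat.lt_add_one k)
            push_cast
            omega
        rw [Pi.zero_apply]
        omega }
  have hcol : ∀ t, P.col t = c t := by
    intro t
    funext k
    have := hlow t k
    simp only [col, P]
    omega
  refine ⟨P, ?_⟩
  have htile : P.toPipedream.tile = D.tile := by
    funext i j
    by_cases hi : 0 < i
    · rw [P.toPipedream.outside i j hi, D.outside i j hi]
    · obtain ⟨t, rfl⟩ : ∃ t : ℕ, i = -(t : ℤ) := ⟨(-i).toNat, by omega⟩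
      rw [toPipedream_tile, hcol, hcol]
      obtain ⟨h1, h2⟩ := hnc t
      refine Tile.ext_sides ?_ ?_ ?_ ?_
      · rw [h1.rowTile_north, D.match_vertical _ j (by omega), ← hc2 (t + 1)]
        congr! 2
        push_cast
        ring
      · rw [rowTile_south, ← hc2]
      · rw [h1.rowTile_east, D.match_horizontal _ j (by omega), h2]
      · rw [h1.rowTile_west, h2]
  cases D
  cases hP : P.toPipedream
  rw [hP] at htile
  congr

theorem prod_emptyTiles (P : Chain μ) (g : ℤ × ℤ → Series) :
    ∏ p ∈ P.toPipedream.emptyTiles, g p =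
      ∏ b ∈ P.boxSet, g (-(b.1 : ℤ), -(b.1 : ℤ) + b.2.2 - b.2.1) := by
  symm
  refine Finset.prod_nbij (fun b => (-(b.1 : ℤ), -(b.1 : ℤ) + b.2.2 - b.2.1)) ?_ ?_ ?_
    fun _ _ => rfl
  · rintro ⟨t, k, c⟩ h
    rw [mem_boxSet] at h
    rw [HalfplanePipedream.emptyTiles, Set.Finite.mem_toFinset]
    refine ⟨by simp, ?_⟩
    dsimp only
    rw [toPipedream_tile, (P.noncrossing t).rowTile_eq_empty]
    refine ⟨k, ?_⟩
    simp only [col]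
    push_cast
    omega
  · rintro ⟨t, k, c⟩ h ⟨t', k', c'⟩ h' heq
    rw [Finset.mem_coe, mem_boxSet] at h h'
    simp only [Prod.mk.injEq] at heq
    obtain ⟨h1, h2⟩ := heq
    obtain rfl : t = t' := by omega
    rcases lt_trichotomy k k' with hk | rfl | hk
    · have := P.interlaces.le_of_lt t hk
      omega
    · obtain rfl : c = c' := by omega
      rfl
    · have := P.interlaces.le_of_lt t hk
      omega
  · rintro ⟨i, j⟩ h
    rw [Finset.mem_coe, HalfplanePipedream.emptyTiles, Set.Finite.mem_toFinset] at h
    obtain ⟨h1, h2⟩ := h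
    dsimp only at h1 h2
    obtain ⟨t, rfl⟩ : ∃ t : ℕ, i = -(t : ℤ) := ⟨(-i).toNat, by omega⟩
    rw [toPipedream_tile, (P.noncrossing t).rowTile_eq_empty] at h2
    obtain ⟨k, h3, h4⟩ := h2
    simp only [col] at h3 h4
    push_cast at h3
    refine ⟨(t, k, (j + t + k).toNat), ?_, ?_⟩
    · rw [Finset.mem_coe, mem_boxSet]
      omega
    · simp only [Prod.mk.injEq, true_and]
      omega

theorem prod_nwElbows (P : Chain μ) (g : ℤ × ℤ → Series) :
    ∏ p ∈ P.toPipedream.nwElbows, g p =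
      ∏ b ∈ P.raiseSet, g (-(b.1 : ℤ), -(b.1 : ℤ) + ((P.row (b.1 + 1) b.2 : ℤ) - 1) - b.2) := by
  symm
  refine Finset.prod_nbij
    (fun b => (-(b.1 : ℤ), -(b.1 : ℤ) + ((P.row (b.1 + 1) b.2 : ℤ) - 1) - b.2)) ?_ ?_ ?_
    fun _ _ => rfl
  · rintro ⟨t, k⟩ h
    rw [mem_raiseSet] at h
    rw [HalfplanePipedream.nwElbows, Set.Finite.mem_toFinset]
    refine ⟨by simp, ?_⟩
    dsimp only
    rw [toPipedream_tile, (P.noncrossing t).rowTile_eq_nwElbow]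
    refine ⟨k, ?_⟩
    simp only [col]
    push_cast
    omega
  · rintro ⟨t, k⟩ h ⟨t', k'⟩ h' heq
    simp only [Prod.mk.injEq] at heq
    obtain ⟨h1, h2⟩ := heq
    obtain rfl : t = t' := by omega
    have : P.col (t + 1) k = P.col (t + 1) k' := by
      simp only [col]
      push_cast
      omega
    rw [(P.noncrossing (t + 1)).strictAnti.injective this]
  · rintro ⟨i, j⟩ h
    rw [Finset.mem_coe, HalfplanePipedream.nwElbows, Set.Finite.mem_toFinset] at h
    obtain ⟨h1, h2⟩ := h
    dsimp only at h1 h2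
    obtain ⟨t, rfl⟩ : ∃ t : ℕ, i = -(t : ℤ) := ⟨(-i).toNat, by omega⟩
    rw [toPipedream_tile, (P.noncrossing t).rowTile_eq_nwElbow] at h2
    obtain ⟨k, h3, h4⟩ := h2
    simp only [col] at h3 h4
    push_cast at h3 h4
    refine ⟨(t, k), ?_, ?_⟩
    · rw [Finset.mem_coe, mem_raiseSet]
      omega
    · simp only [Prod.mk.injEq, true_and]
      omega

/-- Empty tiles are the removed boxes, and north-west elbows are the boxes that could have been
removed. There are |λ| empty tiles, which cancels the sign. -/
theorem weight_toPipedream (P : Chain μ) :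
    (-1) ^ μ.card * P.toPipedream.weight = P.weight := by
  have hcard : P.boxSet.card = μ.card := by
    obtain ⟨T, rfl⟩ := NonposTableau.toChain_surjective P
    exact T.card_boxSet_toChain
  rw [HalfplanePipedream.weight, prod_emptyTiles, prod_nwElbows, Finset.prod_neg, hcard,
    weight_eq_prod, ← mul_assoc, ← mul_assoc, ← mul_pow, neg_one_mul, neg_neg, one_pow, one_mul]

end Chain

/-! ### The Grassmannian polynomials of intervals as sums over chains -/

section Interval

variable (μ : YoungDiagram)

theorem rowLen_eq_zero {k : ℕ} (h : μ.colLen 0 ≤ k) : μ.rowLen k = 0 := by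
  by_contra hne
  have := YoungDiagram.mem_iff_lt_colLen.1
    (YoungDiagram.mem_iff_lt_rowLen.2 (Nat.pos_of_ne_zero hne))
  omega

theorem colLen_eq_zero {c : ℕ} (h : μ.rowLen 0 ≤ c) : μ.colLen c = 0 := by
  by_contra hne
  have := YoungDiagram.mem_iff_lt_rowLen.1
    (YoungDiagram.mem_iff_lt_colLen.2 (Nat.pos_of_ne_zero hne))
  omega

theorem finite_row_eq_zero (m : ℕ) : {P : Chain μ | P.row m = 0}.Finite := by
  have h : ∀ k, max m (μ.colLen 0) ≤ k → μ.rowLen k = 0 := fun k hk =>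
    rowLen_eq_zero μ ((le_max_right _ _).trans hk)
  refine Set.Finite.of_finite_image (f := Chain.row)
    ((chains (max m (μ.colLen 0)) μ.rowLen).finite_toSet.subset ?_)
    fun P _ Q _ hPQ => Chain.ext' hPQ
  rintro _ ⟨P, hP, rfl⟩
  rw [Finset.mem_coe, mem_chains h]
  exact ⟨P.row_zero, P.interlaces, P.row_eq_zero hP (le_max_left _ _)⟩

/-- The chains that are empty after `m` steps. -/
noncomputable def chainFinset (m : ℕ) : Finset (Chain μ) := (finite_row_eq_zero μ m).toFinset

variable {μ}

theorem mem_chainFinset {m : ℕ} {P : Chain μ} : P ∈ chainFinset μ m ↔ P.row m = 0 := by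
  rw [chainFinset, Set.Finite.mem_toFinset]
  rfl

theorem shiftSeries_chainSum {m : ℕ} (hm : μ.colLen 0 ≤ m) :
    shiftSeries (-m) (chainSum m μ.rowLen) = ∑ P ∈ chainFinset μ m, P.weight := by
  have h : ∀ k, m ≤ k → μ.rowLen k = 0 := fun k hk => rowLen_eq_zero μ (hm.trans hk)
  rw [chainSum_eq le_rfl h, map_sum]
  symm
  refine Finset.sum_bij (fun P _ => P.row) (fun P hP => ?_) (fun P _ Q _ hPQ => Chain.ext' hPQ)
    (fun R hR => ?_) fun P hP => ?_
  · rw [mem_chains h]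
    exact ⟨P.row_zero, P.interlaces, mem_chainFinset.1 hP⟩
  · rw [mem_chains h] at hR
    exact ⟨⟨R, hR.1, hR.2.1, m, hR.2.2⟩, mem_chainFinset.2 hR.2.2, rfl⟩
  · rw [P.weight_eq (mem_chainFinset.1 hP), map_prod]
    refine Finset.prod_congr rfl fun t _ => ?_
    rw [shiftSeries_rowWeight, show (m : ℤ) - t + -m = -t by ring,
      rowWeight_eq_of_le hm (fun k hk => P.row_eq_zero_of_colLen_le _ hk)
        (fun k hk => P.row_eq_zero_of_colLen_le _ hk)]

theorem shiftPerm_apply (m : ℤ) (w : Equiv.Perm ℤ) (k : ℤ) :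
    shiftPerm m w k = w (k - m) + m := rfl

theorem grassmannianPerm_apply (k : ℤ) : grassmannianPerm μ k = grassmannianFun μ k := rfl

theorem grassmannianPerm_lt_of_nonpos {i j : ℤ} (h : i < j) (hj : j ≤ 0) :
    grassmannianPerm μ i < grassmannianPerm μ j := by
  obtain ⟨r, rfl⟩ : ∃ r : ℕ, i = -(r : ℤ) := ⟨(-i).toNat, by omega⟩
  obtain ⟨s, rfl⟩ : ∃ s : ℕ, j = -(s : ℤ) := ⟨(-j).toNat, by omega⟩
  rw [grassmannianPerm_apply, grassmannianPerm_apply, grassmannianFun_row, grassmannianFun_row]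
  have := μ.rowLen_anti s r (by omega)
  omega

theorem grassmannianPerm_lt_of_pos {i j : ℤ} (hi : 0 < i) (h : i < j) :
    grassmannianPerm μ i < grassmannianPerm μ j := by
  obtain ⟨r, rfl⟩ : ∃ r : ℕ, i = (r : ℤ) + 1 := ⟨(i - 1).toNat, by omega⟩
  obtain ⟨s, rfl⟩ : ∃ s : ℕ, j = (s : ℤ) + 1 := ⟨(j - 1).toNat, by omega⟩
  rw [grassmannianPerm_apply, grassmannianPerm_apply, grassmannianFun_col, grassmannianFun_col]
  have := μ.colLen_anti r s (by omega)
  omega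

theorem suppIn_shiftPerm_grassmannianPerm {p q : ℤ} (hp : (μ.colLen 0 : ℤ) ≤ 1 - p)
    (hq : (μ.rowLen 0 : ℤ) ≤ q) :
    SuppIn (q - p + 1) (shiftPerm (1 - p) (grassmannianPerm μ)) := by
  intro k hk
  rw [shiftPerm_apply]
  rw [grassmannianPerm_apply]
  rcases hk with hk | hk
  · obtain ⟨r, hr⟩ : ∃ r : ℕ, k - (1 - p) = -(r : ℤ) := ⟨(1 - p - k).toNat, by omega⟩
    rw [hr, grassmannianFun_row, rowLen_eq_zero μ (by omega)]
    omega
  · obtain ⟨r, hr⟩ : ∃ r : ℕ, k - (1 - p) = (r : ℤ) + 1 := ⟨(k - (1 - p) - 1).toNat, by omega⟩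
    rw [hr, grassmannianFun_col, colLen_eq_zero μ (by omega)]
    omega

/-- The interval has m nonpositive positions. After the shift to start at 1, the permutation has its
only possible descent at m. The right-hand side does not involve q. -/
theorem intervalGrothendieck_grassmannianPerm {m : ℕ} {q : ℤ} (hm : μ.colLen 0 ≤ m)
    (hq : (μ.rowLen 0 : ℤ) ≤ q) :
    intervalGrothendieck (1 - m) q (grassmannianPerm μ) = ∑ P ∈ chainFinset μ m, P.weight := by
  have hs : (1 : ℤ) - (1 - m) = m := by ring
  have hsupp := suppIn_shiftPerm_grassmannianPerm (μ := μ) (p := 1 - m) (q := q)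
    (by omega) hq
  rw [intervalGrothendieck, doubleGrothendieck_eq_chainSum (m := m) (l := μ.rowLen) (by omega)
    hsupp, ← shiftSeries_chainSum hm]
  · congr 1
    congr 1
    ring
  · intro i j _ hij hj
    rw [shiftPerm_apply, shiftPerm_apply]
    exact add_lt_add_left (grassmannianPerm_lt_of_nonpos (by omega) (by omega)) _
  · intro i j hi hij
    rw [shiftPerm_apply, shiftPerm_apply]
    exact add_lt_add_left (grassmannianPerm_lt_of_pos (by omega) (by omega)) _
  · exact fun k => μ.rowLen_anti _ _ (Nat.le_succ k)
  · intro k _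
    rw [shiftPerm_apply, hs, show (m : ℤ) - k - m = -(k : ℤ) by ring]
    rw [grassmannianPerm_apply]
    rw [grassmannianFun_row]
    ring

end Interval

/-! ### Convergence -/

theorem coeff_xMinusA_mul {i j : ℤ} {d : ℤ ⊕ ℤ →₀ ℕ} (hi : d (Sum.inl i) = 0)
    (hj : d (Sum.inr j) = 0) (f : Series) : MvPowerSeries.coeff d (xMinusA i j * f) = 0 := by
  rw [xMinusA, mul_assoc, sub_mul, map_sub,
    MvPowerSeries.X_dvd_iff.1 (Dvd.intro _ rfl : x i ∣ _) d hi,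
    MvPowerSeries.X_dvd_iff.1 (Dvd.intro _ rfl : a j ∣ _) d hj, sub_zero]

namespace Chain

variable {μ : YoungDiagram}

/-- The corner box is removed last, at some step t ≥ m, and has content 0. Its factor x_{-t} ⊖
a_{-t} makes every monomial of the weight involve one of these two variables. -/
theorem coeff_weight_eq_zero (P : Chain μ) {m : ℕ} (h : P.row m ≠ 0) {d : ℤ ⊕ ℤ →₀ ℕ}
    (hx : ∀ t : ℕ, m ≤ t → d (Sum.inl (-t)) = 0) (ha : ∀ t : ℕ, m ≤ t → d (Sum.inr (-t)) = 0) :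
    MvPowerSeries.coeff d P.weight = 0 := by
  obtain ⟨t, hmt, ht⟩ : ∃ t, m ≤ t ∧ (t, 0, 0) ∈ P.boxSet := by
    have h0 : P.row m 0 ≠ 0 := fun h0 => h <| by
      ext k
      exact Nat.le_zero.1 ((P.interlaces.anti_right m (Nat.zero_le k)).trans h0.le)
    have hex : ∃ s, P.row s 0 = 0 := ⟨P.len, congrFun P.row_len 0⟩
    classical
    obtain ⟨s, hs, hmin⟩ : ∃ s, P.row s 0 = 0 ∧ ∀ r < s, P.row r 0 ≠ 0 :=
      ⟨Nat.find hex, Nat.find_spec hex, fun r hr => Nat.find_min hex hr⟩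
    have hms : m < s := by
      by_contra hcon
      have := P.interlaces.anti_left (not_lt.1 hcon) 0
      omega
    obtain ⟨t, rfl⟩ : ∃ t, s = t + 1 := ⟨s - 1, by omega⟩
    exact ⟨t, by omega, (P.mem_boxSet t 0 0).2 ⟨hs.le, Nat.pos_of_ne_zero (hmin t (by omega))⟩⟩
  rw [P.weight_eq_prod, ← Finset.mul_prod_erase _ _ ht, mul_assoc]
  exact coeff_xMinusA_mul (hx t hmt) (by simpa using ha t hmt) _

theorem exists_coeff_weight_eq_zero (μ : YoungDiagram) (d : ℤ ⊕ ℤ →₀ ℕ) :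
    ∃ m : ℕ, ∀ P : Chain μ, P ∉ chainFinset μ m → MvPowerSeries.coeff d P.weight = 0 := by
  obtain ⟨m, hm⟩ : ∃ m : ℕ, ∀ v ∈ d.support, Sum.elim Int.natAbs Int.natAbs v < m :=
    ⟨d.support.sup (Sum.elim Int.natAbs Int.natAbs) + 1,
      fun v hv => Nat.lt_succ_of_le (Finset.le_sup hv)⟩
  refine ⟨m, fun P hP => P.coeff_weight_eq_zero (fun h => hP (mem_chainFinset.2 h)) ?_ ?_⟩
  · intro t ht
    by_contra hne
    have := hm _ (Finsupp.mem_support_iff.2 hne)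
    simp at this
    omega
  · intro t ht
    by_contra hne
    have := hm _ (Finsupp.mem_support_iff.2 hne)
    simp at this
    omega

theorem summable_weight (μ : YoungDiagram) : Summable (Chain.weight (μ := μ)) := by
  rw [MvPowerSeries.WithPiTopology.summable_iff_summable_coeff]
  intro d
  obtain ⟨m, hm⟩ := exists_coeff_weight_eq_zero μ d
  exact summable_of_ne_finset_zero fun P hP => hm P hP

theorem coeff_tsum_weight (μ : YoungDiagram) (d : ℤ ⊕ ℤ →₀ ℕ) :
    ∃ m : ℕ, ∀ m' ≥ m, MvPowerSeries.coeff d (∑' P : Chain μ, P.weight) =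
      MvPowerSeries.coeff d (∑ P ∈ chainFinset μ m', P.weight) := by
  obtain ⟨m, hm⟩ := exists_coeff_weight_eq_zero μ d
  refine ⟨m, fun m' hm' => ?_⟩
  have h := MvPowerSeries.WithPiTopology.hasSum_iff_hasSum_coeff.1 (summable_weight μ).hasSum d
  rw [map_sum]
  refine h.unique (hasSum_sum_of_ne_finset_zero fun P hP => hm P fun hP' => hP ?_)
  exact mem_chainFinset.2 (P.row_eq_zero (mem_chainFinset.1 hP') hm')

end Chain

variable {μ : YoungDiagram}

theorem eventually_coeff_intervalGrothendieck (μ : YoungDiagram) (d : ℤ ⊕ ℤ →₀ ℕ) :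
    ∃ m : ℕ, ∀ p q : ℤ, p ≤ 1 - m → (μ.rowLen 0 : ℤ) ≤ q →
      MvPowerSeries.coeff d (intervalGrothendieck p q (grassmannianPerm μ)) =
        MvPowerSeries.coeff d (∑' P : Chain μ, P.weight) := by
  obtain ⟨m, hm⟩ := Chain.coeff_tsum_weight μ d
  refine ⟨max m (μ.colLen 0), fun p q hp hq => ?_⟩
  obtain ⟨k, rfl⟩ : ∃ k : ℕ, p = 1 - k := ⟨(1 - p).toNat, by omega⟩
  rw [intervalGrothendieck_grassmannianPerm (by omega) hq, hm k (by omega)]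

theorem tendsto_intervalGrothendieck (μ : YoungDiagram) :
    Tendsto (fun pq : ℤ × ℤ => intervalGrothendieck pq.1 pq.2 (grassmannianPerm μ))
      (atBot ×ˢ atTop) (𝓝 (∑' P : Chain μ, P.weight)) := by
  rw [MvPowerSeries.WithPiTopology.tendsto_iff_coeff_tendsto]
  intro d
  obtain ⟨m, hm⟩ := eventually_coeff_intervalGrothendieck μ d
  refine tendsto_const_nhds.congr' ?_
  filter_upwards [(eventually_le_atBot (1 - (m : ℤ))).prod_mk
    (eventually_ge_atTop (μ.rowLen 0 : ℤ))] with pq hpq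
  exact (hm pq.1 pq.2 hpq.1 hpq.2).symm

/-! ### Symmetry of the limit -/

/-- As ℤ has characteristic 0, a vanishing derivative means that the variable does not occur. The
condition is closed under ring operations by the Leibniz rule. -/
theorem coeff_eq_zero_of_pderiv {v : ℤ ⊕ ℤ} {f : Series}
    (h : MvPowerSeries.pderiv ℤ v f = 0) {d : ℤ ⊕ ℤ →₀ ℕ} (hd : d v ≠ 0) :
    MvPowerSeries.coeff d f = 0 := by
  have h1 := MvPowerSeries.coeff_pderiv (i := v) f (d - Finsupp.single v 1)
  rw [h, map_zero, tsub_add_cancel_of_le (Finsupp.single_le_iff.2 (Nat.pos_of_ne_zero hd))] at h1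
  rcases mul_eq_zero.1 h1.symm with h2 | h2
  · exact h2
  · norm_cast at h2

/-- The power series that do not involve the variable `v`. -/
noncomputable def pderivKernel (v : ℤ ⊕ ℤ) : Subring Series where
  carrier := {f | MvPowerSeries.pderiv ℤ v f = 0}
  zero_mem' := map_zero _
  one_mem' := MvPowerSeries.pderiv_one
  add_mem' {f g} hf hg := by
    change MvPowerSeries.pderiv ℤ v _ = 0
    rw [map_add, hf, hg, add_zero]
  neg_mem' {f} hf := by
    change MvPowerSeries.pderiv ℤ v _ = 0
    rw [map_neg, hf, neg_zero]
  mul_mem' {f g} hf hg := by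
    change MvPowerSeries.pderiv ℤ v _ = 0
    rw [Derivation.leibniz, hf, hg, smul_zero, smul_zero, add_zero]

theorem xMinusA_mem_pderivKernel {i k : ℤ} (h : k ≠ i) (j : ℤ) :
    xMinusA k j ∈ pderivKernel (Sum.inl i) := by
  have hx : MvPowerSeries.pderiv ℤ (Sum.inl i) (x k) = 0 :=
    MvPowerSeries.pderiv_X_of_ne (by simpa using h)
  have ha : MvPowerSeries.pderiv ℤ (Sum.inl i) (a j) = 0 :=
    MvPowerSeries.pderiv_X_of_ne (by simp)
  have h1 := congrArg (MvPowerSeries.pderiv ℤ (Sum.inl i)) (xMinusA_mul k j)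
  rw [Derivation.leibniz, map_sub, map_sub, MvPowerSeries.pderiv_one, hx, ha, sub_zero,
    smul_zero, zero_add, smul_eq_mul] at h1
  exact (mul_eq_zero.1 h1).resolve_left (one_sub_a_ne_zero j)

theorem Chain.weight_mem_pderivKernel (P : Chain μ) {i : ℤ} (hi : 0 < i) :
    P.weight ∈ pderivKernel (Sum.inl i) := by
  rw [P.weight_eq_prod]
  exact mul_mem (prod_mem fun b _ => xMinusA_mem_pderivKernel (by omega) _)
    (prod_mem fun b _ => sub_mem (one_mem _) (xMinusA_mem_pderivKernel (by omega) _))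

theorem swapX_shiftSeries (i s : ℤ) (f : Series) :
    swapX i (shiftSeries s f) = shiftSeries s (swapX (i - s) f) := by
  have : (shiftSeries s).trans (swapX i) = (swapX (i - s)).trans (shiftSeries s) := by
    simp only [shiftSeries, swapX]
    rw [MvPowerSeries.renameEquiv_trans, MvPowerSeries.renameEquiv_trans]
    refine congrArg (MvPowerSeries.renameEquiv ℤ) (Equiv.ext fun v => ?_)
    rcases v with k | k
    · refine congrArg Sum.inl ?_
      change Equiv.swap i (i + 1) (k + s) = Equiv.swap (i - s) (i - s + 1) k + s
      simp only [Equiv.swap_apply_def]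
      split_ifs <;> omega
    · rfl
  exact DFunLike.congr_fun this f

theorem swapX_intervalGrothendieck {p q i : ℤ} (hp : (μ.colLen 0 : ℤ) ≤ 1 - p)
    (hq : (μ.rowLen 0 : ℤ) ≤ q) (hpi : p ≤ i) (hi : i < 0) :
    swapX i (intervalGrothendieck p q (grassmannianPerm μ)) =
      intervalGrothendieck p q (grassmannianPerm μ) := by
  rw [intervalGrothendieck, swapX_shiftSeries, swapX_doubleGrothendieck
    (suppIn_shiftPerm_grassmannianPerm hp hq) (by omega) (by omega)]
  rw [shiftPerm_apply, shiftPerm_apply]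
  exact add_lt_add_left (grassmannianPerm_lt_of_nonpos (by omega) (by omega)) _

theorem tsum_weight_mem_symmSeries (μ : YoungDiagram) :
    ∑' P : Chain μ, P.weight ∈ symmSeries := by
  refine ⟨fun d i hi hd => ?_, fun i hi => ?_⟩
  · obtain ⟨m, hm⟩ := Chain.coeff_tsum_weight μ d
    rw [hm m le_rfl, map_sum]
    exact Finset.sum_eq_zero fun P _ => coeff_eq_zero_of_pderiv (P.weight_mem_pderivKernel hi) hd
  · ext d
    rw [← permX_swap, coeff_permX]
    obtain ⟨m, hm⟩ := eventually_coeff_intervalGrothendieck μ d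
    obtain ⟨m', hm'⟩ := eventually_coeff_intervalGrothendieck μ
      (d.mapDomain (Equiv.sumCongr (Equiv.swap i (i + 1)) (Equiv.refl ℤ)).symm)
    -- One interval large enough for both the monomial and its image under the swap; the polynomial
    -- of that interval is symmetric.
    obtain ⟨p, hp⟩ : ∃ p : ℤ, p ≤ 1 - m ∧ p ≤ 1 - m' ∧ p ≤ 1 - μ.colLen 0 ∧ p ≤ i :=
      ⟨min (min (1 - m) (1 - m')) (min (1 - μ.colLen 0) i), by omega⟩
    rw [← hm p _ hp.1 le_rfl, ← hm' p _ hp.2.1 le_rfl, ← coeff_permX, permX_swap,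
      swapX_intervalGrothendieck (by omega) le_rfl hp.2.2.2 hi]

/-! ### Independence of the quantities `1 - x_i` over the double symmetric functions -/

theorem permX_swap_of_nonpos {f : Series} (hf : f ∈ symmSeries) {i j : ℤ} (hij : i < j)
    (hj : j ≤ 0) : permX (Equiv.swap i j) f = f := by
  induction j, (show i + 1 ≤ j by omega) using Int.leInduction with
  | base => exact hf.2 i (by omega)
  | succ j hj' ih =>
    have h : Equiv.swap i (j + 1) =
        Equiv.swap j (j + 1) * Equiv.swap i j * Equiv.swap j (j + 1) := by
      ext k
      simp only [Equiv.Perm.mul_apply, Equiv.swap_apply_def]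
      split_ifs <;> omega
    have hs : permX (Equiv.swap j (j + 1)) f = f := hf.2 j (by omega)
    rw [h, permX_mul, permX_mul, hs, ih (by omega) (by omega), hs]

/-- The series involves no variable with positive index, so permuting those has no effect. -/
theorem permX_swap_of_pos {f : Series} (hf : f ∈ symmSeries) {i j : ℤ} (hi : 0 < i)
    (hj : 0 < j) : permX (Equiv.swap i j) f = f := by
  ext d
  rw [coeff_permX]
  by_cases h : ∃ k, 0 < k ∧ d (Sum.inl k) ≠ 0
  · obtain ⟨k, hk, hd⟩ := h
    rw [hf.1 d k hk hd, hf.1 _ (Equiv.swap i j k)]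
    · simp only [Equiv.swap_apply_def]
      split_ifs <;> omega
    · rw [Finsupp.mapDomain_equiv_apply, Equiv.symm_symm, Equiv.sumCongr_apply, Sum.map_inl,
        Equiv.swap_apply_self]
      exact hd
  · push Not at h
    refine congrArg (MvPowerSeries.coeff · f) (Finsupp.ext fun v => ?_)
    rw [Finsupp.mapDomain_equiv_apply, Equiv.symm_symm]
    rcases v with k | k
    · rw [Equiv.sumCongr_apply, Sum.map_inl]
      rcases eq_or_ne k i with rfl | hki
      · rw [Equiv.swap_apply_left, h k hi, h j hj]
      · rcases eq_or_ne k j with rfl | hkj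
        · rw [Equiv.swap_apply_right, h k hj, h i hi]
        · rw [Equiv.swap_apply_of_ne_of_ne hki hkj]
    · rfl

theorem permX_swap_of_mem_symmSeries {f : Series} (hf : f ∈ symmSeries) {i j : ℤ}
    (hij : 0 < i ↔ 0 < j) : permX (Equiv.swap i j) f = f := by
  by_cases hi : 0 < i
  · exact permX_swap_of_pos hf hi (hij.1 hi)
  · rcases lt_trichotomy i j with h | rfl | h
    · exact permX_swap_of_nonpos hf h (by omega)
    · rw [Equiv.swap_self]
      exact permX_one f
    · rw [Equiv.swap_comm]
      exact permX_swap_of_nonpos hf h (by omega)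

theorem infinite_sameSign (t : Set ℤ) (ht : t.Finite) (i : ℤ) :
    {j : ℤ | (0 < i ↔ 0 < j) ∧ j ∉ t}.Infinite := by
  have : {j : ℤ | 0 < i ↔ 0 < j}.Infinite := by
    by_cases hi : 0 < i
    · exact (Set.Ioi_infinite (0 : ℤ)).mono fun j hj => ⟨fun _ => hj, fun _ => hi⟩
    · exact (Set.Iic_infinite (0 : ℤ)).mono fun j hj =>
        ⟨fun h => absurd h hi, fun h => absurd h (not_lt.2 hj)⟩
  exact this.sdiff ht

theorem permX_swap_of_mem_adjoin {t : Set ℤ} {i j : ℤ} (hij : 0 < i ↔ 0 < j) (hi : i ∉ t)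
    (hj : j ∉ t) {f : Series}
    (hf : f ∈ Algebra.adjoin symmSeries ((fun k => 1 - x k) '' t)) :
    permX (Equiv.swap i j) f = f := by
  induction hf using Algebra.adjoin_induction with
  | mem f hf =>
    obtain ⟨k, hk, rfl⟩ := hf
    rw [map_sub, map_one, permX_x, Equiv.swap_apply_of_ne_of_ne]
    · rintro rfl; exact hi hk
    · rintro rfl; exact hj hk
  | algebraMap r => exact permX_swap_of_mem_symmSeries r.2 hij
  | add f g _ _ hf hg => rw [map_add, hf, hg]
  | mul f g _ _ hf hg => rw [map_mul, hf, hg]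

/-- Suppose 1 - x_i were algebraic over the algebra generated by finitely many other 1 - x_k. The
coefficients of an equation are fixed by every swap of x_i with an unused x_j, where i and j are
both positive or both nonpositive. Hence all these 1 - x_j would be roots, and there are infinitely
many of them. -/
theorem algebraicIndependent_one_sub_x :
    AlgebraicIndependent symmSeries fun i => (1 - x i : Series) := by
  refine algebraicIndependent_of_finite_type' Subtype.val_injective fun t ht _ i hi => ?_
  rintro ⟨Q, hQ, hQi⟩
  obtain ⟨Q', hQ'⟩ : ∃ Q', Q' = Q.map
    (algebraMap (Algebra.adjoin symmSeries ((fun k => (1 - x k : Series)) '' t)) Series) :=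
      ⟨_, rfl⟩
  have hne : Q' ≠ 0 := by
    rw [hQ', Ne, Polynomial.map_eq_zero_iff Subtype.val_injective]
    exact hQ
  refine hne (Polynomial.eq_zero_of_infinite_isRoot Q' (((infinite_sameSign t ht i).image
    (f := fun j => (1 - x j : Series)) fun j _ k _ hjk => ?_).mono ?_))
  · exact x_injective (sub_right_injective hjk)
  · rintro _ ⟨j, ⟨hij, hj⟩, rfl⟩
    have hfix : Q'.map (permX (Equiv.swap i j) : Series →+* Series) = Q' := by
      ext1 n
      rw [Polynomial.coeff_map, hQ', Polynomial.coeff_map]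
      exact permX_swap_of_mem_adjoin hij hi hj (Q.coeff n).2
    have h0 : Q'.eval (1 - x i) = 0 := by
      rw [hQ', Polynomial.eval_map_algebraMap]
      exact hQi
    have h1 := congrArg (permX (Equiv.swap i j) : Series →+* Series) h0
    rw [← Polynomial.eval_map_apply, hfix, map_zero] at h1
    have h2 : (permX (Equiv.swap i j) : Series →+* Series) (1 - x i) = 1 - x j := by
      change permX (Equiv.swap i j) (1 - x i) = _
      rw [map_sub, map_one, permX_x, Equiv.swap_apply_left]
    rw [h2] at h1
    exact h1

theorem laurentMonomial_of_nonneg (u : ℤ → Seriesˣ) {n : ℤ →₀ ℤ} (hn : ∀ i, 0 ≤ n i) :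
    laurentMonomial u (Multiplicative.ofAdd n) =
      (n.mapRange Int.toNat rfl).prod fun i k => (u i : Series) ^ k := by
  rw [Finsupp.prod_mapRange_index fun i => pow_zero _]
  change ((n.prod fun i k => u i ^ k : Seriesˣ) : Series) = _
  rw [Finsupp.prod, Finsupp.prod, Units.coe_prod]
  refine Finset.prod_congr rfl fun i _ => ?_
  conv_lhs => rw [← Int.toNat_of_nonneg (hn i)]
  rw [zpow_natCast, Units.val_pow_eq_pow_val]

theorem exists_add_nonneg (S : Finset (ℤ →₀ ℤ)) : ∃ n₀ : ℤ →₀ ℤ, ∀ n ∈ S, ∀ i, 0 ≤ (n + n₀) i := by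
  classical
  induction S using Finset.induction_on with
  | empty => exact ⟨0, by simp⟩
  | insert n S _ ih =>
    obtain ⟨n₀, h⟩ := ih
    -- Enlarging the shift keeps the earlier exponents nonnegative, and -n takes care of the new
    -- one.
    refine ⟨n₀ ⊔ (-n), fun m hm i => ?_⟩
    rw [Finsupp.add_apply, Finsupp.sup_apply, Finsupp.neg_apply]
    rcases Finset.mem_insert.1 hm with rfl | hm
    · omega
    · have := h m hm i
      rw [Finsupp.add_apply] at this
      omega

theorem toSeries_apply (F : BackStableRing) :
    toSeries F = F.coeff.sum fun n b =>
      b • laurentMonomial (fun i => oneSub (Sum.inl i)) (Multiplicative.ofAdd n) :=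
  AddMonoidAlgebra.lift_apply _ _

/-- Multiplication by a Laurent monomial clears the negative exponents and turns a relation into a
polynomial relation between the 1 - x_i. -/
theorem toSeries_injective : Function.Injective toSeries := by
  rw [injective_iff_map_eq_zero]
  intro F hF
  obtain ⟨n₀, hn₀⟩ := exists_add_nonneg F.coeff.support
  obtain ⟨e, he⟩ : ∃ e : (ℤ →₀ ℤ) → ℤ →₀ ℕ, ∀ n, e n = (n + n₀).mapRange Int.toNat rfl :=
    ⟨_, fun _ => rfl⟩
  have hinj : ∀ n ∈ F.coeff.support, ∀ m ∈ F.coeff.support, e n = e m → n = m := by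
    intro n hn m hm hnm
    ext i
    have h := DFunLike.congr_fun hnm i
    have h1 := hn₀ n hn i
    have h2 := hn₀ m hm i
    rw [he, he, Finsupp.mapRange_apply, Finsupp.mapRange_apply] at h
    rw [Finsupp.add_apply] at *
    rw [Finsupp.add_apply] at *
    omega
  have hp : ∑ n ∈ F.coeff.support, MvPolynomial.monomial (e n) (F.coeff n) = 0 := by
    apply algebraicIndependent_one_sub_x.eq_zero_of_aeval_eq_zero
    rw [map_sum]
    have h := congrArg
      (· * laurentMonomial (fun i => oneSub (Sum.inl i)) (Multiplicative.ofAdd n₀)) hF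
    simp only [toSeries_apply, zero_mul, Finsupp.sum, Finset.sum_mul] at h
    rw [← h]
    refine Finset.sum_congr rfl fun n hn => ?_
    rw [smul_mul_assoc, ← map_mul, ← ofAdd_add, laurentMonomial_of_nonneg _ (hn₀ n hn), ← he,
      MvPolynomial.aeval_monomial, Algebra.smul_def]
    rfl
  classical
  ext1
  ext1 n
  by_contra hne
  have hn : n ∈ F.coeff.support := Finsupp.mem_support_iff.2 hne
  have h := congrArg (MvPolynomial.coeff (e n)) hp
  rw [MvPolynomial.coeff_sum, Finset.sum_eq_single n, MvPolynomial.coeff_monomial, if_pos rfl]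
    at h
  · exact hne h
  · intro m hm hmn
    rw [MvPolynomial.coeff_monomial, if_neg fun h => hmn (hinj m hm n hn h)]
  · exact fun h => absurd hn h

/-! ### The Grassmannian double `K`-Stanley functions -/

variable (μ : YoungDiagram)

/-- The sum over all chains, as an element of the double back stable ring. -/
noncomputable def grassmannianLimit : BackStableRing :=
  algebraMap symmSeries BackStableRing ⟨∑' P : Chain μ, P.weight, tsum_weight_mem_symmSeries μ⟩

theorem isBackStableLimit_grassmannianLimit :
    IsBackStableLimit (grassmannianPerm μ) (grassmannianLimit μ) := by
  rw [IsBackStableLimit, grassmannianLimit, toSeries.commutes]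
  exact tendsto_intervalGrothendieck μ

theorem IsBackStableLimit.unique {w : Equiv.Perm ℤ} {F F' : BackStableRing}
    (h : IsBackStableLimit w F) (h' : IsBackStableLimit w F') : F = F' :=
  toSeries_injective (tendsto_nhds_unique h h')

/-- The limit already lies in Λ̂(x‖a), over which η_a is linear, so no variable outside Λ̂(x‖a) is
left to specialize. -/
theorem grassmannianDoubleKStanley_eq_tsum :
    grassmannianDoubleKStanley μ = ∑' P : Chain μ, P.weight := by
  have h : backStableGrothendieck (grassmannianPerm μ) = grassmannianLimit μ :=
    IsBackStableLimit.unique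
      (Classical.epsilon_spec (p := IsBackStableLimit (grassmannianPerm μ))
        ⟨_, isBackStableLimit_grassmannianLimit μ⟩)
      (isBackStableLimit_grassmannianLimit μ)
  rw [grassmannianDoubleKStanley, doubleKStanley, h, grassmannianLimit, eta.commutes]
  rfl

theorem hasSum_chain_weight :
    HasSum (Chain.weight (μ := μ)) (grassmannianDoubleKStanley μ) := by
  rw [grassmannianDoubleKStanley_eq_tsum]
  exact (Chain.summable_weight μ).hasSum

end KStanley

/-- For every partition: the back stable double Grothendieck polynomial of the Grassmannian
permutation exists (the limit lies in the double back stable ring, in exactly one way), and the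
Grassmannian double `K`-Stanley function is `(-1)^|λ| ∑_D wt(D)` over the halfplane pipedreams,
and the sum of the factored weights of the semistandard tableaux with nonpositive entries. The
sums converge coefficientwise. -/
theorem mainTheorem7 (μ : YoungDiagram) :
    (∃! F : KStanley.BackStableRing,
      KStanley.IsBackStableLimit (KStanley.grassmannianPerm μ) F) ∧
    HasSum (fun D : KStanley.HalfplanePipedream μ => (-1 : KStanley.Series) ^ μ.card * D.weight)
      (KStanley.grassmannianDoubleKStanley μ) ∧
    HasSum (fun T : KStanley.NonposTableau μ => T.weight)
      (KStanley.grassmannianDoubleKStanley μ) := by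
  refine ⟨⟨_, KStanley.isBackStableLimit_grassmannianLimit μ, fun F hF =>
    hF.unique (KStanley.isBackStableLimit_grassmannianLimit μ)⟩, ?_, ?_⟩
  · rw [← (Equiv.ofBijective _ ⟨KStanley.Chain.toPipedream_injective (μ := μ),
      KStanley.Chain.toPipedream_surjective⟩).hasSum_iff]
    convert KStanley.hasSum_chain_weight μ using 1
    exact funext fun P => P.weight_toPipedream
  · rw [show (fun T : KStanley.NonposTableau μ => T.weight) = KStanley.Chain.weight ∘
        KStanley.NonposTableau.toChain from funext fun T => T.weight_toChain.symm]
    exact (Equiv.ofBijective _ ⟨KStanley.NonposTableau.toChain_injective (μ := μ),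
      KStanley.NonposTableau.toChain_surjective⟩).hasSum_iff.2 (KStanley.hasSum_chain_weight μ)
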